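/- An FM-bigraph $\langle G,\phi\rangle$ consists of a finite bipartite graph $G=(V_f,V_m,E)$ and an injective map $\phi:V_f\to\mathbb R^2$ giving the positions of the fixed vertices $V_f$; the vertices in $V_m$ are mobile. For $u\in V_m$ let $CH(u)$ be the convex hull of the points $\phi(v)$, where $v$ ranges over the neighbours of $u$. The CH intersection graph $G_{\mathsf x}$ has vertex set $V_m$, and distinct $u,w\in V_m$ are adjacent if and only if $CH(u)\cap CH(w)\neq\emptyset$. A planar 0-bend convex-hull drawing of $\langle G,\phi\rangle$ places each $u\in V_m$ at a point of $CH(u)$ and each $v\in V_f$ at $\phi(v)$, such that all vertices are at distinct points and the edges, drawn as straight-line segments, contain no vertices other than their ends and pairwise meet at most in common ends. A cactus is a connected graph in which any two distinct simple cycles share at most one vertex (for example a path, a cycle or a tree). **Theorem.** There is a polynomial-time algorithm that, given an FM-bigraph $\langle G,\phi\rangle$ such that no three points of $\phi(V_f)$ are collinear and $G_{\mathsf x}$ is a cactus, tests whether $\langle G,\phi\rangle$ has a planar 0-bend convex-hull drawing. More precisely, there is one random access machine program, using exact arithmetic ($+,-,\times,/$) and comparisons on numbers, that answers correctly on all these inputs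 and 1. for real coordinates (real RAM: unit cost for each operation on real numbers, cost proportional to the binary length for operations on natural-number registers) has running time bounded by a polynomial in $n=|V_f|+|V_m|$; 2. for rational coordinates and logarithmic cost (every operation is charged the binary length of the numbers involved) has running time bounded by a polynomial in $n$ plus the total binary length of the coordinates. -/

import Mathlib

/-! ## Drawings of FM-bigraphs -/

/-- An FM-bigraph with coordinates in `K`: fixed vertices `Fin nf` at the pairwise distinct points
`loc i`, mobile vertices `Fin nm`, and edges joining each mobile vertex `m` to the fixed vertices
in `nbr m`. -/
structure FMBigraph (K : Type) where
  nf : ℕ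
  nm : ℕ
  nbr : Fin nm → Finset (Fin nf)
  loc : Fin nf → K × K
  loc_injective : Function.Injective loc

/-- `place` describes a planar straight-line (0-bend) drawing of `G`: vertices are distinct points,
the segment of an edge contains no vertex besides its two ends, and two different edges meet at most
in a common end. -/
structure IsPlanarStraightLineDrawing {V : Type} (G : SimpleGraph V) (place : V → ℝ × ℝ) :
    Prop where
  injective : Function.Injective place
  vertex_edge : ∀ u v w, G.Adj u v → place w ∈ segment ℝ (place u) (place v) → w = u ∨ w = v
  edge_edge : ∀ u v w x, G.Adj u v → G.Adj w x → s(u, v) ≠ s(w, x) →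
    ∀ z ∈ segment ℝ (place u) (place v) ∩ segment ℝ (place w) (place x),
      ∃ y, y ∈ s(u, v) ∧ y ∈ s(w, x) ∧ z = place y

/-- A cactus: a connected graph in which any two different simple cycles share at most one vertex.
Cycles are identified with their edge sets. -/
def IsCactus {V : Type} (G : SimpleGraph V) : Prop :=
  G.Connected ∧ ∀ (u v : V) (p : G.Walk u u) (q : G.Walk v v), p.IsCycle → q.IsCycle →
    {e | e ∈ p.edges} ≠ {e | e ∈ q.edges} →
      ({x | x ∈ p.support} ∩ {x | x ∈ q.support}).Subsingleton

namespace FMBigraph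

/-- The bipartite graph underlying an FM-bigraph. -/
def graph {K : Type} (I : FMBigraph K) : SimpleGraph (Fin I.nf ⊕ Fin I.nm) :=
  SimpleGraph.fromRel fun a b => ∃ m f, f ∈ I.nbr m ∧ a = Sum.inl f ∧ b = Sum.inr m

/-- `CH(m)`: the convex hull of the neighbours of the mobile vertex `m`. -/
def hull (I : FMBigraph ℝ) (m : Fin I.nm) : Set (ℝ × ℝ) :=
  convexHull ℝ (I.loc '' {f | f ∈ I.nbr m})

/-- The CH intersection graph: the intersection graph of the sets `CH(m)`. -/
def chGraph (I : FMBigraph ℝ) : SimpleGraph (Fin I.nm) where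
  Adj u v := u ≠ v ∧ (I.hull u ∩ I.hull v).Nonempty
  symm := ⟨fun _ _ h => ⟨h.1.symm, by rw [Set.inter_comm]; exact h.2⟩⟩
  loopless := ⟨fun _ h => h.1 rfl⟩

/-- The fixed vertices are in general position: no three of them are collinear. -/
def InGeneralPosition (I : FMBigraph ℝ) : Prop :=
  ∀ i j k : Fin I.nf, i ≠ j → i ≠ k → j ≠ k → ¬ Collinear ℝ {I.loc i, I.loc j, I.loc k}

/-- There is a planar 0-bend drawing, with the fixed vertices at their given points, in which each
mobile vertex lies in the convex hull of its neighbours. -/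
def HasPlanarConvexHullDrawing (I : FMBigraph ℝ) : Prop :=
  ∃ pos : Fin I.nm → ℝ × ℝ, (∀ m, pos m ∈ I.hull m) ∧
    IsPlanarStraightLineDrawing I.graph (Sum.elim I.loc pos)

/-- A rational FM-bigraph, seen as a real one. -/
noncomputable def toReal (I : FMBigraph ℚ) : FMBigraph ℝ where
  nf := I.nf
  nm := I.nm
  nbr := I.nbr
  loc i := (((I.loc i).1 : ℝ), ((I.loc i).2 : ℝ))
  loc_injective := by
    intro i j h
    apply I.loc_injective
    simp only [Prod.mk.injEq, Rat.cast_inj] at h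
    exact Prod.ext h.1 h.2

end FMBigraph

/-! ## Random access machines

Programs work on finitely many random access arrays of natural numbers and finitely many random
access arrays of numbers from an ordered field `K`. Field arithmetic is exact. The cost of a run is
the number of operations performed, each charged `1` plus the size of its result: natural numbers
have their binary length as size, elements of `K` a size `sz`. For `K = ℝ` and `sz = 0` this is the
real RAM; for `K = ℚ` and `sz` the binary length it is the RAM with logarithmic cost. -/

/-- Memory contents: `nat a i` and `num a i` are the `i`-th entries of the arrays number `a`. -/
structure RamState (K : Type) where
  nat : ℕ → ℕ → ℕ
  num : ℕ → ℕ → K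

/-- Expressions for natural numbers; `get a i` is the `i`-th entry of array `a`. Subtraction is
truncated. -/
inductive NatExp where
  | const (n : ℕ)
  | get (a : ℕ) (i : NatExp)
  | add (e₁ e₂ : NatExp)
  | sub (e₁ e₂ : NatExp)
  | mul (e₁ e₂ : NatExp)

/-- Expressions for field elements. Only natural numbers are available as constants. -/
inductive NumExp where
  | const (n : ℕ)
  | get (a : ℕ) (i : NatExp)
  | add (e₁ e₂ : NumExp)
  | sub (e₁ e₂ : NumExp)
  | mul (e₁ e₂ : NumExp)
  | div (e₁ e₂ : NumExp)

/-- Tests. -/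
inductive BoolExp where
  | natLe (e₁ e₂ : NatExp)
  | numLe (e₁ e₂ : NumExp)
  | not (b : BoolExp)
  | and (b₁ b₂ : BoolExp)

/-- Programs; `setNat a i e` and `setNum a i e` store the value of `e` in entry `i` of array `a`. -/
inductive RamProgram where
  | skip
  | setNat (a : ℕ) (i e : NatExp)
  | setNum (a : ℕ) (i : NatExp) (e : NumExp)
  | seq (P Q : RamProgram)
  | ite (b : BoolExp) (P Q : RamProgram)
  | while (b : BoolExp) (P : RamProgram)

section Semantics

variable {K : Type} [Field K] [LinearOrder K]

def NatExp.eval (s : RamState K) : NatExp → ℕ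
  | .const n => n
  | .get a i => s.nat a (i.eval s)
  | .add e₁ e₂ => e₁.eval s + e₂.eval s
  | .sub e₁ e₂ => e₁.eval s - e₂.eval s
  | .mul e₁ e₂ => e₁.eval s * e₂.eval s

def NumExp.eval (s : RamState K) : NumExp → K
  | .const n => n
  | .get a i => s.num a (i.eval s)
  | .add e₁ e₂ => e₁.eval s + e₂.eval s
  | .sub e₁ e₂ => e₁.eval s - e₂.eval s
  | .mul e₁ e₂ => e₁.eval s * e₂.eval s
  | .div e₁ e₂ => e₁.eval s / e₂.eval s

def BoolExp.Holds (s : RamState K) : BoolExp → Prop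
  | .natLe e₁ e₂ => e₁.eval s ≤ e₂.eval s
  | .numLe e₁ e₂ => e₁.eval s ≤ e₂.eval s
  | .not b => ¬ b.Holds s
  | .and b₁ b₂ => b₁.Holds s ∧ b₂.Holds s

/-- Cost of evaluating an expression: `1` plus the size of the result, for every node. -/
def NatExp.cost (s : RamState K) : NatExp → ℕ
  | .const n => 1 + n.size
  | .get a i => 1 + (s.nat a (i.eval s)).size + i.cost s
  | .add e₁ e₂ => 1 + (e₁.eval s + e₂.eval s).size + e₁.cost s + e₂.cost s
  | .sub e₁ e₂ => 1 + (e₁.eval s - e₂.eval s).size + e₁.cost s + e₂.cost s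
  | .mul e₁ e₂ => 1 + (e₁.eval s * e₂.eval s).size + e₁.cost s + e₂.cost s

def NumExp.cost (sz : K → ℕ) (s : RamState K) : NumExp → ℕ
  | .const n => 1 + sz n
  | .get a i => 1 + sz (s.num a (i.eval s)) + i.cost s
  | .add e₁ e₂ => 1 + sz (e₁.eval s + e₂.eval s) + e₁.cost sz s + e₂.cost sz s
  | .sub e₁ e₂ => 1 + sz (e₁.eval s - e₂.eval s) + e₁.cost sz s + e₂.cost sz s
  | .mul e₁ e₂ => 1 + sz (e₁.eval s * e₂.eval s) + e₁.cost sz s + e₂.cost sz s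
  | .div e₁ e₂ => 1 + sz (e₁.eval s / e₂.eval s) + e₁.cost sz s + e₂.cost sz s

def BoolExp.cost (sz : K → ℕ) (s : RamState K) : BoolExp → ℕ
  | .natLe e₁ e₂ => 1 + e₁.cost s + e₂.cost s
  | .numLe e₁ e₂ => 1 + e₁.cost sz s + e₂.cost sz s
  | .not b => 1 + b.cost sz s
  | .and b₁ b₂ => 1 + b₁.cost sz s + b₂.cost sz s

/-- Overwrite entry `i` of array `a` of natural numbers. -/
def RamState.setNat (s : RamState K) (a i v : ℕ) : RamState K :=
  { s with nat := Function.update s.nat a (Function.update (s.nat a) i v) }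

/-- Overwrite entry `i` of array `a` of field elements. -/
def RamState.setNum (s : RamState K) (a i : ℕ) (v : K) : RamState K :=
  { s with num := Function.update s.num a (Function.update (s.num a) i v) }

/-- `Runs sz P s s' t`: started in `s`, the program `P` halts in `s'`, and the run costs `t`. -/
inductive Runs (sz : K → ℕ) : RamProgram → RamState K → RamState K → ℕ → Prop
  | skip (s : RamState K) : Runs sz .skip s s 1
  | setNat (a : ℕ) (i e : NatExp) (s : RamState K) :
      Runs sz (.setNat a i e) s (s.setNat a (i.eval s) (e.eval s)) (1 + i.cost s + e.cost s)
  | setNum (a : ℕ) (i : NatExp) (e : NumExp) (s : RamState K) :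
      Runs sz (.setNum a i e) s (s.setNum a (i.eval s) (e.eval s)) (1 + i.cost s + e.cost sz s)
  | seq {P Q : RamProgram} {s s' s'' : RamState K} {t t' : ℕ} :
      Runs sz P s s' t → Runs sz Q s' s'' t' → Runs sz (.seq P Q) s s'' (t + t')
  | ite_true {b : BoolExp} {P Q : RamProgram} {s s' : RamState K} {t : ℕ} :
      b.Holds s → Runs sz P s s' t → Runs sz (.ite b P Q) s s' (1 + b.cost sz s + t)
  | ite_false {b : BoolExp} {P Q : RamProgram} {s s' : RamState K} {t : ℕ} :
      ¬ b.Holds s → Runs sz Q s s' t → Runs sz (.ite b P Q) s s' (1 + b.cost sz s + t)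
  | while_false {b : BoolExp} {P : RamProgram} {s : RamState K} :
      ¬ b.Holds s → Runs sz (.while b P) s s (1 + b.cost sz s)
  | while_true {b : BoolExp} {P : RamProgram} {s s' s'' : RamState K} {t t' : ℕ} :
      b.Holds s → Runs sz P s s' t → Runs sz (.while b P) s' s'' t' →
        Runs sz (.while b P) s s'' (1 + b.cost sz s + t + t')

/-- Started in `s`, the program `P` halts with cost at most `T` and answers whether `A` is true:
the output (entry `2` of array `0` of natural numbers) is `1` if it is and `0` otherwise. -/
def AnswersWithin (sz : K → ℕ) (P : RamProgram) (s : RamState K) (T : ℕ) (A : Prop) : Prop :=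
  ∃ s' t, Runs sz P s s' t ∧ t ≤ T ∧ ((A ∧ s'.nat 0 2 = 1) ∨ (¬ A ∧ s'.nat 0 2 = 0))

/-- The initial memory for an FM-bigraph. Natural numbers: array `0` starts with `nf, nm`, array `1`
holds the adjacency matrix (entry `m * nf + f` is `1` if `f` is a neighbour of `m`, and `0` if not).
Field elements: arrays `0` and `1` hold the two coordinates of the fixed vertices. All else is `0`.
-/
def FMBigraph.input (I : FMBigraph K) : RamState K where
  nat a i :=
    if a = 0 ∧ i = 0 then I.nf
    else if a = 0 ∧ i = 1 then I.nm
    else if a = 1 ∧ ∃ (m : Fin I.nm) (f : Fin I.nf), f ∈ I.nbr m ∧ i = m * I.nf + f then 1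
    else 0
  num a i :=
    if h : i < I.nf then
      if a = 0 then (I.loc ⟨i, h⟩).1 else if a = 1 then (I.loc ⟨i, h⟩).2 else 0
    else 0

end Semantics

/-- Binary length of a rational number, written as a reduced fraction. -/
def ratSize (q : ℚ) : ℕ := q.num.natAbs.size + q.den.size

/-- Number of vertices plus the total binary length of the coordinates. -/
def FMBigraph.bitSize (I : FMBigraph ℚ) : ℕ :=
  I.nf + I.nm + ∑ i, (ratSize (I.loc i).1 + ratSize (I.loc i).2)

/-! The positions of the mobile vertices are discretised, and the resulting finite constraint
problem is solved by path consistency, which is complete because the constraint graph is a cactus.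

Geometry. A drawing amounts to a family of stars, one per mobile vertex with its neighbours as
leaves, such that each centre lies in the hull of its leaves, no edge contains a fixed point other
than its leaf, and different stars meet only in common leaves (`exists_centres`,
`hasPlanarConvexHullDrawing_of_centres`). Consider the arrangement of all lines through two fixed
points. While a centre moves in an open cell contained in the hull of its leaves, it does not change
whether its star touches another one: touching and not touching are both open conditions, the former
because a centre lying on a foreign edge has leaves strictly on both sides of it
(`eventually_starsTouch`, `not_starsTouch_of_mem_openCell`). A centre with at least three leaves can
be nudged to a generic point inside a triangle of leaves; its cell is then bounded and contains the
centroid of three of its corners. A star with two leaves is a segment wherever its centre is. So the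
vertices can be moved one by one to candidates from a list of length `nf ^ 12`
(`exists_special_family`), and general position makes plain sign tests exact there
(`exists_candidates`).

Combinatorics. It remains to choose a candidate for each mobile vertex subject to unary and binary
constraints. Stars lie in the hulls, so only constraints along edges of the CH intersection graph
matter for building a drawing (`hasPlanarConvexHullDrawing_of_tests`). The program starts with the
table of all compatible pairs of nodes (vertex, candidate) and deletes pairs that do not extend to
some third vertex. All pairs taken from a solution survive. Conversely, a nonempty consistent table
over a cactus yields a solution, grown by one bridge or one cycle at a time; along a cycle,
consistency is always used relative to the vertex where the cycle closes
(`exists_solution_of_pathConsistent`).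

Running time. Numbers are produced by a constant number of field operations from the input, so all
memories stay below a fixed power of the input size. Hence each step has polynomial cost
(`exists_stepCostLe`), and the steps are counted separately (`Within`). One argument covers real and
logarithmic cost, through `SizeBound` and a strictly increasing ring homomorphism into ℝ. -/

open Set Filter Topology

/-! ## Plane geometry -/

section PlaneField

variable {K : Type} [Field K]

/-- Twice the signed area of the triangle `p q r`. -/
def orient (p q r : K × K) : K := (q.1 - p.1) * (r.2 - p.2) - (q.2 - p.2) * (r.1 - p.1)

/-- The inner product of `p - f` and `c - f`. -/
def dotAt (f p c : K × K) : K := (p.1 - f.1) * (c.1 - f.1) + (p.2 - f.2) * (c.2 - f.2)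

/-- The intersection of the lines `ab` and `cd`; it is `a` if `a = b = c = d`. -/
def lineInter (a b c d : K × K) : K × K :=
  (a.1 + orient c d a / (orient c d a - orient c d b) * (b.1 - a.1),
   a.2 + orient c d a / (orient c d a - orient c d b) * (b.2 - a.2))

def centroid3 (p q r : K × K) : K × K :=
  ((p.1 + q.1 + r.1) / 3, (p.2 + q.2 + r.2) / 3)

end PlaneField

section PlaneOrdered

variable {K : Type} [Field K] [LinearOrder K]

/-- A test for disjointness of the segments `pa` and `qb`: one of them lies strictly on one side of
the line through the other. -/
def Separated (p a q b : K × K) : Prop :=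
  0 < orient p a q * orient p a b ∨ 0 < orient q b p * orient q b a

end PlaneOrdered

section PlaneReal

lemma orient_swap (p q r : ℝ × ℝ) : orient q p r = - orient p q r := by simp only [orient]; ring

lemma orient_rotate (p q r : ℝ × ℝ) : orient q r p = orient p q r := by simp only [orient]; ring

lemma orient_comb (p q r s : ℝ × ℝ) {α β : ℝ} (h : α + β = 1) :
    orient p q (α • r + β • s) = α * orient p q r + β * orient p q s := by
  obtain rfl : α = 1 - β := by linarith
  simp only [orient, Prod.fst_add, Prod.snd_add, Prod.smul_fst, Prod.smul_snd, smul_eq_mul]; ring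

lemma orient_self_right (p q : ℝ × ℝ) : orient p q q = 0 := by simp only [orient]; ring

lemma orient_self_outer (p q : ℝ × ℝ) : orient p q p = 0 := by simp only [orient]; ring

lemma orient_self_left (p q : ℝ × ℝ) : orient p p q = 0 := by simp only [orient]; ring

lemma collinear_iff_orient (p q r : ℝ × ℝ) : Collinear ℝ {p, q, r} ↔ orient p q r = 0 := by
  rw [collinear_iff_of_mem (p₀ := p) (by simp)]
  constructor
  · rintro ⟨v, hv⟩
    obtain ⟨s, hs⟩ := hv q (by simp)
    obtain ⟨t, ht⟩ := hv r (by simp)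
    rw [hs, ht]
    simp [orient]; ring
  · intro h
    by_cases hpq : q = p
    · refine ⟨r - p, ?_⟩
      simp only [mem_insert_iff, mem_singleton_iff, forall_eq_or_imp, forall_eq]
      exact ⟨⟨0, by simp⟩, ⟨0, by simp [hpq]⟩, ⟨1, by simp⟩⟩
    · refine ⟨q - p, ?_⟩
      simp only [mem_insert_iff, mem_singleton_iff, forall_eq_or_imp, forall_eq]
      refine ⟨⟨0, by simp⟩, ⟨1, by simp⟩, ?_⟩
      simp only [orient] at h
      by_cases h1 : q.1 = p.1
      · have h2 : q.2 - p.2 ≠ 0 := fun h2 => hpq (Prod.ext h1 (by linarith))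
        refine ⟨(r.2 - p.2) / (q.2 - p.2), Prod.ext ?_ ?_⟩
        · simp [h1] at h ⊢
          rcases h with h | h
          · exact absurd h h2
          · linarith
        · simp; field_simp; ring
      · have h2 : q.1 - p.1 ≠ 0 := sub_ne_zero.2 h1
        refine ⟨(r.1 - p.1) / (q.1 - p.1), Prod.ext ?_ ?_⟩
        · simp; field_simp; ring
        · simp; field_simp; linarith

lemma continuous_orient {X : Type*} [TopologicalSpace X] {p q r : X → ℝ × ℝ} (hp : Continuous p)
    (hq : Continuous q) (hr : Continuous r) : Continuous fun x => orient (p x) (q x) (r x) := by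
  unfold orient; fun_prop

/-- At a common point, the affine function cutting out either line vanishes, yet it would be a
convex combination of two nonzero values of the same sign. -/
lemma Separated.disjoint {p a q b : ℝ × ℝ} (h : Separated p a q b) :
    Disjoint (segment ℝ p a) (segment ℝ q b) := by
  rw [Set.disjoint_left]
  rintro z ⟨α, β, hα, hβ, h1, rfl⟩ ⟨γ, δ, hγ, hδ, h2, hz⟩
  have e1 : γ * orient p a q + δ * orient p a b = 0 := by
    rw [← orient_comb _ _ _ _ h2, hz, orient_comb _ _ _ _ h1, orient_self_outer, orient_self_right]
    simp
  have e2 : α * orient q b p + β * orient q b a = 0 := by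
    rw [← orient_comb _ _ _ _ h1, ← hz, orient_comb _ _ _ _ h2, orient_self_outer,
      orient_self_right]
    simp
  have key : ∀ x y s t : ℝ, 0 ≤ s → 0 ≤ t → s + t = 1 → s * x + t * y = 0 → ¬ 0 < x * y := by
    intro x y s t hs ht hst he hxy
    rcases mul_pos_iff.1 hxy with ⟨hx, hy⟩ | ⟨hx, hy⟩
    · rcases hs.eq_or_lt with rfl | hs'
      · have : t = 1 := by linarith
        subst this; linarith
      · have := mul_pos hs' hx
        have := mul_nonneg ht hy.le
        linarith
    · rcases hs.eq_or_lt with rfl | hs'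
      · have : t = 1 := by linarith
        subst this; linarith
      · have := mul_neg_of_pos_of_neg hs' hx
        have := mul_nonpos_of_nonneg_of_nonpos ht hy.le
        linarith
  rcases h with h | h
  · exact key _ _ _ _ hγ hδ h2 e1 h
  · exact key _ _ _ _ hα hβ h1 e2 h

/-- These are the weights at which an affine function with end values `x` and `y` vanishes. If both
values are zero, division by zero makes both weights zero. -/
lemma div_mem_unit {x y : ℝ} (h : x * y ≤ 0) : 0 ≤ x / (x - y) ∧ 0 ≤ -y / (x - y) := by
  rcases le_total 0 x with hx | hx
  · rcases hx.eq_or_lt with rfl | hx'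
    · simp only [zero_div, le_refl, true_and, zero_sub]
      rcases eq_or_ne (-y) 0 with h0 | h0 <;> simp [h0]
    · have hy : y ≤ 0 := by by_contra hy; push Not at hy; nlinarith
      exact ⟨div_nonneg hx (by linarith), div_nonneg (by linarith) (by linarith)⟩
  · rcases hx.eq_or_lt with rfl | hx'
    · simp only [zero_div, le_refl, true_and, zero_sub]
      rcases eq_or_ne (-y) 0 with h0 | h0 <;> simp [h0]
    · have hy : 0 ≤ y := by by_contra hy; push Not at hy; nlinarith
      exact ⟨div_nonneg_of_nonpos hx (by linarith), div_nonneg_of_nonpos (by linarith) (by linarith)⟩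

/-- The common point is given by Cramer's rule. The second hypothesis excludes four collinear
points, where the sign test fails even for disjoint segments. -/
lemma exists_mem_inter_of_not_separated {p a q b : ℝ × ℝ} (h : ¬ Separated p a q b)
    (hn : orient p a b ≠ 0 ∨ orient p a q ≠ 0) :
    ∃ z, z ∈ segment ℝ p a ∧ z ∈ segment ℝ q b := by
  simp only [Separated, not_or, not_lt] at h
  obtain ⟨hA, hC⟩ := h
  -- Both sides are the cross product of the directions `a - p` and `b - q`. If it vanished, `q` and
  -- `b` would be on the same side of the line `pa`, hence on it, against `hn`.
  have hΔ : orient p a b - orient p a q = orient q b p - orient q b a := by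
    simp only [orient]; ring
  have h0 : orient q b p - orient q b a ≠ 0 := by
    rw [← hΔ]
    intro h0
    have h1 : orient p a q = orient p a b := by linarith
    rw [h1] at hA hn
    have : orient p a b = 0 := by nlinarith
    simp [this] at hn
  obtain ⟨t1, t2⟩ := div_mem_unit hC
  obtain ⟨s1, s2⟩ := div_mem_unit hA
  have h0' : orient p a q - orient p a b ≠ 0 := fun h => h0 (by linarith)
  refine ⟨(-orient q b a / (orient q b p - orient q b a)) • p +
    (orient q b p / (orient q b p - orient q b a)) • a, ⟨_, _, t2, t1, by field_simp; ring, rfl⟩,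
    ⟨_, _, s2, s1, by field_simp; ring, ?_⟩⟩
  have e : orient p a q - orient p a b = -(orient q b p - orient q b a) := by linarith
  rw [e]
  have e' : orient p a b = orient p a q + (orient q b p - orient q b a) := by linarith
  generalize hD : orient q b p - orient q b a = Δ at *
  ext
  · simp
    field_simp
    simp only [orient]; ring
  · simp
    field_simp
    simp only [orient]; ring

lemma exists_mem_inter_of_not_separated' {p a q b : ℝ × ℝ} (h : ¬ Separated p a q b)
    (hn : orient q b a ≠ 0 ∨ orient q b p ≠ 0) :
    ∃ z, z ∈ segment ℝ p a ∧ z ∈ segment ℝ q b := by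
  have h' : ¬ Separated q b p a := fun h' => h h'.symm
  obtain ⟨z, h1, h2⟩ := exists_mem_inter_of_not_separated h' hn
  exact ⟨z, h2, h1⟩

/-- A point of the open triangle or segment pokes through: near a configuration with `z` inside the
segment `xy` and `c₁`, `c₂` on different sides of it, one of the segments `zc₁`, `zc₂` meets the
segment `xy`. -/
lemma eventually_inter_of_mem_openSegment {x y z c₁ c₂ : ℝ × ℝ} (hz : z ∈ openSegment ℝ x y)
    (h1 : 0 < orient x y c₁) (h2 : orient x y c₂ < 0) :
    ∀ᶠ w : (ℝ × ℝ) × (ℝ × ℝ) in 𝓝 (x, z),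
      (0 < orient w.1 y c₁ ∧ ∃ u, u ∈ segment ℝ w.2 c₁ ∧ u ∈ segment ℝ w.1 y) ∨
      (orient w.1 y c₂ < 0 ∧ ∃ u, u ∈ segment ℝ w.2 c₂ ∧ u ∈ segment ℝ w.1 y) := by
  obtain ⟨α, β, hα, hβ, hαβ, rfl⟩ := hz
  -- The line through `z` and `c` leaves `x` and `y` strictly on different sides, and this survives
  -- small motions.
  have opp : ∀ c, orient x y c ≠ 0 → orient (α • x + β • y) c x * orient (α • x + β • y) c y < 0 := by
    intro c hc
    have e1 : orient (α • x + β • y) c x = β * orient x y c := by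
      obtain rfl : α = 1 - β := by linarith
      simp only [orient, Prod.fst_add, Prod.snd_add, Prod.smul_fst, Prod.smul_snd, smul_eq_mul]
      ring
    have e2 : orient (α • x + β • y) c y = - (α * orient x y c) := by
      obtain rfl : β = 1 - α := by linarith
      simp only [orient, Prod.fst_add, Prod.snd_add, Prod.smul_fst, Prod.smul_snd, smul_eq_mul]
      ring
    rw [e1, e2]
    have := mul_pos (mul_pos hα hβ) (mul_self_pos.2 hc)
    nlinarith
  have ev : ∀ f : (ℝ × ℝ) × (ℝ × ℝ) → ℝ, Continuous f → f (x, α • x + β • y) < 0 →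
      ∀ᶠ w in 𝓝 (x, α • x + β • y), f w < 0 := fun f hf h => hf.continuousAt.eventually_lt_const h
  have a1 := ev (fun w => orient w.2 c₁ w.1 * orient w.2 c₁ y)
    ((continuous_orient continuous_snd continuous_const continuous_fst).mul
      (continuous_orient continuous_snd continuous_const continuous_const)) (opp c₁ h1.ne')
  have a2 := ev (fun w => orient w.2 c₂ w.1 * orient w.2 c₂ y)
    ((continuous_orient continuous_snd continuous_const continuous_fst).mul
      (continuous_orient continuous_snd continuous_const continuous_const)) (opp c₂ h2.ne)
  have a3 := ev (fun w => - orient w.1 y c₁)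
    (continuous_orient continuous_fst continuous_const continuous_const).neg (by simpa using h1)
  have a4 := ev (fun w => orient w.1 y c₂)
    (continuous_orient continuous_fst continuous_const continuous_const) h2
  filter_upwards [a1, a2, a3, a4] with w b1 b2 b3 b4
  have b3' : 0 < orient w.1 y c₁ := by linarith
  -- Whichever side of the moved line the moved point falls on, the segment to the `c` on the other
  -- side crosses back.
  rcases le_total (orient w.1 y w.2) 0 with hs | hs
  · left
    refine ⟨b3', exists_mem_inter_of_not_separated' ?_ (Or.inl b3'.ne')⟩
    rintro (h | h)
    · linarith
    · nlinarith
  · right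
    refine ⟨b4, exists_mem_inter_of_not_separated' ?_ (Or.inl b4.ne)⟩
    rintro (h | h)
    · linarith
    · nlinarith

/-- A point of a convex hull at which an affine function vanishes sees points of both signs, unless
the function has at most one zero among the generating points. -/
lemma exists_pos_of_mem_convexHull {ι : Type*} (s : Finset ι) (g : ι → ℝ × ℝ) {q : ℝ × ℝ}
    (hq : q ∈ convexHull ℝ (g '' {i | i ∈ s})) (ℓ : ℝ × ℝ → ℝ)
    (hℓ : ∀ (x y : ℝ × ℝ) (a b : ℝ), a + b = 1 → ℓ (a • x + b • y) = a * ℓ x + b * ℓ y)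
    (h0 : ℓ q = 0) (e : ℝ × ℝ) (hqe : q ≠ e) (he : ∀ i ∈ s, ℓ (g i) = 0 → g i = e) :
    ∃ i ∈ s, 0 < ℓ (g i) := by
  by_contra hcon
  push Not at hcon
  -- An open half plane together with at most one boundary point is convex: a proper mixture lies on
  -- the boundary line only if both of its ends do.
  have hc : Convex ℝ {x | ℓ x < 0 ∨ (ℓ x = 0 ∧ x = e)} := by
    rintro x hx y hy a b ha hb hab
    rw [Set.mem_ofPred_eq, hℓ _ _ _ _ hab]
    rcases ha.eq_or_lt with rfl | ha'
    · obtain rfl : b = 1 := by linarith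
      simpa using hy
    rcases hb.eq_or_lt with rfl | hb'
    · obtain rfl : a = 1 := by linarith
      simpa using hx
    rcases hx with hx | ⟨hx, rfl⟩ <;> rcases hy with hy | ⟨hy, rfl⟩
    · left; nlinarith
    · left; rw [hy]; nlinarith
    · left; rw [hx]; nlinarith
    · right; rw [hx]; exact ⟨by ring, Convex.combo_self hab _⟩
  have : q ∈ {x | ℓ x < 0 ∨ (ℓ x = 0 ∧ x = e)} := by
    refine convexHull_min ?_ hc hq
    rintro _ ⟨i, hi, rfl⟩
    rcases (hcon i hi).lt_or_eq with h | h
    · exact Or.inl h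
    · exact Or.inr ⟨h, he i hi h⟩
  rcases this with h | h
  · exact absurd h0 h.ne
  · exact hqe h.2

/-- The signed areas of the three subtriangles, divided by the total area, are the barycentric
coordinates. The point `a` is treated apart because the join description of the hull divides by the
weight of the opposite side. -/
lemma mem_convexHull_triangle {a b c z : ℝ × ℝ} (h1 : 0 ≤ orient a b z) (h2 : 0 ≤ orient b c z)
    (h3 : 0 ≤ orient c a z) (h : 0 < orient a b c) : z ∈ convexHull ℝ {a, b, c} := by
  have hsum : orient a b z + orient b c z + orient c a z = orient a b c := by
    simp only [orient]; ring
  rw [convexHull_insert (by simp), convexHull_pair]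
  rw [mem_convexJoin]
  by_cases h23 : orient c a z + orient a b z = 0
  · refine ⟨a, rfl, b, left_mem_segment _ _ _, ?_⟩
    have e1 : orient a b z = 0 := by linarith
    have e3 : orient c a z = 0 := by linarith
    have : z = a := by
      simp only [orient] at e1 e3 h
      have k1 : (z.1 - a.1) * ((b.1 - a.1) * (c.2 - a.2) - (b.2 - a.2) * (c.1 - a.1)) = 0 := by
        linear_combination (c.1 - a.1) * e1 + (b.1 - a.1) * e3
      have k2 : (z.2 - a.2) * ((b.1 - a.1) * (c.2 - a.2) - (b.2 - a.2) * (c.1 - a.1)) = 0 := by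
        linear_combination (c.2 - a.2) * e1 + (b.2 - a.2) * e3
      rcases mul_eq_zero.1 k1 with k1 | k1
      · rcases mul_eq_zero.1 k2 with k2 | k2
        · exact Prod.ext (by linarith) (by linarith)
        · linarith
      · linarith
    rw [this]; exact left_mem_segment _ _ _
  · have hpos : 0 < orient c a z + orient a b z := lt_of_le_of_ne (by linarith) (Ne.symm h23)
    refine ⟨a, rfl, (orient c a z / (orient c a z + orient a b z)) • b +
      (orient a b z / (orient c a z + orient a b z)) • c,
      ⟨_, _, by positivity, by positivity, by field_simp, rfl⟩,
      orient b c z / orient a b c, (orient c a z + orient a b z) / orient a b c, by positivity,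
      by positivity, by field_simp; linarith, ?_⟩
    ext
    · simp; field_simp; simp only [orient]; ring
    · simp; field_simp; simp only [orient]; ring

end PlaneReal

/-! ### Stars: touching is constant on the cells of the line arrangement. -/

section Stars

variable {ι : Type} {loc : ι → ℝ × ℝ}

/-- `p` lies on no line through two of the points `loc i`. -/
def IsGeneric (loc : ι → ℝ × ℝ) (p : ℝ × ℝ) : Prop :=
  ∀ f g, f ≠ g → orient (loc f) (loc g) p ≠ 0

/-- The cell of `p` in the arrangement of all lines through two of the points `loc i`. -/
def openCell (loc : ι → ℝ × ℝ) (p : ℝ × ℝ) : Set (ℝ × ℝ) :=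
  {z | ∀ f g, f ≠ g → 0 < orient (loc f) (loc g) p * orient (loc f) (loc g) z}

/-- The star with centre `p` and leaves `A` meets the star with centre `q` and leaves `B` outside
common leaves. -/
def StarsTouch (loc : ι → ℝ × ℝ) (A : Finset ι) (p : ℝ × ℝ) (B : Finset ι) (q : ℝ × ℝ) : Prop :=
  ∃ a ∈ A, ∃ b ∈ B, a ≠ b ∧ ∃ z, z ∈ segment ℝ p (loc a) ∧ z ∈ segment ℝ q (loc b)

/-- `p` is in the hull of the points of `A`, and its star contains no point `loc i` besides the
leaves. -/
structure IsStarCentre (loc : ι → ℝ × ℝ) (A : Finset ι) (p : ℝ × ℝ) : Prop where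
  mem_hull : p ∈ convexHull ℝ (loc '' {i | i ∈ A})
  notMem_segment : ∀ a ∈ A, ∀ f, f ≠ a → loc f ∉ segment ℝ p (loc a)

lemma StarsTouch.symm {A B : Finset ι} {p q : ℝ × ℝ} (h : StarsTouch loc A p B q) :
    StarsTouch loc B q A p := by
  obtain ⟨a, ha, b, hb, hab, z, h1, h2⟩ := h
  exact ⟨b, hb, a, ha, hab.symm, z, h2, h1⟩

lemma IsGeneric.ne {p : ℝ × ℝ} (h : IsGeneric loc p) {f g : ι} (hfg : f ≠ g) : p ≠ loc f := by
  rintro rfl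
  exact h f g hfg (orient_self_outer _ _)

lemma orient_ne_of_generic {p : ℝ × ℝ} (h : IsGeneric loc p) {a b : ι} (hab : a ≠ b) :
    orient p (loc a) (loc b) ≠ 0 := by
  rw [← orient_rotate]; exact h a b hab

lemma mem_openCell_self {p : ℝ × ℝ} (h : IsGeneric loc p) : p ∈ openCell loc p :=
  fun f g hfg => mul_self_pos.2 (h f g hfg)

lemma isGeneric_of_mem_openCell {p z : ℝ × ℝ} (h : z ∈ openCell loc p) : IsGeneric loc z :=
  fun f g hfg h0 => by simpa [h0] using h f g hfg

lemma convex_openCell (p : ℝ × ℝ) : Convex ℝ (openCell loc p) := by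
  intro x hx y hy a b ha hb hab f g hfg
  rw [orient_comb _ _ _ _ hab]
  have h1 := hx f g hfg
  have h2 := hy f g hfg
  rcases ha.eq_or_lt with rfl | ha'
  · obtain rfl : b = 1 := by linarith
    simpa using h2
  · nlinarith [mul_pos ha' h1, mul_nonneg hb h2.le]

lemma isOpen_openCell [Finite ι] (p : ℝ × ℝ) : IsOpen (openCell loc p) := by
  simp only [openCell, Set.ofPred_forall]
  refine isOpen_iInter_of_finite fun f => isOpen_iInter_of_finite fun g =>
    isOpen_iInter_of_finite fun _ => ?_
  exact isOpen_lt continuous_const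
    (continuous_const.mul (continuous_orient continuous_const continuous_const continuous_id))

/-- A generic centre is never collinear with two leaves, so disjoint edges pass the strict sign
test, and strict inequalities persist. -/
lemma eventually_not_starsTouch [Finite ι] {A B : Finset ι} {p q : ℝ × ℝ} (hp : IsGeneric loc p)
    (h : ¬ StarsTouch loc A p B q) : ∀ᶠ p' in 𝓝 p, ¬ StarsTouch loc A p' B q := by
  have hsep : ∀ a b, a ∈ A → b ∈ B → a ≠ b → ∀ᶠ p' in 𝓝 p, Separated p' (loc a) q (loc b) := by
    intro a b ha hb hab
    have : Separated p (loc a) q (loc b) := by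
      by_contra hs
      obtain ⟨z, h1, h2⟩ := exists_mem_inter_of_not_separated hs
        (Or.inl (orient_ne_of_generic hp hab))
      exact h ⟨a, ha, b, hb, hab, z, h1, h2⟩
    rcases this with h | h
    · have c : Continuous fun p' => orient p' (loc a) q * orient p' (loc a) (loc b) :=
        (continuous_orient continuous_id continuous_const continuous_const).mul
          (continuous_orient continuous_id continuous_const continuous_const)
      filter_upwards [c.continuousAt.eventually_const_lt h] with p' h'
      exact Or.inl h'
    · have c : Continuous fun p' => orient q (loc b) p' * orient q (loc b) (loc a) :=
        (continuous_orient continuous_const continuous_const continuous_id).mul continuous_const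
      filter_upwards [c.continuousAt.eventually_const_lt h] with p' h'
      exact Or.inr h'
  have hall : ∀ᶠ p' in 𝓝 p, ∀ a b, a ∈ A → b ∈ B → a ≠ b → Separated p' (loc a) q (loc b) := by
    simpa only [eventually_all] using hsep
  filter_upwards [hall] with p' hp' ⟨a, ha, b, hb, hab, z, h1, h2⟩
  exact Set.disjoint_left.1 (hp' a b ha hb hab).disjoint h1 h2

/-- This serves both degenerate contacts, the fixed centre on an edge of the moving star and the
reverse; hence the end `y` and the poking point `z` are arbitrary functions of the moving centre. -/
lemma eventually_starsTouch_of_poke {A B : Finset ι} {q : ℝ × ℝ} {l : ι}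
    {p : ℝ × ℝ} {y z : ℝ × ℝ → ℝ × ℝ} {C : Finset ι}
    (hy : ContinuousAt y p) (hz : ContinuousAt z p)
    (hmem : z p ∈ openSegment ℝ (y p) (loc l))
    {c₁ c₂ : ι} (h1 : 0 < orient (y p) (loc l) (loc c₁)) (h2 : orient (y p) (loc l) (loc c₂) < 0)
    (hc₁ : c₁ ∈ C) (hc₂ : c₂ ∈ C)
    (hT : ∀ p', ∀ c ∈ C, c ≠ l → (∃ u, u ∈ segment ℝ (z p') (loc c) ∧
      u ∈ segment ℝ (y p') (loc l)) → StarsTouch loc A p' B q) :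
    ∀ᶠ p' in 𝓝 p, StarsTouch loc A p' B q := by
  have h := (hy.prodMk hz).eventually (eventually_inter_of_mem_openSegment hmem h1 h2)
  filter_upwards [h] with p' hp'
  rcases hp' with ⟨h, hu⟩ | ⟨h, hu⟩
  · exact hT p' c₁ hc₁ (by rintro rfl; simp [orient_self_right] at h) hu
  · exact hT p' c₂ hc₂ (by rintro rfl; simp [orient_self_right] at h) hu

/-- A centre on a line is balanced by leaves on both sides, unless it sits at the only leaf that the
line may contain. -/
lemma exists_opposite_of_mem_hull {B : Finset ι} {x q : ℝ × ℝ} {l : ι} {y : ℝ × ℝ}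
    (hq : q ∈ convexHull ℝ (loc '' {i | i ∈ B}))
    (h0 : orient x y q = 0) (hql : q ≠ loc l)
    (he : ∀ b ∈ B, orient x y (loc b) = 0 → b = l) :
    (∃ b ∈ B, 0 < orient x y (loc b)) ∧ ∃ b ∈ B, orient x y (loc b) < 0 := by
  constructor
  · exact exists_pos_of_mem_convexHull B loc hq (fun z => orient x y z)
      (fun _ _ _ _ h => orient_comb _ _ _ _ h) h0 (loc l) hql (fun b hb h => by rw [he b hb h])
  · obtain ⟨b, hb, h⟩ := exists_pos_of_mem_convexHull B loc hq (fun z => - orient x y z)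
      (fun _ _ _ _ h => by rw [orient_comb _ _ _ _ h]; ring) (by simpa using h0) (loc l) hql
      (fun b hb h => by rw [he b hb (by simpa using h)])
    exact ⟨b, hb, by linarith⟩

/-- A proper crossing is stable. If one centre lies on an edge of the other star, it has leaves
strictly on both sides of that edge, so whichever way it is pushed off, one of its own edges still
crosses. A leaf on a foreign edge, the one unstable contact, is excluded by genericity of `p` and by
the hypothesis on `q`. -/
lemma eventually_starsTouch {A B : Finset ι} {p q : ℝ × ℝ}
    (hp : IsGeneric loc p) (hpA : p ∈ convexHull ℝ (loc '' {i | i ∈ A}))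
    (hq : IsStarCentre loc B q) (hpq : p ≠ q) (h : StarsTouch loc A p B q) :
    ∀ᶠ p' in 𝓝 p, StarsTouch loc A p' B q := by
  obtain ⟨a, ha, b, hb, hab, z, hz1, hz2⟩ := h
  have hns : ¬ Separated p (loc a) q (loc b) := fun h => Set.disjoint_left.1 h.disjoint hz1 hz2
  have hB : orient p (loc a) (loc b) ≠ 0 := orient_ne_of_generic hp hab
  have hns' := hns
  simp only [Separated, not_or, not_lt] at hns
  obtain ⟨hAB, hCD⟩ := hns
  have hqa : q ≠ loc a := by
    rintro rfl
    exact hq.notMem_segment b hb a hab (left_mem_segment _ _ _)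
  have hΔ : orient p (loc a) (loc b) - orient p (loc a) q =
      orient q (loc b) p - orient q (loc b) (loc a) := by simp only [orient]; ring
  by_cases hA0 : orient p (loc a) q = 0
  -- The segment `qb` leaves the line `pa` at `q`, because `b` is off that line; so the contact
  -- point is `q`.
  · have hqz : q ∈ segment ℝ p (loc a) := by
      obtain ⟨γ, δ, hγ, hδ, h1, rfl⟩ := hz2
      obtain ⟨α, β, hα, hβ, h2, e⟩ := hz1
      have e1 := orient_comb p (loc a) q (loc b) h1
      rw [← e, orient_comb _ _ _ _ h2, orient_self_outer, orient_self_right, hA0] at e1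
      have : δ = 0 := by
        have : δ * orient p (loc a) (loc b) = 0 := by linarith
        exact (mul_eq_zero.1 this).resolve_right hB
      subst this
      obtain rfl : γ = 1 := by linarith
      exact ⟨α, β, hα, hβ, h2, by simpa using e⟩
    have hqo : q ∈ openSegment ℝ p (loc a) := mem_openSegment_of_ne_left_right hpq hqa.symm hqz
    obtain ⟨⟨b₁, hb₁, h1⟩, b₂, hb₂, h2⟩ := exists_opposite_of_mem_hull (l := a) hq.mem_hull hA0 hqa
      (fun b' _ h0 => by
        by_contra hne
        exact orient_ne_of_generic hp (Ne.symm hne) h0)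
    refine eventually_starsTouch_of_poke (y := fun p' => p') (z := fun _ => q) (C := B)
      continuousAt_id continuousAt_const hqo h1 h2 hb₁ hb₂ ?_
    rintro p' c hc hca ⟨u, hu1, hu2⟩
    exact ⟨a, ha, c, hc, hca.symm, u, hu2, hu1⟩
  -- The mirror image: `p` lies on the edge `qb`, and the edges of the moving star do the poking.
  by_cases hC0 : orient q (loc b) p = 0
  · have hD0 : orient q (loc b) (loc a) ≠ 0 := by
      intro hD0
      rw [hC0, hD0] at hΔ
      have : orient p (loc a) q = orient p (loc a) (loc b) := by linarith
      rw [this] at hAB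
      exact hB (by nlinarith)
    have hpz : p ∈ segment ℝ q (loc b) := by
      obtain ⟨γ, δ, hγ, hδ, h1, rfl⟩ := hz1
      obtain ⟨α, β, hα, hβ, h2, e⟩ := hz2
      have e1 := orient_comb q (loc b) p (loc a) h1
      rw [← e, orient_comb _ _ _ _ h2, orient_self_outer, orient_self_right, hC0] at e1
      have : δ = 0 := by
        have : δ * orient q (loc b) (loc a) = 0 := by linarith
        exact (mul_eq_zero.1 this).resolve_right hD0
      subst this
      obtain rfl : γ = 1 := by linarith
      exact ⟨α, β, hα, hβ, h2, by simpa using e⟩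
    have hpb : p ≠ loc b := hp.ne hab.symm
    have hpo : p ∈ openSegment ℝ q (loc b) := mem_openSegment_of_ne_left_right hpq.symm hpb.symm hpz
    have hzero : ∀ a' ∈ A, orient q (loc b) (loc a') = 0 → a' = b := by
      intro a' _ h0
      by_contra hne
      obtain ⟨α, β, hα, hβ, h2, rfl⟩ := hpo
      have := orient_ne_of_generic hp (Ne.symm hne)
      apply this
      obtain rfl : α = 1 - β := by linarith
      have : orient ((1 - β) • q + β • loc b) (loc b) (loc a') =
          (1 - β) * orient q (loc b) (loc a') := by
        simp only [orient, Prod.fst_add, Prod.snd_add, Prod.smul_fst, Prod.smul_snd, smul_eq_mul]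
        ring
      rw [this, h0, mul_zero]
    obtain ⟨⟨a₁, ha₁, h1⟩, a₂, ha₂, h2⟩ := exists_opposite_of_mem_hull (l := b) hpA hC0 hpb hzero
    refine eventually_starsTouch_of_poke (y := fun _ => q) (z := fun p' => p') (C := A)
      continuousAt_const continuousAt_id hpo h1 h2 ha₁ ha₂ ?_
    rintro p' c hc hca ⟨u, hu1, hu2⟩
    exact ⟨c, hc, b, hb, hca, u, hu1, hu2⟩
  -- The contact point would be the leaf `a`, which the star of `q` avoids.
  by_cases hD0 : orient q (loc b) (loc a) = 0
  · exfalso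
    refine hq.notMem_segment b hb a hab ?_
    obtain ⟨γ, δ, hγ, hδ, h1, rfl⟩ := hz1
    obtain ⟨α, β, hα, hβ, h2, e⟩ := hz2
    have e1 := orient_comb q (loc b) p (loc a) h1
    rw [← e, orient_comb _ _ _ _ h2, orient_self_outer, orient_self_right, hD0] at e1
    have : γ = 0 := by
      have : γ * orient q (loc b) p = 0 := by linarith
      exact (mul_eq_zero.1 this).resolve_right hC0
    subst this
    obtain rfl : δ = 1 := by linarith
    exact ⟨α, β, hα, hβ, h2, by simpa using e⟩
  -- All four orientations are nonzero, so the edges cross properly.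
  have c1 : Continuous fun p' => orient p' (loc a) q * orient p' (loc a) (loc b) :=
    (continuous_orient continuous_id continuous_const continuous_const).mul
      (continuous_orient continuous_id continuous_const continuous_const)
  have c2 : Continuous fun p' => orient q (loc b) p' * orient q (loc b) (loc a) :=
    (continuous_orient continuous_const continuous_const continuous_id).mul continuous_const
  have s1 := c1.continuousAt.eventually_lt_const (lt_of_le_of_ne hAB (mul_ne_zero hA0 hB))
  have s2 := c2.continuousAt.eventually_lt_const (lt_of_le_of_ne hCD (mul_ne_zero hC0 hD0))
  filter_upwards [s1, s2] with p' h1 h2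
  obtain ⟨u, hu⟩ := exists_mem_inter_of_not_separated' (p := p') (a := loc a) (q := q) (b := loc b)
    (by rintro (h | h) <;> linarith) (Or.inl hD0)
  exact ⟨a, ha, b, hb, hab, u, hu⟩

/-- Touching and not touching are both open along the segment, and a segment is connected. The
centre `q` has to be avoided because stability of touching is known only for different centres. -/
lemma starsTouch_of_segment [Finite ι] {A B : Finset ι} {p p' q : ℝ × ℝ}
    (hp : ∀ x ∈ segment ℝ p p', IsGeneric loc x ∧ x ∈ convexHull ℝ (loc '' {i | i ∈ A}))
    (hq : IsStarCentre loc B q) (hqs : q ∉ segment ℝ p p') (h : StarsTouch loc A p' B q) :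
    StarsTouch loc A p B q := by
  by_contra hcon
  have hconn : IsPreconnected (segment ℝ p p') := (convex_segment p p').isPreconnected
  obtain ⟨x, hx, h1, h2⟩ := hconn (interior {x | StarsTouch loc A x B q})
    (interior {x | ¬ StarsTouch loc A x B q}) isOpen_interior isOpen_interior
    (by
      intro x hx
      obtain ⟨hg, hc⟩ := hp x hx
      by_cases ht : StarsTouch loc A x B q
      · left
        rw [mem_interior_iff_mem_nhds]
        exact eventually_starsTouch hg hc hq (fun e => hqs (e ▸ hx)) ht
      · right
        rw [mem_interior_iff_mem_nhds]
        exact eventually_not_starsTouch hg ht)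
    ⟨p', right_mem_segment _ _ _, by
      rw [mem_interior_iff_mem_nhds]
      have := hp p' (right_mem_segment _ _ _)
      exact eventually_starsTouch this.1 this.2 hq
        (fun e => hqs (e ▸ right_mem_segment _ _ _)) h⟩
    ⟨p, left_mem_segment _ _ _, by
      rw [mem_interior_iff_mem_nhds]
      exact eventually_not_starsTouch (hp p (left_mem_segment _ _ _)).1 hcon⟩
  have h2' : x ∈ {x | ¬ StarsTouch loc A x B q} := interior_subset h2
  have h1' : x ∈ {x | StarsTouch loc A x B q} := interior_subset h1
  exact h2' h1'

lemma dense_orient_ne {q x : ℝ × ℝ} (hx' : q ≠ x) : Dense {r : ℝ × ℝ | orient q x r ≠ 0} := by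
  have hx := hx'.symm
  intro r
  rw [mem_closure_iff_seq_limit]
  by_cases h0 : orient q x r = 0
  · refine ⟨fun n => r + (1 / ((n : ℝ) + 1)) • (-(x.2 - q.2), x.1 - q.1), fun n => ?_, ?_⟩
    · have hn : (0 : ℝ) < 1 / ((n : ℝ) + 1) := by positivity
      have : orient q x (r + (1 / ((n : ℝ) + 1)) • (-(x.2 - q.2), x.1 - q.1)) =
          orient q x r + (1 / ((n : ℝ) + 1)) * ((x.1 - q.1) ^ 2 + (x.2 - q.2) ^ 2) := by
        simp [orient]; ring
      simp only [mem_ofPred_eq, this, h0, zero_add]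
      refine mul_ne_zero hn.ne' fun h => hx (Prod.ext ?_ ?_)
      · nlinarith [sq_nonneg (x.1 - q.1), sq_nonneg (x.2 - q.2)]
      · nlinarith [sq_nonneg (x.1 - q.1), sq_nonneg (x.2 - q.2)]
    · have := (tendsto_one_div_add_atTop_nhds_zero_nat (𝕜 := ℝ)).smul_const
        ((-(x.2 - q.2), x.1 - q.1) : ℝ × ℝ)
      simpa using this.const_add r
  · exact ⟨fun _ => r, fun _ => h0, tendsto_const_nhds⟩

/-- The complements of the lines `qp` and `qp'` are dense, the first one also open, so the open set
`C` has a point off both lines; the broken line through it misses `q`. -/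
lemma exists_detour {C : Set (ℝ × ℝ)} (hC : IsOpen C) {p p' q : ℝ × ℝ}
    (hp' : p' ∈ C) (hqp : p ≠ q) (hqp' : p' ≠ q) :
    ∃ r ∈ C, q ∉ segment ℝ p r ∧ q ∉ segment ℝ r p' := by
  have key : ∀ x : ℝ × ℝ, x ≠ q → ∀ r, orient q x r ≠ 0 → q ∉ segment ℝ x r := by
    rintro x hx r hr ⟨α, β, hα, hβ, h, e⟩
    have := orient_comb q x x r h
    rw [e, orient_self_right, orient_self_outer] at this
    have hβ0 : β = 0 := by
      have : β * orient q x r = 0 := by linarith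
      exact (mul_eq_zero.1 this).resolve_right hr
    subst hβ0
    obtain rfl : α = 1 := by linarith
    exact hx (by simpa using e)
  have dense : ∀ x : ℝ × ℝ, x ≠ q → Dense {r : ℝ × ℝ | orient q x r ≠ 0} :=
    fun x hx => dense_orient_ne hx.symm
  have ho : IsOpen {r : ℝ × ℝ | orient q p r ≠ 0} :=
    isOpen_ne_fun (continuous_orient continuous_const continuous_const continuous_id)
      continuous_const
  obtain ⟨r, hrC, h1, h2⟩ := ((dense p hqp).inter_of_isOpen_left (dense p' hqp') ho).inter_open_nonempty
    C hC ⟨p', hp'⟩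
  exact ⟨r, hrC, key p hqp r h1, by rw [segment_symm]; exact key p' hqp' r h2⟩

lemma starsTouch_of_openCell_ne [Finite ι] {A B : Finset ι} {p p' q : ℝ × ℝ}
    (hp : IsGeneric loc p) (hcell : openCell loc p ⊆ convexHull ℝ (loc '' {i | i ∈ A}))
    (hp' : p' ∈ openCell loc p)
    (hq : IsStarCentre loc B q) (hne : p ≠ q) (hne' : p' ≠ q) (h : StarsTouch loc A p' B q) :
    StarsTouch loc A p B q := by
  obtain ⟨r, hr, h1, h2⟩ := exists_detour (isOpen_openCell p) hp' hne hne'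
  have hseg : ∀ x y, x ∈ openCell loc p → y ∈ openCell loc p → ∀ z ∈ segment ℝ x y,
      IsGeneric loc z ∧ z ∈ convexHull ℝ (loc '' {i | i ∈ A}) := by
    intro x y hx hy z hz
    have := (convex_openCell p).segment_subset hx hy hz
    exact ⟨isGeneric_of_mem_openCell this, hcell this⟩
  exact starsTouch_of_segment (hseg _ _ (mem_openCell_self hp) hr) hq h1
    (starsTouch_of_segment (hseg _ _ hr hp') hq h2 h)

/-- Whether two stars touch does not change when the centre of one of them moves in its cell. -/
lemma not_starsTouch_of_mem_openCell [Finite ι] {A B : Finset ι} {p p' q : ℝ × ℝ}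
    (hp : IsGeneric loc p) (hcell : openCell loc p ⊆ convexHull ℝ (loc '' {i | i ∈ A}))
    (hp' : p' ∈ openCell loc p) (hA : 1 < A.card) (hB : B.Nonempty)
    (hq : IsStarCentre loc B q) (h : ¬ StarsTouch loc A p B q) :
    ¬ StarsTouch loc A p' B q := by
  obtain ⟨b, hb⟩ := hB
  obtain ⟨a, ha, hab⟩ := A.exists_mem_ne hA b
  have hne : p ≠ q := by
    rintro rfl
    exact h ⟨a, ha, b, hb, hab, p, left_mem_segment _ _ _, left_mem_segment _ _ _⟩
  -- If `q` were in the cell, `p` could be moved within the cell to a point of the edge `qb` close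
  -- to `q`. There the stars touch, and touching is carried back to `p`.
  have hqC : q ∉ openCell loc p := by
    intro hqC
    have hqb : q ≠ loc b := by
      rintro e
      exact isGeneric_of_mem_openCell hqC b a hab.symm (by rw [e, orient_self_outer])
    have hlim : Tendsto (fun n : ℕ => q + (1 / ((n : ℝ) + 1)) • (loc b - q)) atTop (𝓝 q) := by
      have := (tendsto_one_div_add_atTop_nhds_zero_nat (𝕜 := ℝ)).smul_const (loc b - q)
      simpa using this.const_add q
    obtain ⟨n, hn⟩ := (hlim.eventually ((isOpen_openCell p).mem_nhds hqC)).exists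
    have hn0 : (0 : ℝ) < 1 / ((n : ℝ) + 1) := by positivity
    have hn1 : 1 / ((n : ℝ) + 1) ≤ 1 := by
      rw [div_le_one (by positivity)]; linarith [(Nat.cast_nonneg n : (0 : ℝ) ≤ n)]
    refine h (starsTouch_of_openCell_ne hp hcell hn hq hne ?_ ?_)
    · intro e
      have : (1 / ((n : ℝ) + 1)) • (loc b - q) = 0 := by simpa using e
      rcases smul_eq_zero.1 this with h | h
      · exact hn0.ne' h
      · exact hqb (sub_eq_zero.1 h).symm
    · refine ⟨a, ha, b, hb, hab, _, left_mem_segment _ _ _, ?_⟩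
      refine ⟨1 - 1 / ((n : ℝ) + 1), 1 / ((n : ℝ) + 1), by linarith, hn0.le, by ring, ?_⟩
      module
  exact fun h' => h (starsTouch_of_openCell_ne hp hcell hp' hq hne (fun e => hqC (e ▸ hp')) h')

end Stars

/-! ### Candidate points: every bounded cell contains one. -/

section Candidates

variable {ι : Type} {loc : ι → ℝ × ℝ}

/-- The intersection point of two lines through points `loc i`, or one of these points. -/
def IsVertexPoint {K : Type} [Field K] (loc : ι → K × K) (z : K × K) : Prop :=
  ∃ a b c d, z = lineInter (loc a) (loc b) (loc c) (loc d)

/-- The candidates for positions of mobile vertices. -/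
def IsCandidate {K : Type} [Field K] (loc : ι → K × K) (z : K × K) : Prop :=
  ∃ u v w, IsVertexPoint loc u ∧ IsVertexPoint loc v ∧ IsVertexPoint loc w ∧ z = centroid3 u v w

lemma isVertexPoint_self (a : ι) : IsVertexPoint loc (loc a) :=
  ⟨a, a, a, a, by simp [lineInter]⟩

lemma eq_lineInter {a b c d z : ℝ × ℝ} (h1 : orient a b z = 0) (h2 : orient c d z = 0)
    (h : orient c d a - orient c d b ≠ 0) : z = lineInter a b c d := by
  simp only [orient] at h1 h2 h
  ext
  · simp only [lineInter, orient]
    rw [← sub_eq_iff_eq_add', div_mul_eq_mul_div, eq_div_iff h]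
    linear_combination (d.1 - c.1) * h1 + (a.1 - b.1) * h2
  · simp only [lineInter, orient]
    rw [← sub_eq_iff_eq_add', div_mul_eq_mul_div, eq_div_iff h]
    linear_combination (d.2 - c.2) * h1 + (a.2 - b.2) * h2

/-- The closed cell of `p` in the arrangement of all lines through two of the points `loc i`. -/
def closedCell (loc : ι → ℝ × ℝ) (p : ℝ × ℝ) : Set (ℝ × ℝ) :=
  {z | ∀ f g, f ≠ g → 0 ≤ orient (loc f) (loc g) p * orient (loc f) (loc g) z}

lemma openCell_subset_closedCell (p : ℝ × ℝ) : openCell loc p ⊆ closedCell loc p :=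
  fun _ hz f g hfg => (hz f g hfg).le

lemma convex_closedCell (p : ℝ × ℝ) : Convex ℝ (closedCell loc p) := by
  intro x hx y hy a b ha hb hab f g hfg
  rw [orient_comb _ _ _ _ hab]
  have h1 := hx f g hfg
  have h2 := hy f g hfg
  nlinarith [mul_nonneg ha h1, mul_nonneg hb h2]

lemma isClosed_closedCell (p : ℝ × ℝ) : IsClosed (closedCell loc p) := by
  simp only [closedCell, Set.ofPred_forall]
  refine isClosed_iInter fun f => isClosed_iInter fun g => isClosed_iInter fun _ => ?_
  exact isClosed_le continuous_const
    (continuous_const.mul (continuous_orient continuous_const continuous_const continuous_id))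

/-- `p` lies inside the triangle `abc`, which is positively oriented. -/
def InTriangle {K : Type} [Field K] [LinearOrder K] (a b c p : K × K) : Prop :=
  0 < orient a b p ∧ 0 < orient b c p ∧ 0 < orient c a p

/-- The sides of the triangle lie on lines of the arrangement, so the cell cannot leave it. This
gives both boundedness of the cell and its inclusion in the hull of the leaves. -/
lemma InTriangle.closedCell_subset {a b c : ι} {p : ℝ × ℝ}
    (h : InTriangle (loc a) (loc b) (loc c) p) :
    closedCell loc p ⊆ convexHull ℝ {loc a, loc b, loc c} := by
  obtain ⟨h1, h2, h3⟩ := h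
  have ne : ∀ f g, 0 < orient (loc f) (loc g) p → f ≠ g := by
    rintro f g h rfl
    simp [orient_self_left] at h
  intro z hz
  refine mem_convexHull_triangle (le_of_mul_le_mul_left ?_ h1) (le_of_mul_le_mul_left ?_ h2)
    (le_of_mul_le_mul_left ?_ h3) ?_
  · rw [mul_zero]; exact hz a b (ne _ _ h1)
  · rw [mul_zero]; exact hz b c (ne _ _ h2)
  · rw [mul_zero]; exact hz c a (ne _ _ h3)
  · have : orient (loc a) (loc b) p + orient (loc b) (loc c) p + orient (loc c) (loc a) p =
        orient (loc a) (loc b) (loc c) := by simp only [orient]; ring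
    linarith

lemma orient_add_smul (f g e d : ℝ × ℝ) (t : ℝ) :
    orient f g (e + t • d) = orient f g e + t * ((g.1 - f.1) * d.2 - (g.2 - f.2) * d.1) := by
  simp only [orient, Prod.fst_add, Prod.snd_add, Prod.smul_fst, Prod.smul_snd, smul_eq_mul]; ring

/-- Unless two nonparallel lines of the arrangement meet at `e`, all lines through `e` share a
direction. Small moves forwards and backwards in this direction stay in the closed cell, so `e` is
not extreme. -/
lemma isVertexPoint_of_mem_extremePoints [Finite ι] {p e : ℝ × ℝ} (hp : IsGeneric loc p)
    (he : e ∈ (closedCell loc p).extremePoints ℝ) : IsVertexPoint loc e := by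
  rw [mem_extremePoints] at he
  obtain ⟨heK, hext⟩ := he
  by_contra hcon
  obtain ⟨d, hd0, hd⟩ : ∃ d : ℝ × ℝ, d ≠ 0 ∧ ∀ f g, f ≠ g → orient (loc f) (loc g) e = 0 →
      ((loc g).1 - (loc f).1) * d.2 - ((loc g).2 - (loc f).2) * d.1 = 0 := by
    by_cases h : ∃ f g, f ≠ g ∧ orient (loc f) (loc g) e = 0
    · obtain ⟨f, g, hfg, h0⟩ := h
      refine ⟨loc g - loc f, ?_, ?_⟩
      · intro h
        apply hp f g hfg
        rw [sub_eq_zero.1 h, orient_self_left]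
      · intro f' g' _ h0'
        by_contra hpar
        refine hcon ⟨f, g, f', g', eq_lineInter h0 h0' fun h => hpar ?_⟩
        simp only [orient, Prod.fst_sub, Prod.snd_sub] at h ⊢
        linarith
    · push Not at h
      exact ⟨(1, 0), by simp, fun f g hfg h0 => absurd h0 (h f g hfg)⟩
  have key : ∀ᶠ t : ℝ in 𝓝 0, ∀ f g, f ≠ g →
      0 ≤ orient (loc f) (loc g) p * orient (loc f) (loc g) (e + t • d) := by
    simp only [eventually_all]
    intro f g hfg
    by_cases h0 : orient (loc f) (loc g) e = 0
    · refine Eventually.of_forall fun t => ?_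
      rw [orient_add_smul, h0, hd f g hfg h0]; simp
    · have hpos : 0 < orient (loc f) (loc g) p * orient (loc f) (loc g) e :=
        lt_of_le_of_ne (heK f g hfg) (mul_ne_zero (hp f g hfg) h0).symm
      have hc : Continuous fun t : ℝ => orient (loc f) (loc g) p *
          orient (loc f) (loc g) (e + t • d) :=
        continuous_const.mul (continuous_orient continuous_const continuous_const (by fun_prop))
      have h00 : (0 : ℝ) < (fun t : ℝ => orient (loc f) (loc g) p *
          orient (loc f) (loc g) (e + t • d)) 0 := by simpa using hpos
      have := hc.continuousAt.eventually_const_lt h00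
      exact this.mono fun t ht => ht.le
  have key2 : ∀ᶠ t : ℝ in 𝓝 0, e + t • d ∈ closedCell loc p ∧ e + (-t) • d ∈ closedCell loc p :=
    key.and ((continuous_neg.tendsto' (0 : ℝ) 0 neg_zero).eventually key)
  obtain ⟨t, ⟨h1, h2⟩, ht⟩ :=
    ((key2.filter_mono nhdsWithin_le_nhds).and (self_mem_nhdsWithin (s := Ioi (0 : ℝ)))).exists
  have := (hext _ h1 _ h2 ⟨1/2, 1/2, by norm_num, by norm_num, by norm_num, by module⟩).1
  have h0 : t • d = 0 := by simpa using this
  rcases smul_eq_zero.1 h0 with h | h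
  · exact (ne_of_gt ht) h
  · exact hd0 h

/-- By Krein–Milman the cell is the closed hull of its extreme points. If these were all on one
line, so would be the nonempty open cell. -/
lemma exists_extremePoint_notMem [Finite ι] {p : ℝ × ℝ} (hp : IsGeneric loc p)
    (hK : IsCompact (closedCell loc p)) {x y : ℝ × ℝ} (hxy : x ≠ y) :
    ∃ e ∈ (closedCell loc p).extremePoints ℝ, orient x y e ≠ 0 := by
  by_contra hcon
  push Not at hcon
  have hsub : closedCell loc p ⊆ {z | orient x y z = 0} := by
    rw [← closure_convexHull_extremePoints hK (convex_closedCell p)]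
    refine closure_minimal (convexHull_min hcon ?_) ?_
    · intro z hz w hw a b _ _ hab
      rw [mem_ofPred_eq, orient_comb _ _ _ _ hab, hz, hw]; simp
    · exact isClosed_eq (continuous_orient continuous_const continuous_const continuous_id)
        continuous_const
  obtain ⟨z, hz, hz'⟩ := (dense_orient_ne hxy).inter_open_nonempty (openCell loc p)
    (isOpen_openCell p) ⟨p, mem_openCell_self hp⟩
  exact hz' (hsub (openCell_subset_closedCell p hz))

lemma orient_eq_zero_of_three {f g x y z : ℝ × ℝ} (hfg : f ≠ g) (hx : orient f g x = 0)
    (hy : orient f g y = 0) (hz : orient f g z = 0) : orient x y z = 0 := by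
  simp only [orient] at *
  by_cases h : g.1 = f.1
  · have h2 : g.2 - f.2 ≠ 0 := fun h2 => hfg (Prod.ext h.symm (by linarith))
    have k : ∀ w : ℝ × ℝ, (g.1 - f.1) * (w.2 - f.2) - (g.2 - f.2) * (w.1 - f.1) = 0 →
        w.1 = f.1 := by
      intro w hw
      rw [h] at hw
      have : (g.2 - f.2) * (w.1 - f.1) = 0 := by linarith
      linarith [(mul_eq_zero.1 this).resolve_left h2]
    rw [k x hx, k y hy, k z hz]; ring
  · have h1 : g.1 - f.1 ≠ 0 := sub_ne_zero.2 h
    apply mul_left_cancel₀ h1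
    linear_combination (z.1 - y.1) * hx + (x.1 - z.1) * hy + (y.1 - x.1) * hz

/-- Every bounded cell contains a candidate. -/
lemma exists_candidate_mem_openCell [Finite ι] {p : ℝ × ℝ} (hp : IsGeneric loc p) (hinj : Function.Injective loc)
    (hK : IsCompact (closedCell loc p)) :
    ∃ c ∈ openCell loc p, IsCandidate loc c := by
  -- The first line is arbitrary. The second one passes through `e₁`, which forces `e₂ ≠ e₁`, and
  -- the third is the line `e₁e₂`, so the three corners are not collinear.
  obtain ⟨e₁, h₁, -⟩ := exists_extremePoint_notMem hp hK (x := (0, 0)) (y := (1, 0)) (by simp)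
  obtain ⟨e₂, h₂, hne⟩ := exists_extremePoint_notMem hp hK (x := e₁) (y := e₁ + (1, 0)) (by simp)
  have h12 : e₁ ≠ e₂ := by rintro rfl; simp [orient_self_outer] at hne
  obtain ⟨e₃, h₃, hor⟩ := exists_extremePoint_notMem hp hK h12
  refine ⟨centroid3 e₁ e₂ e₃, ?_, e₁, e₂, e₃, isVertexPoint_of_mem_extremePoints hp h₁,
    isVertexPoint_of_mem_extremePoints hp h₂, isVertexPoint_of_mem_extremePoints hp h₃, rfl⟩
  intro f g hfg
  have k₁ := extremePoints_subset h₁ f g hfg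
  have k₂ := extremePoints_subset h₂ f g hfg
  have k₃ := extremePoints_subset h₃ f g hfg
  have hs : orient (loc f) (loc g) (centroid3 e₁ e₂ e₃) = (orient (loc f) (loc g) e₁ +
      orient (loc f) (loc g) e₂ + orient (loc f) (loc g) e₃) / 3 := by
    simp only [orient, centroid3]; ring
  rw [hs]
  -- All three corners are weakly on the correct side. If their average is not strictly there, all
  -- of them lie on the line `fg`, contrary to the choice.
  by_contra hcon
  push Not at hcon
  have hpf := hp f g hfg
  have z : ∀ t, orient (loc f) (loc g) p * t = 0 → t = 0 :=
    fun t ht => (mul_eq_zero.1 ht).resolve_left hpf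
  exact hor (orient_eq_zero_of_three (hinj.ne hfg) (z _ (by nlinarith)) (z _ (by nlinarith))
    (z _ (by nlinarith)))

/-- By Carathéodory, `p` is a positive combination of at most three affinely independent leaves. One
or two leaves would put `p` on a line of the arrangement; three give the triangle, up to
orientation. -/
lemma exists_inTriangle {A : Finset ι} {p : ℝ × ℝ} (hp : IsGeneric loc p) (hA : 1 < A.card)
    (h : p ∈ convexHull ℝ (loc '' {i | i ∈ A})) :
    ∃ a ∈ A, ∃ b ∈ A, ∃ c ∈ A, InTriangle (loc a) (loc b) (loc c) p := by
  obtain ⟨κ, _, z, w, hz, hind, hw, hw1, hs⟩ := eq_pos_convex_span_of_mem_convexHull h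
  have hcard : Fintype.card κ ≤ 3 := by
    have := hind.card_le_finrank_succ
    have h2 : Module.finrank ℝ (vectorSpan ℝ (range z)) ≤ 2 := by
      calc _ ≤ Module.finrank ℝ (ℝ × ℝ) := Submodule.finrank_le _
        _ = 2 := by simp
    omega
  have hz' : ∀ k, ∃ a ∈ A, loc a = z k := fun k => hz ⟨k, rfl⟩
  choose i hiA hi using hz'
  have hinj : Function.Injective i := fun k l hkl => hind.injective (by rw [← hi, ← hi, hkl])
  obtain ⟨n, hn, w₀, i₀, hsum, hsum1, hinj', hw', hiA'⟩ : ∃ n ≤ 3, ∃ (w₀ : Fin n → ℝ)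
      (i₀ : Fin n → ι), ∑ j, w₀ j • loc (i₀ j) = p ∧ ∑ j, w₀ j = 1 ∧ Function.Injective i₀ ∧
      (∀ j, 0 < w₀ j) ∧ ∀ j, i₀ j ∈ A := by
    set e := (Fintype.equivFin κ).symm
    refine ⟨_, hcard, w ∘ e, i ∘ e, ?_, ?_, hinj.comp e.injective, fun j => hw _, fun j => hiA _⟩
    · rw [← hs, ← e.sum_comp]; simp [hi]
    · rw [← hw1, ← e.sum_comp]; rfl
  interval_cases n
  · simp at hsum1
  · exfalso
    simp only [Fin.sum_univ_one] at hsum hsum1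
    rw [hsum1, one_smul] at hsum
    obtain ⟨a, -, ha⟩ := A.exists_mem_ne hA (i₀ 0)
    exact hp.ne ha.symm hsum.symm
  · exfalso
    simp only [Fin.sum_univ_two] at hsum hsum1
    have := orient_comb (loc (i₀ 0)) (loc (i₀ 1)) (loc (i₀ 0)) (loc (i₀ 1)) hsum1
    rw [hsum, orient_self_outer, orient_self_right] at this
    exact hp (i₀ 0) (i₀ 1) (hinj'.ne (by simp)) (by linarith)
  · simp only [Fin.sum_univ_three] at hsum hsum1
    have p0 := hw' 0
    have p1 := hw' 1
    have p2 := hw' 2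
    have h01 := hp (i₀ 0) (i₀ 1) (hinj'.ne (by simp))
    have hw0 : w₀ 0 = 1 - w₀ 1 - w₀ 2 := by linarith
    have e1 : orient (loc (i₀ 0)) (loc (i₀ 1)) p =
        w₀ 2 * orient (loc (i₀ 0)) (loc (i₀ 1)) (loc (i₀ 2)) := by
      rw [← hsum, hw0]; simp [orient]; ring
    have e2 : orient (loc (i₀ 1)) (loc (i₀ 2)) p =
        w₀ 0 * orient (loc (i₀ 0)) (loc (i₀ 1)) (loc (i₀ 2)) := by
      rw [← hsum, hw0]; simp [orient]; ring
    have e3 : orient (loc (i₀ 2)) (loc (i₀ 0)) p =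
        w₀ 1 * orient (loc (i₀ 0)) (loc (i₀ 1)) (loc (i₀ 2)) := by
      rw [← hsum, hw0]; simp [orient]; ring
    have hne : orient (loc (i₀ 0)) (loc (i₀ 1)) (loc (i₀ 2)) ≠ 0 := by
      intro h; rw [h, mul_zero] at e1; exact h01 e1
    rcases hne.lt_or_gt with hneg | hpos
    · refine ⟨_, hiA' 0, _, hiA' 2, _, hiA' 1, ?_, ?_, ?_⟩
      · rw [orient_swap, e3]; nlinarith
      · rw [orient_swap, e2]; nlinarith
      · rw [orient_swap, e1]; nlinarith
    · refine ⟨_, hiA' 0, _, hiA' 1, _, hiA' 2, ?_, ?_, ?_⟩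
      · rw [e1]; positivity
      · rw [e2]; positivity
      · rw [e3]; positivity

end Candidates

/-! ### Moving mobile vertices to candidates. -/

section Replacement

variable {ι : Type} {loc : ι → ℝ × ℝ}

/-- A compact and a closed set that are disjoint have disjoint thickenings, and no point of the
segment moves further than its end `p`. -/
lemma eventually_disjoint_segment {p a : ℝ × ℝ} {s : Set (ℝ × ℝ)} (hs : IsClosed s)
    (h : Disjoint (segment ℝ p a) s) : ∀ᶠ p' in 𝓝 p, Disjoint (segment ℝ p' a) s := by
  have hc : IsCompact (segment ℝ p a) := by
    rw [segment_eq_image]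
    exact isCompact_Icc.image (by fun_prop)
  obtain ⟨δ, hδ, hd⟩ := h.exists_thickenings hc hs
  filter_upwards [Metric.ball_mem_nhds p hδ] with p' hp'
  refine hd.mono ?_ (Metric.self_subset_thickening hδ s)
  rintro _ ⟨α, β, hα, hβ, hαβ, rfl⟩
  rw [Metric.mem_thickening_iff]
  refine ⟨α • p + β • a, ⟨α, β, hα, hβ, hαβ, rfl⟩, ?_⟩
  rw [dist_add_right, dist_smul₀, Real.norm_of_nonneg hα]
  have : dist p' p < δ := hp'
  nlinarith [dist_nonneg (x := p') (y := p)]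

lemma isClosed_segment (x y : ℝ × ℝ) : IsClosed (segment ℝ x y) := by
  have hc : IsCompact (segment ℝ x y) := by
    rw [segment_eq_image]
    exact isCompact_Icc.image (by fun_prop)
  exact hc.isClosed

/-- No genericity is assumed here, in contrast to `eventually_not_starsTouch`: this version
justifies the first nudge of an arbitrary centre to a generic position. -/
lemma eventually_not_starsTouch_of_not {A B : Finset ι} {p q : ℝ × ℝ}
    (h : ¬ StarsTouch loc A p B q) : ∀ᶠ p' in 𝓝 p, ¬ StarsTouch loc A p' B q := by
  have hev : ∀ᶠ p' in 𝓝 p, ∀ a ∈ A, ∀ b ∈ B, a ≠ b →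
      Disjoint (segment ℝ p' (loc a)) (segment ℝ q (loc b)) := by
    rw [eventually_all_finset]
    intro a ha
    rw [eventually_all_finset]
    intro b hb
    by_cases hab : a = b
    · simp [hab]
    · have := eventually_disjoint_segment (isClosed_segment q (loc b)) (p := p) (a := loc a)
        (Set.disjoint_left.2 fun z h1 h2 => h ⟨a, ha, b, hb, hab, z, h1, h2⟩)
      exact this.mono fun p' hp' _ => hp'
  filter_upwards [hev] with p' hp' ⟨a, ha, b, hb, hab, z, h1, h2⟩
  exact Set.disjoint_left.1 (hp' a ha b hb hab) h1 h2

lemma dense_isGeneric [Finite ι] (hinj : Function.Injective loc) :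
    Dense {p | IsGeneric loc p} := by
  have : {p | IsGeneric loc p} = ⋂ fg : {fg : ι × ι // fg.1 ≠ fg.2},
      {p | orient (loc fg.1.1) (loc fg.1.2) p ≠ 0} := by
    ext p
    simp [IsGeneric]
  rw [this]
  refine dense_iInter_of_isOpen (fun fg => ?_) fun fg => dense_orient_ne (hinj.ne fg.2)
  exact isOpen_ne_fun (continuous_orient continuous_const continuous_const continuous_id)
    continuous_const

/-- A nondegenerate triangle of leaves gives the hull an interior, whose closure then contains the
hull; generic points are dense in that interior. -/
lemma exists_isGeneric_near [Finite ι] {A : Finset ι} {p : ℝ × ℝ} (hinj : Function.Injective loc)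
    (hp : p ∈ convexHull ℝ (loc '' {i | i ∈ A}))
    (hA : ∃ a ∈ A, ∃ b ∈ A, ∃ c ∈ A, 0 < orient (loc a) (loc b) (loc c))
    {P : ℝ × ℝ → Prop} (hP : ∀ᶠ x in 𝓝 p, P x) :
    ∃ x, IsGeneric loc x ∧ x ∈ convexHull ℝ (loc '' {i | i ∈ A}) ∧ P x := by
  set C := convexHull ℝ (loc '' {i | i ∈ A}) with hC
  obtain ⟨a, ha, b, hb, c, hc, habc⟩ := hA
  have hint : (interior C).Nonempty := by
    refine ⟨centroid3 (loc a) (loc b) (loc c), ?_⟩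
    rw [mem_interior]
    refine ⟨{z | InTriangle (loc a) (loc b) (loc c) z}, ?_, ?_, ?_⟩
    · rintro z ⟨h1, h2, h3⟩
      refine convexHull_mono ?_ (mem_convexHull_triangle h1.le h2.le h3.le habc)
      rintro _ (rfl | rfl | rfl)
      exacts [⟨a, ha, rfl⟩, ⟨b, hb, rfl⟩, ⟨c, hc, rfl⟩]
    · have k : ∀ x y : ℝ × ℝ, IsOpen {z | 0 < orient x y z} := fun x y =>
        isOpen_lt continuous_const
          (continuous_orient continuous_const continuous_const continuous_id)
      exact (k _ _).inter ((k _ _).inter (k _ _))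
    · have e : ∀ x y z : ℝ × ℝ, orient x y (centroid3 x y z) = orient x y z / 3 := by
        intro x y z; simp only [orient, centroid3]; ring
      have e2 : ∀ x y z : ℝ × ℝ, orient y z (centroid3 x y z) = orient x y z / 3 := by
        intro x y z; simp only [orient, centroid3]; ring
      have e3 : ∀ x y z : ℝ × ℝ, orient z x (centroid3 x y z) = orient x y z / 3 := by
        intro x y z; simp only [orient, centroid3]; ring
      refine ⟨?_, ?_, ?_⟩
      · rw [e]; linarith
      · rw [e2]; linarith
      · rw [e3]; linarith
  have hpc : p ∈ closure (interior C) := by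
    rw [(convex_convexHull ℝ _).closure_interior_eq_closure_of_nonempty_interior hint]
    exact subset_closure hp
  obtain ⟨O, hO, hOo, hpO⟩ := mem_nhds_iff.1 hP
  obtain ⟨y, hyO, hyC⟩ := mem_closure_iff.1 hpc O hOo hpO
  obtain ⟨x, ⟨hxO, hxC⟩, hx⟩ := (dense_isGeneric hinj).inter_open_nonempty _
    (hOo.inter isOpen_interior) ⟨y, hyO, hyC⟩
  exact ⟨x, hx, interior_subset hxC, hO hxO⟩

/-- Positions suitable for a mobile vertex with neighbours `A`: generic points inside a triangle, or
a specific point of the segment if there are two neighbours. -/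
def IsSpecial (loc : ι → ℝ × ℝ) (A : Finset ι) (p : ℝ × ℝ) : Prop :=
  (IsGeneric loc p ∧ ∃ a ∈ A, ∃ b ∈ A, ∃ c ∈ A, InTriangle (loc a) (loc b) (loc c) p) ∨
    ∃ a b, a ≠ b ∧ (∀ i, i ∈ A ↔ i = a ∨ i = b) ∧ p = centroid3 (loc a) (loc a) (loc b)

/-- No three of the points `loc i` are collinear. -/
def NoThreeCollinear (loc : ι → ℝ × ℝ) : Prop :=
  ∀ i j k, i ≠ j → i ≠ k → j ≠ k → orient (loc i) (loc j) (loc k) ≠ 0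

/-- Nudge the centre to a generic point of the hull without creating contacts, and enclose it in a
triangle of leaves. Its cell is bounded and inside the hull, so it contains a candidate, and moving
there changes no contact. -/
lemma exists_special_of_three [Finite ι] {A : Finset ι} {p : ℝ × ℝ} (hinj : Function.Injective loc)
    (hgp : NoThreeCollinear loc) (hA : 2 < A.card) (hp : IsStarCentre loc A p)
    {κ : Type*} [Finite κ] (B : κ → Finset ι) (q : κ → ℝ × ℝ) (hB : ∀ k, (B k).Nonempty)
    (hq : ∀ k, IsStarCentre loc (B k) (q k)) (h : ∀ k, ¬ StarsTouch loc A p (B k) (q k)) :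
    ∃ p', IsCandidate loc p' ∧ IsSpecial loc A p' ∧
      ∀ k, ¬ StarsTouch loc A p' (B k) (q k) := by
  have h3 : ∃ a ∈ A, ∃ b ∈ A, ∃ c ∈ A, 0 < orient (loc a) (loc b) (loc c) := by
    obtain ⟨a, b, c, ha, hb, hc, hab, hac, hbc⟩ := Finset.two_lt_card_iff.1 hA
    rcases (hgp a b c hab hac hbc).lt_or_gt with hlt | hgt
    · exact ⟨b, hb, a, ha, c, hc, by rw [orient_swap]; linarith⟩
    · exact ⟨a, ha, b, hb, c, hc, hgt⟩
  have hA1 : 1 < A.card := by omega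
  obtain ⟨x, hxg, hxC, hx⟩ := exists_isGeneric_near hinj hp.mem_hull h3
    (eventually_all.2 fun k => eventually_not_starsTouch_of_not (h k))
  obtain ⟨a, ha, b, hb, c, hc, habc⟩ := exists_inTriangle hxg hA1 hxC
  have hK := habc.closedCell_subset
  have hsub : ({loc a, loc b, loc c} : Set (ℝ × ℝ)) ⊆ loc '' {i | i ∈ A} := by
    rintro _ (rfl | rfl | rfl)
    exacts [⟨a, ha, rfl⟩, ⟨b, hb, rfl⟩, ⟨c, hc, rfl⟩]
  have hcomp : IsCompact (closedCell loc x) :=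
    ((Set.toFinite _).isCompact_convexHull ℝ).of_isClosed_subset (isClosed_closedCell x) hK
  obtain ⟨p', hp', hcand⟩ := exists_candidate_mem_openCell hxg hinj hcomp
  have ne : ∀ f g, 0 < orient (loc f) (loc g) x → f ≠ g := by
    rintro f g h rfl
    simp [orient_self_left] at h
  refine ⟨p', hcand, Or.inl ⟨isGeneric_of_mem_openCell hp', a, ha, b, hb, c, hc, ?_⟩, fun k => ?_⟩
  · exact ⟨(mul_pos_iff_of_pos_left habc.1).1 (hp' a b (ne _ _ habc.1)),
      (mul_pos_iff_of_pos_left habc.2.1).1 (hp' b c (ne _ _ habc.2.1)),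
      (mul_pos_iff_of_pos_left habc.2.2).1 (hp' c a (ne _ _ habc.2.2))⟩
  · exact not_starsTouch_of_mem_openCell hxg
      ((openCell_subset_closedCell x).trans (hK.trans (convexHull_mono hsub))) hp' hA1 (hB k) (hq k)
      (hx k)

/-- Both segments lie on one ray from `b`, so the shorter one is contained in the longer one. -/
lemma mem_segment_or_of_common {p q b z : ℝ × ℝ} (h1 : z ∈ segment ℝ p b) (h2 : z ∈ segment ℝ q b)
    (hz : z ≠ b) : p ∈ segment ℝ q b ∨ q ∈ segment ℝ p b := by
  have h1' : z - b ∈ segment ℝ (p - b) 0 := by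
    obtain ⟨α, β, hα, hβ, h, rfl⟩ := h1
    refine ⟨α, β, hα, hβ, h, ?_⟩
    obtain rfl : β = 1 - α := by linarith
    module
  obtain ⟨α, β, hα, hβ, hαβ, rfl⟩ := h1
  obtain ⟨γ, δ, hγ, hδ, hγδ, e⟩ := h2
  obtain rfl : β = 1 - α := by linarith
  obtain rfl : δ = 1 - γ := by linarith
  have hα0 : 0 < α := lt_of_le_of_ne hα (by rintro rfl; simp at hz)
  have hγ0 : 0 < γ := lt_of_le_of_ne hγ (by rintro rfl; simp at e; exact hz (by rw [← e]))
  have e' : γ • (q - b) = α • (p - b) := by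
    have : γ • (q - b) = (γ • q + (1 - γ) • b) - b := by module
    rw [this, e]; module
  rcases le_total α γ with h | h
  · right
    refine ⟨α / γ, 1 - α / γ, by positivity, by rw [sub_nonneg, div_le_one hγ0]; exact h, by ring, ?_⟩
    have : q - b = (α / γ) • (p - b) := by
      rw [div_eq_inv_mul, mul_smul, ← e', smul_smul, inv_mul_cancel₀ hγ0.ne', one_smul]
    rw [← sub_add_cancel q b, this]; module
  · left
    refine ⟨γ / α, 1 - γ / α, by positivity, by rw [sub_nonneg, div_le_one hα0]; exact h, by ring, ?_⟩
    have : p - b = (γ / α) • (q - b) := by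
      rw [div_eq_inv_mul, mul_smul, e', smul_smul, inv_mul_cancel₀ hα0.ne', one_smul]
    rw [← sub_add_cancel p b, this]; module

/-- Any point of the segment `ab` splits it into two edges covering it. Thus the star of a vertex
with two neighbours is the same set for each centre; only the assignment of points to the leaves
changes. -/
lemma segment_subset_union {p p' a b z : ℝ × ℝ} (hp : p ∈ segment ℝ a b) (hp' : p' ∈ segment ℝ a b)
    (h : z ∈ segment ℝ p' a) : z ∈ segment ℝ p a ∨ z ∈ segment ℝ p b := by
  have hz : z ∈ segment ℝ a b :=
    (convex_segment a b).segment_subset hp' (left_mem_segment _ _ _) h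
  rw [segment_eq_image_lineMap] at hz hp
  obtain ⟨s, hs, rfl⟩ := hz
  obtain ⟨t, ht, rfl⟩ := hp
  rcases le_total s t with hst | hst
  · left
    rw [segment_symm, show a = AffineMap.lineMap a b (0 : ℝ) by simp]
    have : s ∈ segment ℝ 0 t := by rw [segment_eq_Icc ht.1]; exact ⟨hs.1, hst⟩
    have := mem_image_of_mem (AffineMap.lineMap a b) this
    rw [image_segment] at this
    simpa using this
  · right
    have : s ∈ segment ℝ t 1 := by rw [segment_eq_Icc ht.2]; exact ⟨hst, hs.2⟩
    have := mem_image_of_mem (AffineMap.lineMap a b) this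
    rw [image_segment] at this
    simpa using this

lemma centroid3_mem_openSegment (a b : ℝ × ℝ) : centroid3 a a b ∈ openSegment ℝ a b := by
  refine ⟨2 / 3, 1 / 3, by norm_num, by norm_num, by norm_num, ?_⟩
  ext <;> simp [centroid3] <;> ring

/-- The star of a vertex with two neighbours does not depend on its centre. -/
lemma not_starsTouch_pair {A B : Finset ι} {a b : ι} (hab : loc a ≠ loc b)
    (hA : ∀ i, i ∈ A ↔ i = a ∨ i = b) {p p' q : ℝ × ℝ} (hp : p ∈ segment ℝ (loc a) (loc b))
    (hp' : p' ∈ openSegment ℝ (loc a) (loc b)) (hB : 1 < B.card) (h : ¬ StarsTouch loc A p B q) :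
    ¬ StarsTouch loc A p' B q := by
  have key : ∀ a b, loc a ≠ loc b → a ∈ A → b ∈ A → p ∈ segment ℝ (loc a) (loc b) →
      p' ∈ openSegment ℝ (loc a) (loc b) → ∀ b' ∈ B, a ≠ b' → ∀ z, z ∈ segment ℝ p' (loc a) →
      z ∈ segment ℝ q (loc b') → False := by
    intro a b hab ha hb hp hp' b' hb' hab' z h1 h2
    rcases segment_subset_union hp (openSegment_subset_segment _ _ _ hp') h1 with h3 | h3
    · exact h ⟨a, ha, b', hb', hab', z, h3, h2⟩
    by_cases hbb : b = b'
    · subst hbb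
      -- The new centre is strictly between the ends, so its edge to `a` does not reach `b`.
      have hzb : z ≠ loc b := by
        intro hz
        obtain ⟨α, β, hα, hβ, hαβ, e⟩ := h1
        obtain ⟨γ, δ, hγ, hδ, hγδ, rfl⟩ := hp'
        obtain rfl : β = 1 - α := by linarith
        obtain rfl : γ = 1 - δ := by linarith
        have h0 : (1 - α * δ) • (loc b - loc a) = 0 := by
          rw [hz] at e
          have : (1 - α * δ) • (loc b - loc a) =
              loc b - (α • ((1 - δ) • loc a + δ • loc b) + (1 - α) • loc a) := by module
          rw [this, e, sub_self]
        rcases smul_eq_zero.1 h0 with h0 | h0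
        · nlinarith
        · exact hab (sub_eq_zero.1 h0).symm
      -- The edges `pb` and `qb` are nested. Either `p` is on `qb` and the edge `pa` touches it, or
      -- `q` is on `pb` and so is an end of an edge of `q` to a second leaf.
      rcases mem_segment_or_of_common h3 h2 hzb with h4 | h4
      · exact h ⟨a, ha, b, hb', hab', p, left_mem_segment _ _ _, h4⟩
      · obtain ⟨b'', hb'', hne⟩ := B.exists_mem_ne hB b
        exact h ⟨b, hb, b'', hb'', hne.symm, q, h4, left_mem_segment _ _ _⟩
    · exact h ⟨b, hb, b', hb', hbb, z, h3, h2⟩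
  rintro ⟨c, hc, b', hb', hcb, z, h1, h2⟩
  rcases (hA c).1 hc with rfl | rfl
  · exact key c b hab hc ((hA b).2 (Or.inr rfl)) hp hp' b' hb' hcb z h1 h2
  · rw [segment_symm] at hp
    rw [openSegment_symm] at hp'
    exact key c a hab.symm hc ((hA a).2 (Or.inl rfl)) hp hp' b' hb' hcb z h1 h2

end Replacement

/-! ### Sign tests for positions, exact at special positions. -/

section Drawings

/-- The test whether `p` is suitable as the centre of a star with leaves `A`. -/
def ValidCentre {ι : Type} {K : Type} [Field K] [LinearOrder K] (loc : ι → K × K) (A : Finset ι)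
    (p : K × K) : Prop :=
  (∃ a ∈ A, ∃ b ∈ A, ∃ c ∈ A, InTriangle (loc a) (loc b) (loc c) p ∨
    (a ≠ b ∧ p = centroid3 (loc a) (loc a) (loc b))) ∧
  ∀ c ∈ A, ∀ f, f ≠ c → orient (loc f) (loc c) p ≠ 0 ∨ 0 < dotAt (loc f) p (loc c)

/-- The test whether two stars do not touch. -/
def CompatibleCentres {ι : Type} {K : Type} [Field K] [LinearOrder K] (loc : ι → K × K)
    (A : Finset ι) (p : K × K) (B : Finset ι) (q : K × K) : Prop :=
  ∀ a ∈ A, ∀ b ∈ B, a ≠ b → Separated p (loc a) q (loc b)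

variable {ι : Type} {loc : ι → ℝ × ℝ}

lemma ValidCentre.one_lt_card {A : Finset ι} {p : ℝ × ℝ} (h : ValidCentre loc A p) :
    1 < A.card := by
  obtain ⟨⟨a, ha, b, hb, c, hc, h⟩, -⟩ := h
  have hab : a ≠ b := by
    rcases h with h | h
    · rintro rfl
      simpa [orient_self_left] using h.1
    · exact h.1
  exact Finset.one_lt_card.2 ⟨a, ha, b, hb, hab⟩

/-- A point `f` of the segment from `p` to a leaf is collinear with its ends and sees them in
opposite directions, so the inner product at `f` is not positive. -/
lemma ValidCentre.isStarCentre {A : Finset ι} {p : ℝ × ℝ} (h : ValidCentre loc A p) :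
    IsStarCentre loc A p := by
  obtain ⟨⟨a, ha, b, hb, c, hc, h⟩, h2⟩ := h
  refine ⟨?_, ?_⟩
  · rcases h with ⟨h1, h2, h3⟩ | ⟨-, rfl⟩
    · have hs : orient (loc a) (loc b) p + orient (loc b) (loc c) p + orient (loc c) (loc a) p =
        orient (loc a) (loc b) (loc c) := by simp only [orient]; ring
      refine convexHull_mono ?_ (mem_convexHull_triangle h1.le h2.le h3.le (by linarith))
      rintro _ (rfl | rfl | rfl)
      exacts [⟨a, ha, rfl⟩, ⟨b, hb, rfl⟩, ⟨c, hc, rfl⟩]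
    · exact (convex_convexHull ℝ _).segment_subset (subset_convexHull ℝ (loc '' {i | i ∈ A}) ⟨a, ha, rfl⟩)
        (subset_convexHull ℝ (loc '' {i | i ∈ A}) ⟨b, hb, rfl⟩)
        (openSegment_subset_segment _ _ _ (centroid3_mem_openSegment _ _))
  · rintro d hd f hfd ⟨α, β, hα, hβ, hαβ, e⟩
    obtain rfl : β = 1 - α := by linarith
    rcases h2 d hd f hfd with h | h
    · apply h
      rw [← e]
      simp [orient]; ring
    · rw [← e] at h
      have : dotAt (α • p + (1 - α) • loc d) p (loc d) =
          - (α * (1 - α)) * ((p.1 - (loc d).1) ^ 2 + (p.2 - (loc d).2) ^ 2) := by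
        simp [dotAt]; ring
      rw [this] at h
      have := mul_nonneg (mul_nonneg hα hβ)
        (add_nonneg (sq_nonneg (p.1 - (loc d).1)) (sq_nonneg (p.2 - (loc d).2)))
      linarith

lemma dotAt_centroid3_pos {a b : ℝ × ℝ} (h : a ≠ b) :
    0 < dotAt b (centroid3 a a b) a ∧ 0 < dotAt a (centroid3 a a b) b := by
  have hpos : 0 < (a.1 - b.1) ^ 2 + (a.2 - b.2) ^ 2 := by
    by_contra hcon
    refine h (Prod.ext ?_ ?_) <;> nlinarith [sq_nonneg (a.1 - b.1), sq_nonneg (a.2 - b.2)]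
  constructor
  · have : dotAt b (centroid3 a a b) a = 2 / 3 * ((a.1 - b.1) ^ 2 + (a.2 - b.2) ^ 2) := by
      simp [dotAt, centroid3]; ring
    rw [this]; positivity
  · have : dotAt a (centroid3 a a b) b = 1 / 3 * ((a.1 - b.1) ^ 2 + (a.2 - b.2) ^ 2) := by
      simp [dotAt, centroid3]; ring
    rw [this]; positivity

/-- Genericity settles the first kind of position. For a vertex with two neighbours, general
position leaves only the other neighbour on the line of an edge, and the inner product recognises it
as outside the edge. -/
lemma IsSpecial.validCentre (hinj : Function.Injective loc) (hgp : NoThreeCollinear loc)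
    {A : Finset ι} {p : ℝ × ℝ} (h : IsSpecial loc A p) : ValidCentre loc A p := by
  rcases h with ⟨hg, a, ha, b, hb, c, hc, h⟩ | ⟨a, b, hab, hA, rfl⟩
  · exact ⟨⟨a, ha, b, hb, c, hc, Or.inl h⟩, fun c _ f hf => Or.inl (hg f c hf)⟩
  · have ha : a ∈ A := (hA a).2 (Or.inl rfl)
    have hb : b ∈ A := (hA b).2 (Or.inr rfl)
    refine ⟨⟨a, ha, b, hb, b, hb, Or.inr ⟨hab, rfl⟩⟩, ?_⟩
    intro c hc f hf
    have hd := dotAt_centroid3_pos (hinj.ne hab)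
    rcases (hA c).1 hc with rfl | rfl
    · by_cases hfb : f = b
      · subst hfb; exact Or.inr hd.1
      · left
        have : orient (loc f) (loc c) (centroid3 (loc c) (loc c) (loc b)) =
            orient (loc f) (loc c) (loc b) / 3 := by simp only [orient, centroid3]; ring
        rw [this]
        exact div_ne_zero (hgp _ _ _ hf hfb hab) (by norm_num)
    · by_cases hfa : f = a
      · subst hfa; exact Or.inr hd.2
      · left
        have : orient (loc f) (loc c) (centroid3 (loc a) (loc a) (loc c)) =
            2 / 3 * orient (loc f) (loc c) (loc a) := by simp only [orient, centroid3]; ring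
        rw [this]
        exact mul_ne_zero (by norm_num) (hgp _ _ _ hf hfa hab.symm)

lemma StarsTouch.of_not_separated {A B : Finset ι} {p q : ℝ × ℝ} {a b : ι} (ha : a ∈ A) (hb : b ∈ B)
    (hab : a ≠ b) (h : ¬ Separated p (loc a) q (loc b))
    (hn : orient p (loc a) (loc b) ≠ 0 ∨ orient q (loc b) (loc a) ≠ 0) :
    StarsTouch loc A p B q := by
  rcases hn with hn | hn
  · obtain ⟨z, h1, h2⟩ := exists_mem_inter_of_not_separated h (Or.inl hn)
    exact ⟨a, ha, b, hb, hab, z, h1, h2⟩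
  · obtain ⟨z, h1, h2⟩ := exists_mem_inter_of_not_separated' h (Or.inl hn)
    exact ⟨a, ha, b, hb, hab, z, h1, h2⟩

/-- A line through a leaf of the pair and the centre between the two leaves is the line `xy`. By
general position its only fixed points are `x` and `y`. -/
lemma pair_line {A : Finset ι} {x y a b : ι} (hxy : x ≠ y) (hA : ∀ i, i ∈ A ↔ i = x ∨ i = y)
    (hgp : NoThreeCollinear loc) (ha : a ∈ A) (hab : a ≠ b)
    (h : orient (centroid3 (loc x) (loc x) (loc y)) (loc a) (loc b) = 0) :
    b ∈ A ∧ centroid3 (loc x) (loc x) (loc y) ∈ segment ℝ (loc a) (loc b) := by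
  have hmem := openSegment_subset_segment ℝ _ _ (centroid3_mem_openSegment (loc x) (loc y))
  rcases (hA a).1 ha with rfl | rfl
  · have e : orient (centroid3 (loc a) (loc a) (loc y)) (loc a) (loc b) =
        orient (loc y) (loc a) (loc b) / 3 := by simp only [orient, centroid3]; ring
    by_cases hb : b = y
    · subst hb; exact ⟨(hA b).2 (Or.inr rfl), hmem⟩
    · rw [e] at h
      exact absurd h (div_ne_zero (hgp _ _ _ hxy.symm (Ne.symm hb) hab) (by norm_num))
  · have e : orient (centroid3 (loc x) (loc x) (loc a)) (loc a) (loc b) =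
        2 / 3 * orient (loc x) (loc a) (loc b) := by simp only [orient, centroid3]; ring
    by_cases hb : b = x
    · subst hb; exact ⟨(hA b).2 (Or.inl rfl), by rw [segment_symm]; exact hmem⟩
    · rw [e] at h
      exact absurd h (mul_ne_zero (by norm_num) (hgp _ _ _ hxy (Ne.symm hb) hab))

/-- Stars that do not touch can fail the sign test only if both centres are collinear with the
leaves `a` and `b`. This excludes generic centres; otherwise both stars have `a` and `b` as leaves
and their centres share the segment `ab`, where they would touch. -/
lemma IsSpecial.compatibleCentres (hgp : NoThreeCollinear loc)
    {A B : Finset ι} {p q : ℝ × ℝ} (hp : IsSpecial loc A p) (hq : IsSpecial loc B q)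
    (h : ¬ StarsTouch loc A p B q) : CompatibleCentres loc A p B q := by
  intro a ha b hb hab
  by_contra hsep
  have hn : orient p (loc a) (loc b) = 0 ∧ orient q (loc b) (loc a) = 0 := by
    by_contra hn
    rw [not_and_or] at hn
    exact h (StarsTouch.of_not_separated ha hb hab hsep hn)
  rcases hp with ⟨hg, -⟩ | ⟨x, y, hxy, hA, rfl⟩
  · exact orient_ne_of_generic hg hab hn.1
  rcases hq with ⟨hg, -⟩ | ⟨x', y', hxy', hB, rfl⟩
  · exact orient_ne_of_generic hg hab.symm hn.2
  obtain ⟨hbA, hp⟩ := pair_line hxy hA hgp ha hab hn.1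
  obtain ⟨haB, hq⟩ := pair_line hxy' hB hgp hb hab.symm hn.2
  rw [segment_symm] at hq
  rcases segment_subset_union hq hp (left_mem_segment _ _ _) with h' | h'
  · exact h ⟨b, hbA, a, haB, hab.symm, _, left_mem_segment _ _ _, h'⟩
  · exact h ⟨a, ha, b, hb, hab, _, left_mem_segment _ _ _, h'⟩

lemma exists_special [Finite ι] {A : Finset ι} {p : ℝ × ℝ} (hinj : Function.Injective loc)
    (hgp : NoThreeCollinear loc) (hA : 1 < A.card) (hp : IsStarCentre loc A p)
    {κ : Type*} [Finite κ] (B : κ → Finset ι) (q : κ → ℝ × ℝ) (hB : ∀ k, 1 < (B k).card)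
    (hq : ∀ k, IsStarCentre loc (B k) (q k)) (h : ∀ k, ¬ StarsTouch loc A p (B k) (q k)) :
    ∃ p', IsCandidate loc p' ∧ IsSpecial loc A p' ∧
      ∀ k, ¬ StarsTouch loc A p' (B k) (q k) := by
  classical
  by_cases h2 : 2 < A.card
  · exact exists_special_of_three hinj hgp h2 hp B q
      (fun k => Finset.card_pos.1 (by have := hB k; omega)) hq h
  · obtain ⟨a, b, hab, rfl⟩ := Finset.card_eq_two.1 (by omega : A.card = 2)
    have hmem : ∀ i, i ∈ ({a, b} : Finset ι) ↔ i = a ∨ i = b := by simp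
    refine ⟨centroid3 (loc a) (loc a) (loc b), ⟨_, _, _, isVertexPoint_self a,
      isVertexPoint_self a, isVertexPoint_self b, rfl⟩, Or.inr ⟨a, b, hab, hmem, rfl⟩, fun k => ?_⟩
    refine not_starsTouch_pair (hinj.ne hab) hmem ?_ (centroid3_mem_openSegment _ _) (hB k) (h k)
    have := hp.mem_hull
    have e : loc '' {i | i ∈ ({a, b} : Finset ι)} = {loc a, loc b} := by
      ext x; simp [eq_comm]
    rwa [e, convexHull_pair] at this

/-- Replacing one vertex at a time is sound because each special position is again a star centre, so
the remaining vertices still see an admissible family. -/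
lemma exists_special_family [Finite ι] {n : ℕ} {A : Fin n → Finset ι} {pos : Fin n → ℝ × ℝ}
    (hinj : Function.Injective loc)
    (hgp : NoThreeCollinear loc) (hA : ∀ u, 1 < (A u).card) (hp : ∀ u, IsStarCentre loc (A u) (pos u))
    (h : ∀ u w, u ≠ w → ¬ StarsTouch loc (A u) (pos u) (A w) (pos w)) :
    ∃ pos' : Fin n → ℝ × ℝ, (∀ u, IsCandidate loc (pos' u)) ∧ (∀ u, IsSpecial loc (A u) (pos' u)) ∧
      ∀ u w, u ≠ w → ¬ StarsTouch loc (A u) (pos' u) (A w) (pos' w) := by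
  have key : ∀ S : Finset (Fin n), ∃ pos' : Fin n → ℝ × ℝ, (∀ u, IsStarCentre loc (A u) (pos' u)) ∧
      (∀ u ∈ S, IsCandidate loc (pos' u) ∧ IsSpecial loc (A u) (pos' u)) ∧
      ∀ u w, u ≠ w → ¬ StarsTouch loc (A u) (pos' u) (A w) (pos' w) := by
    intro S
    induction S using Finset.induction_on with
    | empty => exact ⟨pos, hp, by simp, h⟩
    | insert v S hv ih =>
      obtain ⟨pos', h1, h2, h3⟩ := ih
      obtain ⟨p', hc, hs, ht⟩ := exists_special hinj hgp (hA v) (h1 v)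
        (κ := {w // w ≠ v}) (fun w => A w) (fun w => pos' w) (fun w => hA w) (fun w => h1 w)
        (fun w => h3 v w w.2.symm)
      refine ⟨Function.update pos' v p', fun u => ?_, fun u hu => ?_, fun u w huw => ?_⟩
      · by_cases huv : u = v
        · subst huv
          rw [Function.update_self]
          exact (hs.validCentre hinj hgp).isStarCentre
        · rw [Function.update_of_ne huv]; exact h1 u
      · by_cases huv : u = v
        · subst huv
          rw [Function.update_self]
          exact ⟨hc, hs⟩
        · rw [Function.update_of_ne huv]
          exact h2 u ((Finset.mem_insert.1 hu).resolve_left huv)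
      · by_cases huv : u = v
        · subst huv
          rw [Function.update_self, Function.update_of_ne huw.symm]
          exact ht ⟨w, huw.symm⟩
        · rw [Function.update_of_ne huv]
          by_cases hwv : w = v
          · subst hwv
            rw [Function.update_self]
            exact fun h => ht ⟨u, huv⟩ h.symm
          · rw [Function.update_of_ne hwv]
            exact h3 u w huw
  obtain ⟨pos', -, h2, h3⟩ := key Finset.univ
  exact ⟨pos', fun u => (h2 u (Finset.mem_univ u)).1, fun u => (h2 u (Finset.mem_univ u)).2, h3⟩

/-! ### Drawings as families of stars that do not touch. -/

namespace FMBigraph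

lemma graph_adj {K : Type} (I : FMBigraph K) {x y : Fin I.nf ⊕ Fin I.nm} (h : I.graph.Adj x y) :
    ∃ m f, f ∈ I.nbr m ∧ ((x = Sum.inr m ∧ y = Sum.inl f) ∨ (y = Sum.inr m ∧ x = Sum.inl f)) := by
  rw [graph, SimpleGraph.fromRel_adj] at h
  obtain ⟨-, ⟨m, f, hf, h1, h2⟩ | ⟨m, f, hf, h1, h2⟩⟩ := h
  · exact ⟨m, f, hf, Or.inr ⟨h2, h1⟩⟩
  · exact ⟨m, f, hf, Or.inl ⟨h2, h1⟩⟩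

lemma graph_adj_of_mem {K : Type} (I : FMBigraph K) {m : Fin I.nm} {f : Fin I.nf}
    (h : f ∈ I.nbr m) : I.graph.Adj (Sum.inr m) (Sum.inl f) := by
  rw [graph, SimpleGraph.fromRel_adj]
  exact ⟨by simp, Or.inr ⟨m, f, h, rfl, rfl⟩⟩

/-- A vertex with no neighbour has an empty hull, and one with a single neighbour would be placed on
top of it; this explains the lower bound on the degrees. -/
lemma exists_centres (I : FMBigraph ℝ) (h : I.HasPlanarConvexHullDrawing) :
    ∃ pos : Fin I.nm → ℝ × ℝ, (∀ u, 1 < (I.nbr u).card) ∧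
      (∀ u, IsStarCentre I.loc (I.nbr u) (pos u)) ∧
      ∀ u w, u ≠ w → ¬ StarsTouch I.loc (I.nbr u) (pos u) (I.nbr w) (pos w) := by
  obtain ⟨pos, hpos, hd⟩ := h
  refine ⟨pos, fun u => ?_, fun u => ⟨hpos u, fun a ha f hfa hmem => ?_⟩, fun u w huw => ?_⟩
  · by_contra hcard
    have hu := hpos u
    rcases Nat.lt_or_ge 0 (I.nbr u).card with h0 | h0
    · obtain ⟨a, ha⟩ := Finset.card_eq_one.1 (by omega : (I.nbr u).card = 1)
      rw [hull, ha] at hu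
      have : pos u = I.loc a := by simpa using hu
      have := hd.injective (a₁ := Sum.inr u) (a₂ := Sum.inl a) this
      simp at this
    · have : I.nbr u = ∅ := Finset.card_eq_zero.1 (by omega)
      rw [hull, this] at hu
      simp at hu
  · have := hd.vertex_edge _ _ (Sum.inl f) (I.graph_adj_of_mem ha) hmem
    simp [hfa] at this
  · rintro ⟨a, ha, b, hb, hab, z, h1, h2⟩
    obtain ⟨y, hy1, hy2, -⟩ := hd.edge_edge _ _ _ _ (I.graph_adj_of_mem ha) (I.graph_adj_of_mem hb)
      (by simp [huw]) z ⟨h1, h2⟩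
    rw [Sym2.mem_iff] at hy1 hy2
    rcases hy1 with rfl | rfl
    · simp [huw] at hy2
    · simp [hab] at hy2

/-- Two edges with a common end that meet elsewhere are nested. Within one star this puts a leaf on
another edge; for a common leaf of two stars it puts one centre on the other star, and a second leaf
of that centre exhibits a forbidden contact. -/
lemma hasPlanarConvexHullDrawing_of_centres (I : FMBigraph ℝ) (pos : Fin I.nm → ℝ × ℝ)
    (hA : ∀ u, 1 < (I.nbr u).card) (hp : ∀ u, IsStarCentre I.loc (I.nbr u) (pos u))
    (ht : ∀ u w, u ≠ w → ¬ StarsTouch I.loc (I.nbr u) (pos u) (I.nbr w) (pos w)) :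
    I.HasPlanarConvexHullDrawing := by
  have hne : ∀ u f, pos u ≠ I.loc f := by
    intro u f e
    obtain ⟨a, ha, haf⟩ := (I.nbr u).exists_mem_ne (hA u) f
    exact (hp u).notMem_segment a ha f haf.symm (e ▸ left_mem_segment _ _ _)
  have hseg : ∀ u w a, u ≠ w → a ∈ I.nbr u → pos w ∉ segment ℝ (pos u) (I.loc a) := by
    intro u w a huw ha hmem
    obtain ⟨b, hb, hba⟩ := (I.nbr w).exists_mem_ne (hA w) a
    exact ht u w huw ⟨a, ha, b, hb, hba.symm, pos w, hmem, left_mem_segment _ _ _⟩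
  have hee : ∀ u a w b, a ∈ I.nbr u → b ∈ I.nbr w → (u ≠ w ∨ a ≠ b) →
      ∀ z, z ∈ segment ℝ (pos u) (I.loc a) → z ∈ segment ℝ (pos w) (I.loc b) →
      (u = w ∧ z = pos u) ∨ (a = b ∧ z = I.loc a) := by
    intro u a w b ha hb h z h1 h2
    by_cases huw : u = w
    · subst huw
      have hab : a ≠ b := by simpa using h
      by_cases hz : z = pos u
      · exact Or.inl ⟨rfl, hz⟩
      · rw [segment_symm] at h1 h2
        rcases mem_segment_or_of_common h1 h2 hz with h | h
        · rw [segment_symm] at h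
          exact absurd h ((hp u).notMem_segment b hb a hab)
        · rw [segment_symm] at h
          exact absurd h ((hp u).notMem_segment a ha b hab.symm)
    · by_cases hab : a = b
      · subst hab
        by_cases hz : z = I.loc a
        · exact Or.inr ⟨rfl, hz⟩
        · rcases mem_segment_or_of_common h1 h2 hz with h | h
          · exact absurd h (hseg w u a (Ne.symm huw) hb)
          · exact absurd h (hseg u w a huw ha)
      · exact absurd ⟨a, ha, b, hb, hab, z, h1, h2⟩ (ht u w huw)
  refine ⟨pos, fun u => (hp u).mem_hull, ?_, ?_, ?_⟩
  · rintro (f | u) (g | w) h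
    · rw [I.loc_injective h]
    · exact absurd h.symm (hne w f)
    · exact absurd h (hne u g)
    · by_contra huw
      have huw' : u ≠ w := fun e => huw (by rw [e])
      obtain ⟨a, ha⟩ := Finset.card_pos.1 (by have := hA u; omega : 0 < (I.nbr u).card)
      exact hseg u w a huw' ha (by
        have : pos u = pos w := h
        rw [← this]; exact left_mem_segment _ _ _)
  · intro x y w hxy hw
    obtain ⟨m, f, hf, h⟩ := I.graph_adj hxy
    have key : Sum.elim I.loc pos w ∈ segment ℝ (pos m) (I.loc f) → w = Sum.inr m ∨ w = Sum.inl f := by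
      intro hw
      rcases w with g | k
      · by_contra hcon
        exact (hp m).notMem_segment f hf g (by rintro rfl; simp at hcon) hw
      · by_contra hcon
        exact hseg m k f (by rintro rfl; simp at hcon) hf hw
    rcases h with ⟨rfl, rfl⟩ | ⟨rfl, rfl⟩
    · exact key hw
    · rw [segment_symm] at hw
      exact (key hw).symm
  · intro x y x' y' hxy hxy' hne z hz
    obtain ⟨m, f, hf, h⟩ := I.graph_adj hxy
    obtain ⟨m', f', hf', h'⟩ := I.graph_adj hxy'
    have e1 : s(x, y) = s(Sum.inr m, Sum.inl f) := by
      rcases h with ⟨rfl, rfl⟩ | ⟨rfl, rfl⟩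
      · rfl
      · exact Sym2.eq_swap
    have e2 : s(x', y') = s(Sum.inr m', Sum.inl f') := by
      rcases h' with ⟨rfl, rfl⟩ | ⟨rfl, rfl⟩
      · rfl
      · exact Sym2.eq_swap
    have s1 : segment ℝ (Sum.elim I.loc pos x) (Sum.elim I.loc pos y) =
        segment ℝ (pos m) (I.loc f) := by
      rcases h with ⟨rfl, rfl⟩ | ⟨rfl, rfl⟩
      · rfl
      · exact segment_symm _ _ _
    have s2 : segment ℝ (Sum.elim I.loc pos x') (Sum.elim I.loc pos y') =
        segment ℝ (pos m') (I.loc f') := by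
      rcases h' with ⟨rfl, rfl⟩ | ⟨rfl, rfl⟩
      · rfl
      · exact segment_symm _ _ _
    rw [e1, e2] at hne ⊢
    rw [s1, s2] at hz
    have hne' : m ≠ m' ∨ f ≠ f' := by
      by_contra hcon
      push Not at hcon
      exact hne (by rw [hcon.1, hcon.2])
    rcases hee m f m' f' hf hf' hne' z hz.1 hz.2 with ⟨rfl, rfl⟩ | ⟨rfl, rfl⟩
    · exact ⟨Sum.inr m, by simp, by simp, rfl⟩
    · exact ⟨Sum.inl f, by simp, by simp, rfl⟩

lemma noThreeCollinear (I : FMBigraph ℝ) (h : I.InGeneralPosition) : NoThreeCollinear I.loc :=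
  fun i j k hij hik hjk h0 => h i j k hij hik hjk ((collinear_iff_orient _ _ _).2 h0)

/-- Under general position, a drawing exists only if one exists in which mobile vertices are placed
at candidates that pass the tests. -/
theorem exists_candidates (I : FMBigraph ℝ) (hgp : I.InGeneralPosition)
    (h : I.HasPlanarConvexHullDrawing) :
    ∃ pos : Fin I.nm → ℝ × ℝ, (∀ u, IsCandidate I.loc (pos u)) ∧
      (∀ u, ValidCentre I.loc (I.nbr u) (pos u)) ∧
      ∀ u w, u ≠ w → CompatibleCentres I.loc (I.nbr u) (pos u) (I.nbr w) (pos w) := by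
  obtain ⟨pos, hA, hp, ht⟩ := I.exists_centres h
  have hgp' := I.noThreeCollinear hgp
  obtain ⟨pos', hc, hs, ht'⟩ := exists_special_family I.loc_injective hgp' hA hp ht
  exact ⟨pos', hc, fun u => (hs u).validCentre I.loc_injective hgp',
    fun u w huw => (hs u).compatibleCentres hgp' (hs w) (ht' u w huw)⟩

/-- Positions that pass the tests, for pairs adjacent in the CH intersection graph, give a drawing. -/
theorem hasPlanarConvexHullDrawing_of_tests (I : FMBigraph ℝ) (pos : Fin I.nm → ℝ × ℝ)
    (hv : ∀ u, ValidCentre I.loc (I.nbr u) (pos u))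
    (hc : ∀ u w, I.chGraph.Adj u w →
      CompatibleCentres I.loc (I.nbr u) (pos u) (I.nbr w) (pos w) ∨
      CompatibleCentres I.loc (I.nbr w) (pos w) (I.nbr u) (pos u)) :
    I.HasPlanarConvexHullDrawing := by
  refine I.hasPlanarConvexHullDrawing_of_centres pos (fun u => (hv u).one_lt_card)
    (fun u => (hv u).isStarCentre) ?_
  rintro u w huw ⟨a, ha, b, hb, hab, z, h1, h2⟩
  -- Stars stay inside the hulls, so a contact is possible only between vertices adjacent in the CH
  -- intersection graph.
  have hsub : ∀ u a, a ∈ I.nbr u → segment ℝ (pos u) (I.loc a) ⊆ I.hull u := fun u a ha =>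
    (convex_convexHull ℝ _).segment_subset (hv u).isStarCentre.mem_hull
      (subset_convexHull ℝ _ ⟨a, ha, rfl⟩)
  rcases hc u w ⟨huw, z, hsub u a ha h1, hsub w b hb h2⟩ with h | h
  · exact Set.disjoint_left.1 (h a ha b hb hab).disjoint h1 h2
  · exact Set.disjoint_left.1 (h b hb a ha hab.symm).disjoint h2 h1

end FMBigraph

end Drawings

/-! ### Path consistency is complete over a cactus. -/

section CactusConsistency

variable {V D : Type}

/-- The path `P` and the edge `sw` form a cycle. An excursion that leaves `x` by a new edge and
returns to `P` without `x` can be closed up along `P` to a second cycle. Its last edge into `x`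
belongs to `P`, so the cycles share both ends of this edge, although they differ in the edge `xq`.
-/
lemma IsCactus.no_chord {H : SimpleGraph V} (hH : IsCactus H) {s w : V} (hsw : H.Adj s w)
    (P : H.Walk w s) (hP : P.IsPath) (hsP : s(s, w) ∉ P.edges) {x y q : V} (hx : x ∈ P.support)
    (hy : y ∈ P.support) (hxq : H.Adj x q) (he : s(x, q) ∉ P.edges)
    (he' : s(x, q) ≠ s(s, w)) (Q : H.Walk q y) (hQ : x ∉ Q.support) : False := by
  classical
  have h1 : (SimpleGraph.Walk.cons hsw P).IsCycle :=
    (SimpleGraph.Walk.cons_isCycle_iff P hsw).2 ⟨hP, hsP⟩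
  obtain ⟨W, hW⟩ : ∃ W : H.Walk y x, W.edges ⊆ P.edges := by
    have hsplit := P.take_spec hx
    have hy' : y ∈ (P.takeUntil x hx).support ∨ y ∈ (P.dropUntil x hx).support := by
      rw [← SimpleGraph.Walk.mem_support_append_iff, hsplit]; exact hy
    rcases hy' with h | h
    · exact ⟨(P.takeUntil x hx).dropUntil y h, fun e he => P.edges_takeUntil_subset_edges hx
        ((P.takeUntil x hx).edges_dropUntil_subset_edges h he)⟩
    · refine ⟨((P.dropUntil x hx).takeUntil y h).reverse, ?_⟩
      intro e he
      rw [SimpleGraph.Walk.edges_reverse, List.mem_reverse] at he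
      exact P.edges_dropUntil_subset_edges hx
        ((P.dropUntil x hx).edges_takeUntil_subset_edges h he)
  set B := (Q.append W).bypass with hB
  have hBe : ∀ e ∈ B.edges, e ∈ Q.edges ∨ e ∈ P.edges := by
    intro e he
    have := (Q.append W).edges_bypass_subset_edges he
    rw [SimpleGraph.Walk.edges_append, List.mem_append] at this
    exact this.imp_right fun h => hW h
  have hQx : ∀ z, s(x, z) ∉ Q.edges := fun z hz => hQ (Q.fst_mem_support_of_mem_edges hz)
  have h2 : (SimpleGraph.Walk.cons hxq B).IsCycle := by
    refine (SimpleGraph.Walk.cons_isCycle_iff B hxq).2 ⟨SimpleGraph.Walk.bypass_isPath _, fun h => ?_⟩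
    rcases hBe _ h with h | h
    · exact hQx _ h
    · exact he h
  have hnil : ¬ B.Nil := SimpleGraph.Walk.not_nil_of_ne hxq.ne.symm
  have hz : s(B.penultimate, x) ∈ B.edges := B.mk_penultimate_end_mem_edges hnil
  have hzP : B.penultimate ∈ P.support := by
    rcases hBe _ hz with h | h
    · rw [Sym2.eq_swap] at h
      exact absurd h (hQx _)
    · exact P.fst_mem_support_of_mem_edges h
  have hzB : B.penultimate ∈ B.support := B.fst_mem_support_of_mem_edges hz
  have hne : B.penultimate ≠ x := (B.adj_penultimate hnil).ne
  have hsub := hH.2 _ _ _ _ h1 h2 (by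
    intro h
    have : s(x, q) ∈ {e | e ∈ (SimpleGraph.Walk.cons hxq B).edges} := by simp
    rw [← h] at this
    simp only [SimpleGraph.Walk.edges_cons, Set.mem_ofPred_eq, List.mem_cons] at this
    rcases this with h | h
    · exact he' h
    · exact he h)
  refine hne (hsub ⟨?_, ?_⟩ ⟨?_, ?_⟩)
  · simp [hzP]
  · simp [hzB]
  · simp [hx]
  · simp

/-- Both end values are prescribed. Consistency of the pair formed by the current vertex and the
final vertex gives a value at the next vertex that is still compatible with the final one, so the
path closes with the correct value. -/
lemma exists_extension_path {H : SimpleGraph V} {R : V → V → D → D → Prop}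
    (hdiag : ∀ u x y, R u u x y → x = y)
    (hpc : ∀ u v w x y, R u v x y → ∃ z, R u w x z ∧ R w v z y) {a b : V} (P : H.Walk a b)
    (hP : P.IsPath) (x y : D) (h : R a b x y) :
    ∃ g : V → D, g a = x ∧ g b = y ∧ (∀ u ∈ P.support, R u u (g u) (g u)) ∧
      ∀ u v, s(u, v) ∈ P.edges → R u v (g u) (g v) ∨ R v u (g v) (g u) := by
  classical
  induction P generalizing x with
  | nil =>
    rename_i u
    refine ⟨fun _ => x, rfl, hdiag _ _ _ h, fun v hv => ?_, by simp⟩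
    obtain rfl : v = u := by simpa using hv
    have := hdiag _ _ _ h
    subst this
    exact h
  | cons hadj p ih =>
    rename_i a c b
    rw [SimpleGraph.Walk.cons_isPath_iff] at hP
    obtain ⟨z, hz1, hz2⟩ := hpc a b c x y h
    obtain ⟨g, hg1, hg2, hg3, hg4⟩ := ih hP.1 z hz2
    -- Extending a pair to its own first vertex makes the value there self-compatible, since
    -- diagonal entries relate only equal values.
    obtain ⟨z', hz', -⟩ := hpc a c a x z hz1
    obtain rfl := hdiag _ _ _ hz'
    have hne : ∀ u ∈ p.support, u ≠ a := fun u hu e => hP.2 (e ▸ hu)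
    have hup : ∀ u ∈ p.support, Function.update g a x u = g u :=
      fun u hu => Function.update_of_ne (hne u hu) _ _
    refine ⟨Function.update g a x, by simp, ?_, ?_, ?_⟩
    · rw [hup b p.end_mem_support, hg2]
    · intro u hu
      rw [SimpleGraph.Walk.support_cons, List.mem_cons] at hu
      rcases hu with rfl | hu
      · simpa using hz'
      · rw [hup u hu]; exact hg3 u hu
    · intro u v huv
      rw [SimpleGraph.Walk.edges_cons, List.mem_cons] at huv
      rcases huv with huv | huv
      · rw [Sym2.eq_iff] at huv
        rcases huv with ⟨rfl, rfl⟩ | ⟨rfl, rfl⟩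
        · left
          rw [hup _ p.start_mem_support, Function.update_self, hg1]; exact hz1
        · right
          rw [hup _ p.start_mem_support, Function.update_self, hg1]; exact hz1
      · rw [hup u (p.fst_mem_support_of_mem_edges huv), hup v (p.snd_mem_support_of_mem_edges huv)]
        exact hg4 u v huv

/-- The edges of `H` that are not inside `S`. -/
def outerGraph (H : SimpleGraph V) (S : Set V) : SimpleGraph V where
  Adj u v := H.Adj u v ∧ ¬ (u ∈ S ∧ v ∈ S)
  symm := ⟨fun _ _ h => ⟨h.1.symm, fun h' => h.2 h'.symm⟩⟩
  loopless := ⟨fun _ h => h.1.ne rfl⟩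

lemma outerGraph_le (H : SimpleGraph V) (S : Set V) : outerGraph H S ≤ H := fun _ _ h => h.1

lemma outerGraph_anti (H : SimpleGraph V) {S T : Set V} (h : S ⊆ T) :
    outerGraph H T ≤ outerGraph H S :=
  fun _ _ h' => ⟨h'.1, fun h'' => h'.2 ⟨h h''.1, h h''.2⟩⟩

/-- A partial solution on a set `S` that is attached to the rest of the graph in single vertices. -/
def IsPartialSolution (H : SimpleGraph V) (R : V → V → D → D → Prop) (S : Set V) : Prop :=
  ∃ f : V → D, (∀ u ∈ S, R u u (f u) (f u)) ∧
    (∀ u ∈ S, ∀ v ∈ S, H.Adj u v → R u v (f u) (f v) ∨ R v u (f v) (f u)) ∧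
    ∀ s ∈ S, ∀ t ∈ S, (outerGraph H S).Reachable s t → s = t

/-- As `sw` is a bridge of the outer graph, `w` has no other neighbour in `S`, so one compatible
value suffices, and the enlarged set is still attached in single vertices. -/
lemma IsPartialSolution.exists_insert {H : SimpleGraph V} {R : V → V → D → D → Prop}
    (hdiag : ∀ u x y, R u u x y → x = y)
    (hpc : ∀ u v w x y, R u v x y → ∃ z, R u w x z ∧ R w v z y) {S : Set V}
    (hS : IsPartialSolution H R S) {s w : V} (hs : s ∈ S) (hw : w ∉ S) (hsw : H.Adj s w)
    (hbr : ¬ ((outerGraph H S).deleteEdges {s(s, w)}).Reachable w s) :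
    IsPartialSolution H R (insert w S) := by
  classical
  obtain ⟨f, h1, h2, h3⟩ := hS
  obtain ⟨z, hz, -⟩ := hpc s s w _ _ (h1 s hs)
  obtain ⟨z', hz1', hz2'⟩ := hpc s w w _ _ hz
  obtain rfl := hdiag _ _ _ hz2'
  have hadj : (outerGraph H S).Adj s w := ⟨hsw, fun h => hw h.2⟩
  have hup : ∀ u ∈ S, Function.update f w z' u = f u :=
    fun u hu => Function.update_of_ne (by rintro rfl; exact hw hu) _ _
  have honly : ∀ v ∈ S, H.Adj w v → v = s := by
    intro v hv hwv
    have : (outerGraph H S).Adj w v := ⟨hwv, fun h => hw h.1⟩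
    exact h3 v hv s hs (this.symm.reachable.trans hadj.symm.reachable)
  have hle := outerGraph_anti H (Set.subset_insert w S)
  have hle' : outerGraph H (insert w S) ≤ (outerGraph H S).deleteEdges {s(s, w)} := by
    intro u v huv
    rw [SimpleGraph.deleteEdges_adj]
    refine ⟨hle huv, fun h => huv.2 ?_⟩
    rw [Set.mem_singleton_iff, Sym2.eq_iff] at h
    rcases h with ⟨rfl, rfl⟩ | ⟨rfl, rfl⟩
    · exact ⟨Or.inr hs, Or.inl rfl⟩
    · exact ⟨Or.inl rfl, Or.inr hs⟩
  have hnew : ∀ t ∈ S, ¬ (outerGraph H (insert w S)).Reachable w t := by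
    intro t ht h
    obtain rfl := h3 t ht s hs ((h.mono hle).symm.trans hadj.symm.reachable)
    exact hbr (h.mono hle')
  refine ⟨Function.update f w z', ?_, ?_, ?_⟩
  · rintro u (rfl | hu)
    · simpa using hz2'
    · rw [hup u hu]; exact h1 u hu
  · rintro u (rfl | hu) v (rfl | hv) huv
    · exact absurd huv (H.irrefl)
    · obtain rfl := honly v hv huv
      right
      rw [hup v hv, Function.update_self]; exact hz
    · obtain rfl := honly u hu huv.symm
      left
      rw [hup u hu, Function.update_self]; exact hz
    · rw [hup u hu, hup v hv]; exact h2 u hu v hv huv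
  · rintro u (rfl | hu) v (rfl | hv) huv
    · rfl
    · exact absurd huv (hnew v hv)
    · exact absurd huv.symm (hnew u hu)
    · exact h3 u hu v hv (huv.mono hle)

/-- The edge `sw` lies on a cycle of the outer graph, which meets `S` only in `s`. Values are
propagated along the rest of the cycle back to `s`. By the cactus property the cycle has no chords
and no excursions, so there are no further constraints and single-vertex attachment is preserved. -/
lemma IsPartialSolution.exists_union {H : SimpleGraph V} (hH : IsCactus H)
    {R : V → V → D → D → Prop} (hdiag : ∀ u x y, R u u x y → x = y)
    (hpc : ∀ u v w x y, R u v x y → ∃ z, R u w x z ∧ R w v z y) {S : Set V}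
    (hS : IsPartialSolution H R S) {s w : V} (hs : s ∈ S) (hw : w ∉ S) (hsw : H.Adj s w)
    (hbr : ((outerGraph H S).deleteEdges {s(s, w)}).Reachable w s) :
    ∃ T, w ∈ T ∧ IsPartialSolution H R (S ∪ T) := by
  classical
  obtain ⟨f, h1, h2, h3⟩ := hS
  obtain ⟨P', hP'⟩ := hbr.exists_isPath
  have hle1 : (outerGraph H S).deleteEdges {s(s, w)} ≤ outerGraph H S :=
    SimpleGraph.deleteEdges_le _
  set P := P'.mapLe (hle1.trans (outerGraph_le H S)) with hPdef
  have hPs : P.support = P'.support := by rw [hPdef, SimpleGraph.Walk.support_mapLe_eq_support]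
  have hPe : P.edges = P'.edges := by rw [hPdef, SimpleGraph.Walk.edges_mapLe_eq_edges]
  have hP : P.IsPath := by rw [SimpleGraph.Walk.isPath_def, hPs]; exact hP'.support_nodup
  have hsP : s(s, w) ∉ P.edges := by
    rw [hPe]
    intro h
    have := P'.edges_subset_edgeSet h
    simp [SimpleGraph.edgeSet_deleteEdges] at this
  have hreach : ∀ x ∈ P.support, (outerGraph H S).Reachable x s := by
    intro x hx
    rw [hPs] at hx
    exact ⟨(P'.dropUntil x hx).mapLe hle1⟩
  have hsw' : s ∈ P.support := P.end_mem_support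
  have hww' : w ∈ P.support := P.start_mem_support
  -- Extending the diagonal pair at `s` to `w` gives both orders: `hz1` covers the closing edge
  -- `sw`, and `hz2` starts the propagation along `P`.
  obtain ⟨z, hz1, hz2⟩ := hpc s s w _ _ (h1 s hs)
  obtain ⟨g, hgw, hgs, hg1, hg2⟩ := exists_extension_path hdiag hpc P hP z (f s) hz2
  have hPS : ∀ x ∈ P.support, x ∈ S → x = s := fun x hx hxS => h3 x hxS s hs (hreach x hx)
  set f' : V → D := fun x => if x ∈ S then f x else g x with hf'
  have hf'S : ∀ x ∈ S, f' x = f x := fun x hx => by simp [hf', hx]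
  have hf'P : ∀ x ∈ P.support, f' x = g x := by
    intro x hx
    by_cases hxS : x ∈ S
    · obtain rfl := hPS x hx hxS
      rw [hf'S _ hxS, hgs]
    · simp [hf', hxS]
  refine ⟨{x | x ∈ P.support}, hww', f', ?_, ?_, ?_⟩
  · rintro u (hu | hu)
    · rw [hf'S u hu]; exact h1 u hu
    · rw [hf'P u hu]; exact hg1 u hu
  · have hcross : ∀ u ∈ S, ∀ v ∈ P.support, v ∉ S → H.Adj u v → u = s := by
      intro u hu v hv hvS huv
      have : (outerGraph H S).Adj u v := ⟨huv, fun h => hvS h.2⟩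
      exact h3 u hu s hs (this.reachable.trans (hreach v hv))
    intro u hu v hv huv
    by_cases huP : u ∈ P.support
    · by_cases hvP : v ∈ P.support
      · rw [hf'P u huP, hf'P v hvP]
        by_cases he : s(u, v) ∈ P.edges
        · exact hg2 u v he
        · by_cases he' : s(u, v) = s(s, w)
          · rw [Sym2.eq_iff] at he'
            rcases he' with ⟨rfl, rfl⟩ | ⟨rfl, rfl⟩
            · left; rw [hgs, hgw]; exact hz1
            · right; rw [hgs, hgw]; exact hz1
          · exact (hH.no_chord hsw P hP hsP huP hvP huv he he' SimpleGraph.Walk.nil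
              (by simpa using huv.ne)).elim
      · have hvS : v ∈ S := hv.resolve_right hvP
        by_cases huS : u ∈ S
        · rw [hf'S u huS, hf'S v hvS]; exact h2 u huS v hvS huv
        · exact absurd (hcross v hvS u huP huS huv.symm ▸ hsw') hvP
    · have huS : u ∈ S := hu.resolve_right huP
      by_cases hvS : v ∈ S
      · rw [hf'S u huS, hf'S v hvS]; exact h2 u huS v hvS huv
      · exact absurd (hcross u huS v (hv.resolve_left hvS) hvS huv ▸ hsw') huP
  · have hle := outerGraph_anti H (Set.subset_union_left (s := S) (t := {x | x ∈ P.support}))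
    intro x hx y hy hxy
    by_contra hne
    have hmem : ∀ x y, x ∈ S ∪ {x | x ∈ P.support} → y ∈ S ∪ {x | x ∈ P.support} →
        (outerGraph H S).Reachable x y → x ≠ y → x ∈ P.support := by
      intro x y hx hy hxy hne
      rcases hx with hx | hx
      · rcases hy with hy | hy
        · exact absurd (h3 x hx y hy hxy) hne
        · have := h3 x hx s hs (hxy.trans (hreach y hy))
          rw [this]; exact hsw'
      · exact hx
    have hxP := hmem x y hx hy (hxy.mono hle) hne
    have hyP := hmem y x hy hx (hxy.mono hle).symm (Ne.symm hne)
    obtain ⟨Q', hQ'⟩ := hxy.exists_isPath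
    cases Q' with
    | nil => exact hne rfl
    | cons hadj Q =>
      rename_i q
      rw [SimpleGraph.Walk.cons_isPath_iff] at hQ'
      have hqP : q ∉ P.support := fun h => hadj.2 ⟨hx, Or.inr h⟩
      refine hH.no_chord hsw P hP hsP hxP hyP hadj.1
        (fun h => hqP (P.snd_mem_support_of_mem_edges h)) (fun h => ?_)
        (Q.mapLe (outerGraph_le H _)) ?_
      · rw [Sym2.eq_iff] at h
        rcases h with ⟨rfl, rfl⟩ | ⟨rfl, rfl⟩
        · exact hqP hww'
        · exact hqP hsw'
      · rw [SimpleGraph.Walk.support_mapLe_eq_support]; exact hQ'.2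

/-- Over a cactus, a nonempty path consistent network has a solution. -/
theorem exists_solution_of_pathConsistent [Finite V] {H : SimpleGraph V} (hH : IsCactus H)
    {R : V → V → D → D → Prop} (hdiag : ∀ u x y, R u u x y → x = y)
    (hpc : ∀ u v w x y, R u v x y → ∃ z, R u w x z ∧ R w v z y)
    (hne : ∃ u v x y, R u v x y) :
    ∃ f : V → D, (∀ u, R u u (f u) (f u)) ∧
      ∀ u v, H.Adj u v → R u v (f u) (f v) ∨ R v u (f v) (f u) := by
  obtain ⟨u₀, v₀, x₀, y₀, h₀⟩ := hne
  obtain ⟨z, hz, -⟩ := hpc u₀ v₀ u₀ x₀ y₀ h₀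
  obtain rfl := hdiag _ _ _ hz
  have hstart : IsPartialSolution H R {u₀} := by
    refine ⟨fun _ => x₀, ?_, ?_, ?_⟩
    · rintro u rfl; exact hz
    · rintro u rfl v rfl h; exact absurd h H.irrefl
    · rintro u rfl v rfl _; rfl
  -- A maximal nonempty partial solution is everything: by connectedness an edge would leave it, and
  -- that edge is either a bridge of the outer graph or lies on a cycle.
  obtain ⟨S, hS⟩ := (Set.toFinite {S : Set V | IsPartialSolution H R S ∧ S.Nonempty}).exists_maximal
    ⟨_, hstart, ⟨u₀, rfl⟩⟩
  have huniv : ∀ v, v ∈ S := by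
    by_contra hcon
    push Not at hcon
    obtain ⟨v, hv⟩ := hcon
    obtain ⟨u, hu⟩ := hS.1.2
    obtain ⟨p⟩ := hH.1.preconnected u v
    obtain ⟨d, -, hd1, hd2⟩ := p.exists_boundary_dart S hu hv
    by_cases hbr : ((outerGraph H S).deleteEdges {s(d.fst, d.snd)}).Reachable d.snd d.fst
    · obtain ⟨T, hT, hT'⟩ := hS.1.1.exists_union hH hdiag hpc hd1 hd2 d.adj hbr
      exact hd2 (hS.2 ⟨hT', hS.1.2.mono Set.subset_union_left⟩ Set.subset_union_left (Or.inr hT))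
    · have := hS.1.1.exists_insert hdiag hpc hd1 hd2 d.adj hbr
      exact hd2 (hS.2 ⟨this, ⟨_, Or.inl rfl⟩⟩ (Set.subset_insert _ _) (Or.inl rfl))
  obtain ⟨f, h1, h2, -⟩ := hS.1.1
  exact ⟨f, fun u => h1 u (huniv u), fun u v => h2 u (huniv u) v (huniv v)⟩

end CactusConsistency

/-! ## Reasoning about programs -/

/-- Bounds for the size of the result of a field operation. -/
structure SizeBound {K : Type} [Field K] (sz : K → ℕ) : Prop where
  natCast : ∀ n : ℕ, sz n ≤ 2 * n + 2
  add : ∀ x y, sz (x + y) ≤ 2 * (sz x + sz y) + 2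
  sub : ∀ x y, sz (x - y) ≤ 2 * (sz x + sz y) + 2
  mul : ∀ x y, sz (x * y) ≤ 2 * (sz x + sz y) + 2
  div : ∀ x y, sz (x / y) ≤ 2 * (sz x + sz y) + 2

/-- All numbers in memory are bounded by `X` in value or size. -/
structure BoundedState {K : Type} (sz : K → ℕ) (X : ℕ) (s : RamState K) : Prop where
  nat : ∀ a i, s.nat a i ≤ X
  num : ∀ a i, sz (s.num a i) ≤ X

/-- The arrays of natural numbers written by a program. -/
def RamProgram.natWrites : RamProgram → List ℕ
  | .skip => []
  | .setNat a _ _ => [a]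
  | .setNum _ _ _ => []
  | .seq P Q => P.natWrites ++ Q.natWrites
  | .ite _ P Q => P.natWrites ++ Q.natWrites
  | .while _ P => P.natWrites

/-- The arrays of field elements written by a program. -/
def RamProgram.numWrites : RamProgram → List ℕ
  | .skip => []
  | .setNat _ _ _ => []
  | .setNum a _ _ => [a]
  | .seq P Q => P.numWrites ++ Q.numWrites
  | .ite _ P Q => P.numWrites ++ Q.numWrites
  | .while _ P => P.numWrites

/-- The memories agree outside the arrays written by `P`. -/
structure AgreeOutside {K : Type} (P : RamProgram) (s s' : RamState K) : Prop where
  nat : ∀ a, a ∉ P.natWrites → s'.nat a = s.nat a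
  num : ∀ a, a ∉ P.numWrites → s'.num a = s.num a

section Steps

set_option linter.unusedSectionVars false

variable {K : Type} [Field K] [LinearOrder K]

/-- Runs in which every memory satisfies `B`, together with the number of steps. -/
inductive StepRuns (B : RamState K → Prop) : RamProgram → RamState K → RamState K → ℕ → Prop
  | skip (s : RamState K) : B s → StepRuns B .skip s s 1
  | setNat (a : ℕ) (i e : NatExp) (s : RamState K) : B s → B (s.setNat a (i.eval s) (e.eval s)) →
      StepRuns B (.setNat a i e) s (s.setNat a (i.eval s) (e.eval s)) 1
  | setNum (a : ℕ) (i : NatExp) (e : NumExp) (s : RamState K) : B s →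
      B (s.setNum a (i.eval s) (e.eval s)) →
      StepRuns B (.setNum a i e) s (s.setNum a (i.eval s) (e.eval s)) 1
  | seq {P Q : RamProgram} {s s' s'' : RamState K} {t t' : ℕ} :
      StepRuns B P s s' t → StepRuns B Q s' s'' t' → StepRuns B (.seq P Q) s s'' (t + t')
  | ite_true {b : BoolExp} {P Q : RamProgram} {s s' : RamState K} {t : ℕ} :
      b.Holds s → B s → StepRuns B P s s' t → StepRuns B (.ite b P Q) s s' (1 + t)
  | ite_false {b : BoolExp} {P Q : RamProgram} {s s' : RamState K} {t : ℕ} :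
      ¬ b.Holds s → B s → StepRuns B Q s s' t → StepRuns B (.ite b P Q) s s' (1 + t)
  | while_false {b : BoolExp} {P : RamProgram} {s : RamState K} :
      ¬ b.Holds s → B s → StepRuns B (.while b P) s s 1
  | while_true {b : BoolExp} {P : RamProgram} {s s' s'' : RamState K} {t t' : ℕ} :
      b.Holds s → B s → StepRuns B P s s' t → StepRuns B (.while b P) s' s'' t' →
        StepRuns B (.while b P) s s'' (1 + t + t')

lemma StepRuns.final {B : RamState K → Prop} {P : RamProgram} {s s' : RamState K} {m : ℕ}
    (h : StepRuns B P s s' m) : B s' := by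
  induction h <;> assumption

lemma StepRuns.agreeOutside {B : RamState K → Prop} {P : RamProgram} {s s' : RamState K} {m : ℕ}
    (h : StepRuns B P s s' m) : AgreeOutside P s s' := by
  induction h with
  | skip => exact ⟨fun _ _ => rfl, fun _ _ => rfl⟩
  | setNat a i e s =>
    refine ⟨fun b hb => ?_, fun _ _ => rfl⟩
    simp only [RamProgram.natWrites, List.mem_singleton] at hb
    simp [RamState.setNat, Function.update_of_ne hb]
  | setNum a i e s =>
    refine ⟨fun _ _ => rfl, fun b hb => ?_⟩
    simp only [RamProgram.numWrites, List.mem_singleton] at hb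
    simp [RamState.setNum, Function.update_of_ne hb]
  | seq _ _ ih1 ih2 =>
    refine ⟨fun a ha => ?_, fun a ha => ?_⟩
    · simp only [RamProgram.natWrites, List.mem_append, not_or] at ha
      rw [ih2.nat a ha.2, ih1.nat a ha.1]
    · simp only [RamProgram.numWrites, List.mem_append, not_or] at ha
      rw [ih2.num a ha.2, ih1.num a ha.1]
  | ite_true _ _ _ ih =>
    refine ⟨fun a ha => ?_, fun a ha => ?_⟩
    · simp only [RamProgram.natWrites, List.mem_append, not_or] at ha
      exact ih.nat a ha.1
    · simp only [RamProgram.numWrites, List.mem_append, not_or] at ha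
      exact ih.num a ha.1
  | ite_false _ _ _ ih =>
    refine ⟨fun a ha => ?_, fun a ha => ?_⟩
    · simp only [RamProgram.natWrites, List.mem_append, not_or] at ha
      exact ih.nat a ha.2
    · simp only [RamProgram.numWrites, List.mem_append, not_or] at ha
      exact ih.num a ha.2
  | while_false => exact ⟨fun _ _ => rfl, fun _ _ => rfl⟩
  | while_true _ _ _ _ ih1 ih2 =>
    exact ⟨fun a ha => (ih2.nat a ha).trans (ih1.nat a ha),
      fun a ha => (ih2.num a ha).trans (ih1.num a ha)⟩

/-! ### Polynomial cost of single steps -/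

lemma pow_add_pow_le_pow {X : ℕ} (hX : 2 ≤ X) {a b c : ℕ} (ha : a < c) (hb : b < c) :
    X ^ a + X ^ b ≤ X ^ c := by
  have h1 : X ^ a ≤ X ^ (c - 1) := Nat.pow_le_pow_right (by omega) (by omega)
  have h2 : X ^ b ≤ X ^ (c - 1) := Nat.pow_le_pow_right (by omega) (by omega)
  have h3 : X ^ c = X ^ (c - 1) * X := by rw [← pow_succ]; congr 1; omega
  have h4 := Nat.mul_le_mul_left (X ^ (c - 1)) hX
  omega

/-- Natural registers are bounded in value, so values of a fixed expression are polynomial in `X`;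
the binary length is bounded by the value itself. The exponent depends only on the expression. -/
lemma natExp_cost_bound (e : NatExp) : ∃ k, ∀ (X : ℕ) (s : RamState K), 2 ≤ X →
    (∀ a i, s.nat a i ≤ X) → e.eval s ≤ X ^ k ∧ e.cost s ≤ X ^ k := by
  have size_le : ∀ n : ℕ, n.size ≤ n := fun n => Nat.size_le.2 n.lt_two_pow_self
  have bin : ∀ (X k₁ k₂ v c₁ c₂ : ℕ), 2 ≤ X → v ≤ X ^ (k₁ + k₂ + 1) → c₁ ≤ X ^ k₁ → c₂ ≤ X ^ k₂ →
      v ≤ X ^ (k₁ + k₂ + 4) ∧ 1 + v.size + c₁ + c₂ ≤ X ^ (k₁ + k₂ + 4) := by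
    intro X k₁ k₂ v c₁ c₂ hX hv h1 h2
    have p := size_le v
    have a1 := pow_add_pow_le_pow hX (a := 0) (b := k₁ + k₂ + 1) (c := k₁ + k₂ + 2) (by omega) (by omega)
    have a2 := pow_add_pow_le_pow hX (a := k₁) (b := k₂) (c := k₁ + k₂ + 3) (by omega) (by omega)
    have a3 := pow_add_pow_le_pow hX (a := k₁ + k₂ + 2) (b := k₁ + k₂ + 3) (c := k₁ + k₂ + 4)
      (by omega) (by omega)
    rw [pow_zero] at a1
    constructor <;> omega
  induction e with
  | const n =>
    refine ⟨n + 1, fun X s hX _ => ?_⟩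
    have h1 : n < X ^ n := Nat.lt_pow_self hX
    have h2 := size_le n
    have h3 : X ^ n * 2 ≤ X ^ (n + 1) := by rw [pow_succ]; gcongr
    simp only [NatExp.eval, NatExp.cost]
    constructor <;> omega
  | get a i ih =>
    obtain ⟨k, hk⟩ := ih
    refine ⟨0 + k + 4, fun X s hX hs => ?_⟩
    obtain ⟨h1, h2⟩ := hk X s hX hs
    simp only [NatExp.eval, NatExp.cost]
    have := bin X 0 k (s.nat a (i.eval s)) 0 (i.cost s) hX ?_ (by simp) h2
    · constructor <;> omega
    · exact (hs _ _).trans (Nat.le_self_pow (by omega) X)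
  | add e₁ e₂ ih₁ ih₂ =>
    obtain ⟨k₁, h₁⟩ := ih₁
    obtain ⟨k₂, h₂⟩ := ih₂
    refine ⟨k₁ + k₂ + 4, fun X s hX hs => ?_⟩
    refine bin X k₁ k₂ _ _ _ hX ?_ (h₁ X s hX hs).2 (h₂ X s hX hs).2
    have := pow_add_pow_le_pow hX (a := k₁) (b := k₂) (c := k₁ + k₂ + 1) (by omega) (by omega)
    have a1 := (h₁ X s hX hs).1
    have a2 := (h₂ X s hX hs).1
    simp only [NatExp.eval]
    omega
  | sub e₁ e₂ ih₁ ih₂ =>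
    obtain ⟨k₁, h₁⟩ := ih₁
    obtain ⟨k₂, h₂⟩ := ih₂
    refine ⟨k₁ + k₂ + 4, fun X s hX hs => ?_⟩
    refine bin X k₁ k₂ _ _ _ hX ?_ (h₁ X s hX hs).2 (h₂ X s hX hs).2
    have := pow_add_pow_le_pow hX (a := k₁) (b := k₂) (c := k₁ + k₂ + 1) (by omega) (by omega)
    have a1 := (h₁ X s hX hs).1
    simp only [NatExp.eval]
    omega
  | mul e₁ e₂ ih₁ ih₂ =>
    obtain ⟨k₁, h₁⟩ := ih₁
    obtain ⟨k₂, h₂⟩ := ih₂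
    refine ⟨k₁ + k₂ + 4, fun X s hX hs => ?_⟩
    refine bin X k₁ k₂ _ _ _ hX ?_ (h₁ X s hX hs).2 (h₂ X s hX hs).2
    calc _ ≤ X ^ k₁ * X ^ k₂ := Nat.mul_le_mul (h₁ X s hX hs).1 (h₂ X s hX hs).1
      _ = X ^ (k₁ + k₂) := (pow_add _ _ _).symm
      _ ≤ _ := Nat.pow_le_pow_right (by omega) (by omega)

/-- Field elements are bounded only in size. Each operation costs a constant factor in size,
absorbed by raising the exponent since `X ≥ 2`. -/
lemma numExp_cost_bound {sz : K → ℕ} (hsz : SizeBound sz) (e : NumExp) :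
    ∃ k, ∀ (X : ℕ) (s : RamState K), 2 ≤ X → BoundedState sz X s →
      sz (e.eval s) ≤ X ^ k ∧ e.cost sz s ≤ X ^ k := by
  have bin : ∀ (X k₁ k₂ v v₁ v₂ c₁ c₂ : ℕ), 2 ≤ X → v ≤ 2 * (v₁ + v₂) + 2 → v₁ ≤ X ^ k₁ →
      v₂ ≤ X ^ k₂ → c₁ ≤ X ^ k₁ → c₂ ≤ X ^ k₂ →
      v ≤ X ^ (k₁ + k₂ + 6) ∧ 1 + v + c₁ + c₂ ≤ X ^ (k₁ + k₂ + 6) := by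
    intro X k₁ k₂ v v₁ v₂ c₁ c₂ hX hv h1 h2 h3 h4
    have a1 := pow_add_pow_le_pow hX (a := k₁) (b := k₂) (c := k₁ + k₂ + 1) (by omega) (by omega)
    have e1 : ∀ j, X ^ (k₁ + k₂ + j) * 2 ≤ X ^ (k₁ + k₂ + j + 1) := fun j => by
      rw [pow_succ]; gcongr
    have b1 := e1 1
    have b2 := e1 2
    have b3 := e1 3
    have b4 := e1 4
    have b5 := e1 5
    have b0 : 0 < X ^ (k₁ + k₂ + 1) := by positivity
    simp only [Nat.reduceAdd, add_assoc] at *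
    constructor <;> omega
  induction e with
  | const n =>
    refine ⟨2 * n + 3, fun X s hX _ => ?_⟩
    have h1 : 2 * n + 3 < X ^ (2 * n + 3) := Nat.lt_pow_self hX
    have h2 := hsz.natCast n
    simp only [NumExp.eval, NumExp.cost]
    constructor <;> omega
  | get a i =>
    obtain ⟨k, hk⟩ := natExp_cost_bound (K := K) i
    refine ⟨k + 0 + 6, fun X s hX hs => ?_⟩
    have h2 := (hk X s hX hs.nat).2
    simp only [NumExp.eval, NumExp.cost]
    have h3 := hs.num a (i.eval s)
    have a1 := pow_add_pow_le_pow hX (a := 0) (b := 1) (c := k + 2) (by omega) (by omega)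
    have a2 := pow_add_pow_le_pow hX (a := k) (b := k + 2) (c := k + 0 + 6) (by omega) (by omega)
    rw [pow_zero, pow_one] at a1
    constructor <;> omega
  | add e₁ e₂ ih₁ ih₂ =>
    obtain ⟨k₁, h₁⟩ := ih₁
    obtain ⟨k₂, h₂⟩ := ih₂
    exact ⟨k₁ + k₂ + 6, fun X s hX hs => bin X k₁ k₂ _ _ _ _ _ hX (hsz.add _ _) (h₁ X s hX hs).1
      (h₂ X s hX hs).1 (h₁ X s hX hs).2 (h₂ X s hX hs).2⟩
  | sub e₁ e₂ ih₁ ih₂ =>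
    obtain ⟨k₁, h₁⟩ := ih₁
    obtain ⟨k₂, h₂⟩ := ih₂
    exact ⟨k₁ + k₂ + 6, fun X s hX hs => bin X k₁ k₂ _ _ _ _ _ hX (hsz.sub _ _) (h₁ X s hX hs).1
      (h₂ X s hX hs).1 (h₁ X s hX hs).2 (h₂ X s hX hs).2⟩
  | mul e₁ e₂ ih₁ ih₂ =>
    obtain ⟨k₁, h₁⟩ := ih₁
    obtain ⟨k₂, h₂⟩ := ih₂
    exact ⟨k₁ + k₂ + 6, fun X s hX hs => bin X k₁ k₂ _ _ _ _ _ hX (hsz.mul _ _) (h₁ X s hX hs).1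
      (h₂ X s hX hs).1 (h₁ X s hX hs).2 (h₂ X s hX hs).2⟩
  | div e₁ e₂ ih₁ ih₂ =>
    obtain ⟨k₁, h₁⟩ := ih₁
    obtain ⟨k₂, h₂⟩ := ih₂
    exact ⟨k₁ + k₂ + 6, fun X s hX hs => bin X k₁ k₂ _ _ _ _ _ hX (hsz.div _ _) (h₁ X s hX hs).1
      (h₂ X s hX hs).1 (h₁ X s hX hs).2 (h₂ X s hX hs).2⟩

lemma one_add_pow_add_pow_le {X : ℕ} (hX : 2 ≤ X) (a b : ℕ) :
    1 + X ^ a + X ^ b ≤ X ^ (a + b + 2) := by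
  have a1 := pow_add_pow_le_pow hX (a := 0) (b := a) (c := a + b + 1) (by omega) (by omega)
  have a2 := pow_add_pow_le_pow hX (a := a + b + 1) (b := b) (c := a + b + 2) (by omega) (by omega)
  rw [pow_zero] at a1
  omega

lemma boolExp_cost_bound {sz : K → ℕ} (hsz : SizeBound sz) (b : BoolExp) :
    ∃ k, ∀ (X : ℕ) (s : RamState K), 2 ≤ X → BoundedState sz X s → b.cost sz s ≤ X ^ k := by
  induction b with
  | natLe e₁ e₂ =>
    obtain ⟨k₁, h₁⟩ := natExp_cost_bound (K := K) e₁
    obtain ⟨k₂, h₂⟩ := natExp_cost_bound (K := K) e₂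
    refine ⟨k₁ + k₂ + 2, fun X s hX hs => ?_⟩
    have a1 := (h₁ X s hX hs.nat).2
    have a2 := (h₂ X s hX hs.nat).2
    have := one_add_pow_add_pow_le hX k₁ k₂
    simp only [BoolExp.cost]; omega
  | numLe e₁ e₂ =>
    obtain ⟨k₁, h₁⟩ := numExp_cost_bound hsz e₁
    obtain ⟨k₂, h₂⟩ := numExp_cost_bound hsz e₂
    refine ⟨k₁ + k₂ + 2, fun X s hX hs => ?_⟩
    have a1 := (h₁ X s hX hs).2
    have a2 := (h₂ X s hX hs).2
    have := one_add_pow_add_pow_le hX k₁ k₂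
    simp only [BoolExp.cost]; omega
  | not b ih =>
    obtain ⟨k, h⟩ := ih
    refine ⟨k + 0 + 2, fun X s hX hs => ?_⟩
    have a1 := h X s hX hs
    have := one_add_pow_add_pow_le hX k 0
    simp only [BoolExp.cost]; omega
  | and b₁ b₂ ih₁ ih₂ =>
    obtain ⟨k₁, h₁⟩ := ih₁
    obtain ⟨k₂, h₂⟩ := ih₂
    refine ⟨k₁ + k₂ + 2, fun X s hX hs => ?_⟩
    have a1 := h₁ X s hX hs
    have a2 := h₂ X s hX hs
    have := one_add_pow_add_pow_le hX k₁ k₂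
    simp only [BoolExp.cost]; omega

/-- Every single step of `P` costs at most `W` in a memory bounded by `X`. -/
def StepCostLe (sz : K → ℕ) (X W : ℕ) : RamProgram → Prop
  | .skip => 1 ≤ W
  | .setNat _ i e => ∀ s : RamState K, BoundedState sz X s → 1 + i.cost s + e.cost s ≤ W
  | .setNum _ i e => ∀ s : RamState K, BoundedState sz X s → 1 + i.cost s + e.cost sz s ≤ W
  | .seq P Q => StepCostLe sz X W P ∧ StepCostLe sz X W Q
  | .ite b P Q => (∀ s : RamState K, BoundedState sz X s → 1 + b.cost sz s ≤ W) ∧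
      StepCostLe sz X W P ∧ StepCostLe sz X W Q
  | .while b P => (∀ s : RamState K, BoundedState sz X s → 1 + b.cost sz s ≤ W) ∧
      StepCostLe sz X W P

lemma StepCostLe.mono {sz : K → ℕ} {X W W' : ℕ} (hW : W ≤ W') {P : RamProgram}
    (h : StepCostLe sz X W P) : StepCostLe sz X W' P := by
  induction P with
  | skip => exact le_trans h hW
  | setNat a i e => exact fun s hs => (h s hs).trans hW
  | setNum a i e => exact fun s hs => (h s hs).trans hW
  | seq P Q ihP ihQ => exact ⟨ihP h.1, ihQ h.2⟩
  | ite b P Q ihP ihQ => exact ⟨fun s hs => (h.1 s hs).trans hW, ihP h.2.1, ihQ h.2.2⟩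
  | _ b P ih => exact ⟨fun s hs => (h.1 s hs).trans hW, ih h.2⟩

lemma exists_stepCostLe {sz : K → ℕ} (hsz : SizeBound sz) (P : RamProgram) :
    ∃ k, ∀ X : ℕ, 2 ≤ X → StepCostLe sz X (X ^ k) P := by
  have up : ∀ {X a b : ℕ}, 2 ≤ X → a ≤ b → X ^ a ≤ X ^ b := fun hX h =>
    Nat.pow_le_pow_right (by omega) h
  induction P with
  | skip => exact ⟨0, fun X _ => by simp [StepCostLe]⟩
  | setNat a i e =>
    obtain ⟨k₁, h₁⟩ := natExp_cost_bound (K := K) i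
    obtain ⟨k₂, h₂⟩ := natExp_cost_bound (K := K) e
    refine ⟨k₁ + k₂ + 2, fun X hX s hs => ?_⟩
    have a1 := (h₁ X s hX hs.nat).2
    have a2 := (h₂ X s hX hs.nat).2
    have := one_add_pow_add_pow_le hX k₁ k₂
    omega
  | setNum a i e =>
    obtain ⟨k₁, h₁⟩ := natExp_cost_bound (K := K) i
    obtain ⟨k₂, h₂⟩ := numExp_cost_bound hsz e
    refine ⟨k₁ + k₂ + 2, fun X hX s hs => ?_⟩
    have a1 := (h₁ X s hX hs.nat).2
    have a2 := (h₂ X s hX hs).2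
    have := one_add_pow_add_pow_le hX k₁ k₂
    omega
  | seq P Q ihP ihQ =>
    obtain ⟨k₁, h₁⟩ := ihP
    obtain ⟨k₂, h₂⟩ := ihQ
    exact ⟨k₁ + k₂, fun X hX => ⟨(h₁ X hX).mono (up hX (by omega)),
      (h₂ X hX).mono (up hX (by omega))⟩⟩
  | ite b P Q ihP ihQ =>
    obtain ⟨k, h⟩ := boolExp_cost_bound hsz b
    obtain ⟨k₁, h₁⟩ := ihP
    obtain ⟨k₂, h₂⟩ := ihQ
    refine ⟨k + k₁ + k₂ + 2, fun X hX => ⟨fun s hs => ?_, (h₁ X hX).mono (up hX (by omega)),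
      (h₂ X hX).mono (up hX (by omega))⟩⟩
    have a1 := h X s hX hs
    have a2 := one_add_pow_add_pow_le hX k 0
    have a3 := up hX (show k + 0 + 2 ≤ k + k₁ + k₂ + 2 by omega)
    omega
  | _ b P ih =>
    obtain ⟨k, h⟩ := boolExp_cost_bound hsz b
    obtain ⟨k₁, h₁⟩ := ih
    refine ⟨k + k₁ + 2, fun X hX => ⟨fun s hs => ?_, (h₁ X hX).mono (up hX (by omega))⟩⟩
    have a1 := h X s hX hs
    have a2 := one_add_pow_add_pow_le hX k 0
    have a3 := up hX (show k + 0 + 2 ≤ k + k₁ + 2 by omega)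
    omega

/-- This separates the two concerns: the number of steps, and a uniform price per step valid as long
as memories stay bounded. -/
lemma StepRuns.exists_runs {sz : K → ℕ} {X W : ℕ} {P : RamProgram} {s s' : RamState K} {m : ℕ}
    (h : StepRuns (BoundedState sz X) P s s' m) (hP : StepCostLe sz X W P) :
    ∃ t, Runs sz P s s' t ∧ t ≤ m * W := by
  induction h with
  | skip s _ => exact ⟨1, Runs.skip s, by simpa [StepCostLe] using hP⟩
  | setNat a i e s hs _ => exact ⟨_, Runs.setNat a i e s, by simpa using hP s hs⟩
  | setNum a i e s hs _ => exact ⟨_, Runs.setNum a i e s, by simpa using hP s hs⟩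
  | seq _ _ ih1 ih2 =>
    obtain ⟨t, h1, h2⟩ := ih1 hP.1
    obtain ⟨t', h1', h2'⟩ := ih2 hP.2
    exact ⟨_, Runs.seq h1 h1', by rw [add_mul]; omega⟩
  | ite_true hb hs _ ih =>
    obtain ⟨t, h1, h2⟩ := ih hP.2.1
    exact ⟨_, Runs.ite_true hb h1, by have := hP.1 _ hs; rw [add_mul]; omega⟩
  | ite_false hb hs _ ih =>
    obtain ⟨t, h1, h2⟩ := ih hP.2.2
    exact ⟨_, Runs.ite_false hb h1, by have := hP.1 _ hs; rw [add_mul]; omega⟩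
  | while_false hb hs => exact ⟨_, Runs.while_false hb, by have := hP.1 _ hs; omega⟩
  | while_true hb hs _ _ ih1 ih2 =>
    obtain ⟨t, h1, h2⟩ := ih1 hP.2
    obtain ⟨t', h1', h2'⟩ := ih2 hP
    exact ⟨_, Runs.while_true hb h1 h1', by have := hP.1 _ hs; rw [add_mul, add_mul]; omega⟩

/-! ### Total correctness with a polynomial number of steps -/

/-- From `s`, the program `P` halts after at most `X ^ c` steps, with memories bounded by `X`, and
the final memory satisfies `Q`. -/
def Within (sz : K → ℕ) (X : ℕ) (P : RamProgram) (s : RamState K) (c : ℕ)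
    (Q : RamState K → Prop) : Prop :=
  ∃ s' m, StepRuns (BoundedState sz X) P s s' m ∧ m ≤ X ^ c ∧ Q s'

variable {sz : K → ℕ} {X : ℕ}

lemma Within.imp {P : RamProgram} {s : RamState K} {c : ℕ} {Q Q' : RamState K → Prop}
    (h : Within sz X P s c Q)
    (hQ : ∀ s', BoundedState sz X s' → AgreeOutside P s s' → Q s' → Q' s') :
    Within sz X P s c Q' := by
  obtain ⟨s', m, h1, h2, h3⟩ := h
  exact ⟨s', m, h1, h2, hQ s' h1.final h1.agreeOutside h3⟩

lemma BoundedState.setNat {s : RamState K} (h : BoundedState sz X s) {a i v : ℕ} (hv : v ≤ X) :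
    BoundedState sz X (s.setNat a i v) := by
  refine ⟨fun b j => ?_, h.num⟩
  simp only [RamState.setNat, Function.update_apply]
  split_ifs
  · rw [Function.update_apply]
    split_ifs
    · exact hv
    · exact h.nat _ _
  · exact h.nat _ _

lemma BoundedState.setNum {s : RamState K} (h : BoundedState sz X s) {a i : ℕ} {v : K}
    (hv : sz v ≤ X) : BoundedState sz X (s.setNum a i v) := by
  refine ⟨h.nat, fun b j => ?_⟩
  simp only [RamState.setNum, Function.update_apply]
  split_ifs
  · rw [Function.update_apply]
    split_ifs
    · exact hv
    · exact h.num _ _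
  · exact h.num _ _

lemma Within.setNat {a : ℕ} {i e : NatExp} {s : RamState K} {Q : RamState K → Prop}
    (hs : BoundedState sz X s) (he : e.eval s ≤ X) (hQ : Q (s.setNat a (i.eval s) (e.eval s))) :
    Within sz X (.setNat a i e) s 0 Q :=
  ⟨_, 1, StepRuns.setNat a i e s hs (hs.setNat he), by simp, hQ⟩

lemma Within.setNum {a : ℕ} {i : NatExp} {e : NumExp} {s : RamState K} {Q : RamState K → Prop}
    (hs : BoundedState sz X s) (he : sz (e.eval s) ≤ X)
    (hQ : Q (s.setNum a (i.eval s) (e.eval s))) :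
    Within sz X (.setNum a i e) s 0 Q :=
  ⟨_, 1, StepRuns.setNum a i e s hs (hs.setNum he), by simp, hQ⟩

lemma Within.skip {s : RamState K} {Q : RamState K → Prop} (hs : BoundedState sz X s) (hQ : Q s) :
    Within sz X .skip s 0 Q :=
  ⟨_, 1, StepRuns.skip s hs, by simp, hQ⟩

/-- Tracking only exponents avoids explicit polynomials: two powers of `X` with smaller exponents
add up to at most the next power. -/
lemma Within.seq {P P' : RamProgram} {s : RamState K} {a b c : ℕ} {Q R : RamState K → Prop}
    (hX : 4 ≤ X) (h : Within sz X P s a Q)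
    (h' : ∀ s', BoundedState sz X s' → AgreeOutside P s s' → Q s' → Within sz X P' s' b R)
    (ha : a < c) (hb : b < c) : Within sz X (.seq P P') s c R := by
  obtain ⟨s', m, h1, h2, h3⟩ := h
  obtain ⟨s'', m', h1', h2', h3'⟩ := h' s' h1.final h1.agreeOutside h3
  refine ⟨s'', _, h1.seq h1', ?_, h3'⟩
  have := pow_add_pow_le_pow (X := X) (by omega) ha hb
  omega

lemma Within.ite {b : BoolExp} {P P' : RamProgram} {s : RamState K} {a c : ℕ}
    {R : RamState K → Prop} (hX : 4 ≤ X) (hs : BoundedState sz X s)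
    (h : b.Holds s → Within sz X P s a R) (h' : ¬ b.Holds s → Within sz X P' s a R) (ha : a < c) :
    Within sz X (.ite b P P') s c R := by
  have hle := pow_add_pow_le_pow (X := X) (by omega) (show 0 < c by omega) ha
  rw [pow_zero] at hle
  by_cases hb : b.Holds s
  · obtain ⟨s', m, h1, h2, h3⟩ := h hb
    exact ⟨s', _, StepRuns.ite_true hb hs h1, by omega, h3⟩
  · obtain ⟨s', m, h1, h2, h3⟩ := h' hb
    exact ⟨s', _, StepRuns.ite_false hb hs h1, by omega, h3⟩

/-- The register number `v` (entry `0` of array `v`). -/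
def NatExp.reg (v : ℕ) : NatExp := .get v (.const 0)

/-- Run `P` with register `v` running through all numbers below `e`. -/
def RamProgram.for (v : ℕ) (e : NatExp) (P : RamProgram) : RamProgram :=
  .seq (.setNat v (.const 0) (.const 0))
    (.while (.not (.natLe e (.reg v))) (.seq P (.setNat v (.const 0) (.add (.reg v) (.const 1)))))

lemma setNat_nat_of_ne {s : RamState K} {a b i v : ℕ} (h : b ≠ a) :
    (s.setNat a i v).nat b = s.nat b := by
  simp [RamState.setNat, Function.update_of_ne h]

lemma setNat_nat_self {s : RamState K} {a i v : ℕ} : (s.setNat a i v).nat a i = v := by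
  simp [RamState.setNat]

lemma setNat_nat_self_of_ne {s : RamState K} {a i j v : ℕ} (h : j ≠ i) :
    (s.setNat a i v).nat a j = s.nat a j := by
  simp [RamState.setNat, Function.update_of_ne h]

lemma AgreeOutside.trans {P : RamProgram} {s s' s'' : RamState K} (h : AgreeOutside P s s')
    (h' : AgreeOutside P s' s'') : AgreeOutside P s s'' :=
  ⟨fun a ha => (h'.nat a ha).trans (h.nat a ha), fun a ha => (h'.num a ha).trans (h.num a ha)⟩

lemma AgreeOutside.mono {P P' : RamProgram} {s s' : RamState K} (h : AgreeOutside P s s')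
    (h1 : ∀ a ∈ P.natWrites, a ∈ P'.natWrites) (h2 : ∀ a ∈ P.numWrites, a ∈ P'.numWrites) :
    AgreeOutside P' s s' :=
  ⟨fun a ha => h.nat a fun h => ha (h1 a h), fun a ha => h.num a fun h => ha (h2 a h)⟩

lemma natWrites_for (v : ℕ) (e : NatExp) (P : RamProgram) (a : ℕ) :
    a ∈ (RamProgram.for v e P).natWrites ↔ a = v ∨ a ∈ P.natWrites := by
  simp [RamProgram.for, RamProgram.natWrites]
  tauto

lemma numWrites_for (v : ℕ) (e : NatExp) (P : RamProgram) (a : ℕ) :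
    a ∈ (RamProgram.for v e P).numWrites ↔ a ∈ P.numWrites := by
  simp [RamProgram.for, RamProgram.numWrites]

lemma agreeOutside_for_setNat (v : ℕ) (e : NatExp) (P : RamProgram) (s : RamState K) (i x : ℕ) :
    AgreeOutside (RamProgram.for v e P) s (s.setNat v i x) := by
  refine ⟨fun a ha => ?_, fun _ _ => rfl⟩
  rw [natWrites_for, not_or] at ha
  exact setNat_nat_of_ne ha.1

/-- The rule for loops: `Inv i` holds before round `i`. -/
theorem Within.for {v : ℕ} {e : NatExp} {P : RamProgram} {s : RamState K} {n c : ℕ}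
    (Inv : ℕ → RamState K → Prop) (hX : 4 ≤ X) (hs : BoundedState sz X s) (hn : n ≤ X)
    (hv : v ∉ P.natWrites)
    (he : ∀ s', AgreeOutside (.for v e P) s s' → e.eval s' = n)
    (hInv : ∀ i s x, Inv i s → Inv i (s.setNat v 0 x)) (h0 : Inv 0 s)
    (step : ∀ i < n, ∀ s', BoundedState sz X s' → AgreeOutside (.for v e P) s s' →
      s'.nat v 0 = i → Inv i s' → Within sz X P s' c (Inv (i + 1))) :
    Within sz X (.for v e P) s (c + 2) (Inv n) := by
  -- Induction on the number `d` of remaining rounds; each round pays for its body, one test and one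
  -- increment.
  have loop : ∀ d i s', i + d = n → BoundedState sz X s' → AgreeOutside (.for v e P) s s' →
      s'.nat v 0 = i → Inv i s' → ∃ s'' m, StepRuns (BoundedState sz X)
        (.while (.not (.natLe e (.reg v))) (.seq P (.setNat v (.const 0) (.add (.reg v) (.const 1)))))
        s' s'' m ∧ m ≤ d * (X ^ c + 2) + 1 ∧ Inv n s'' := by
    intro d
    induction d with
    | zero =>
      intro i s' hi hs' hag hvi hI
      refine ⟨s', 1, StepRuns.while_false ?_ hs', by simp, ?_⟩
      · simp only [BoolExp.Holds, NatExp.eval, NatExp.reg, he s' hag, hvi]; omega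
      · obtain rfl : i = n := by omega
        exact hI
    | succ d ih =>
      intro i s' hi hs' hag hvi hI
      obtain ⟨s₁, m₁, h1, h2, h3⟩ := step i (by omega) s' hs' hag hvi hI
      have hag1 := h1.agreeOutside
      have hv1 : s₁.nat v 0 = i := by rw [hag1.nat v hv, hvi]
      have hadd : (NatExp.add (.reg v) (.const 1)).eval s₁ = i + 1 := by
        simp [NatExp.eval, NatExp.reg, hv1]
      have hc0 : (NatExp.const 0).eval s₁ = 0 := rfl
      have hset := StepRuns.setNat (B := BoundedState sz X) v (.const 0)
        (.add (.reg v) (.const 1)) s₁ h1.final (h1.final.setNat (by rw [hadd]; omega))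
      rw [hadd, hc0] at hset
      have hag2 : AgreeOutside (.for v e P) s' s₁ :=
        hag1.mono (fun a ha => (natWrites_for v e P a).2 (Or.inr ha))
          (fun a ha => (numWrites_for v e P a).2 ha)
      obtain ⟨s₂, m₂, k1, k2, k3⟩ := ih (i + 1) (s₁.setNat v 0 (i + 1)) (by omega)
        hset.final ((hag.trans hag2).trans (agreeOutside_for_setNat v e P s₁ 0 (i + 1)))
        setNat_nat_self (hInv _ _ _ h3)
      refine ⟨s₂, _, StepRuns.while_true ?_ hs' (h1.seq hset) k1, ?_, k3⟩
      · simp only [BoolExp.Holds, NatExp.eval, NatExp.reg, he s' hag, hvi]; omega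
      · rw [Nat.succ_mul]; omega
  have hset := StepRuns.setNat (B := BoundedState sz X) v (.const 0) (.const 0) s hs
    (hs.setNat (Nat.zero_le _))
  obtain ⟨s'', m, h1, h2, h3⟩ := loop n 0 (s.setNat v 0 0) (by omega) hset.final
    (agreeOutside_for_setNat v e P s 0 0) setNat_nat_self (hInv _ _ _ h0)
  refine ⟨s'', _, StepRuns.seq hset h1, ?_, h3⟩
  have hp : 1 ≤ X ^ c := Nat.one_le_pow _ _ (by omega)
  -- One factor `X` pays for the rounds, the other for the overhead; this is where `4 ≤ X` is
  -- needed.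
  calc 1 + m ≤ n * (X ^ c + 2) + 2 := by omega
    _ ≤ X * (X ^ c + 2) + 2 := by gcongr
    _ ≤ X ^ c * X ^ 2 := by
      have k1 : X * (X ^ c + 2) = X ^ c * X + 2 * X := by ring
      have k2 : X ^ c * X ^ 2 = X ^ c * X * X := by ring
      have k3 : 1 * X ≤ X ^ c * X := Nat.mul_le_mul_right X hp
      have k4 := Nat.mul_le_mul_left (X ^ c * X) hX
      omega
    _ = X ^ (c + 2) := (pow_add _ _ _).symm

/-- A loop that sets a flag if some condition holds in one of the rounds. -/
theorem Within.exists {v fl : ℕ} {e : NatExp} {P : RamProgram} {s : RamState K} {n c : ℕ}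
    (C : ℕ → Prop) (hX : 4 ≤ X) (hs : BoundedState sz X s) (hn : n ≤ X)
    (hv : v ∉ P.natWrites) (hvf : fl ≠ v)
    (he : ∀ s', AgreeOutside (.for v e P) s s' → e.eval s' = n)
    (step : ∀ i < n, ∀ s', BoundedState sz X s' → AgreeOutside (.for v e P) s s' →
      s'.nat v 0 = i → Within sz X P s' c (fun s'' =>
        (C i → s''.nat fl 0 = 1) ∧ (¬ C i → s''.nat fl 0 = s'.nat fl 0))) :
    Within sz X (.for v e P) s (c + 2) (fun s'' =>
        ((∃ i < n, C i) → s''.nat fl 0 = 1) ∧ ((¬ ∃ i < n, C i) → s''.nat fl 0 = s.nat fl 0)) := by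
  refine Within.for (Inv := fun j s'' => ((∃ i < j, C i) → s''.nat fl 0 = 1) ∧
    ((¬ ∃ i < j, C i) → s''.nat fl 0 = s.nat fl 0)) hX hs hn hv he ?_ ?_ ?_
  · intro i s x h
    rwa [setNat_nat_of_ne hvf]
  · simp
  · intro i hi s' hs' hag hvi hI
    refine (step i hi s' hs' hag hvi).imp fun s'' _ _ h => ⟨fun hex => ?_, fun hex => ?_⟩
    · by_cases hC : C i
      · exact h.1 hC
      · rw [h.2 hC]
        obtain ⟨j, hj, hCj⟩ := hex
        refine hI.1 ⟨j, lt_of_le_of_ne (by omega) ?_, hCj⟩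
        rintro rfl
        exact hC hCj
    · rw [h.2 fun hC => hex ⟨i, by omega, hC⟩]
      exact hI.2 fun ⟨j, hj, hCj⟩ => hex ⟨j, by omega, hCj⟩

end Steps

/-! ## The program -/

def nfE : NatExp := .get 0 (.const 0)
def nmE : NatExp := .get 0 (.const 1)
def vertexCountE : NatExp := .mul (.mul (.mul nfE nfE) nfE) nfE
def candidateCountE : NatExp := .mul (.mul vertexCountE vertexCountE) vertexCountE
def nodeCountE : NatExp := .mul nmE candidateCountE

/-- Number of quadruples of fixed vertices. -/
def vertexCount (n : ℕ) : ℕ := n * n * n * n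

/-- Number of triples of quadruples of fixed vertices. -/
def candidateCount (n : ℕ) : ℕ := vertexCount n * vertexCount n * vertexCount n

/-- Store quotients and remainders by `n` of the numbers below `m * n` in arrays `q` and `r`. -/
def divTableProgram (q r : ℕ) (m n : NatExp) : RamProgram :=
  .for 30 m (.for 31 n (.seq (.setNat q (.add (.mul (.reg 30) n) (.reg 31)) (.reg 30))
    (.setNat r (.add (.mul (.reg 30) n) (.reg 31)) (.reg 31))))

def orientE (p q r : NumExp × NumExp) : NumExp :=
  .sub (.mul (.sub q.1 p.1) (.sub r.2 p.2)) (.mul (.sub q.2 p.2) (.sub r.1 p.1))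

def dotE (f p c : NumExp × NumExp) : NumExp :=
  .add (.mul (.sub p.1 f.1) (.sub c.1 f.1)) (.mul (.sub p.2 f.2) (.sub c.2 f.2))

def lineInterE (a b c d : NumExp × NumExp) : NumExp × NumExp :=
  (.add a.1 (.mul (.div (orientE c d a) (.sub (orientE c d a) (orientE c d b))) (.sub b.1 a.1)),
   .add a.2 (.mul (.div (orientE c d a) (.sub (orientE c d a) (orientE c d b))) (.sub b.2 a.2)))

def centroidE (p q r : NumExp × NumExp) : NumExp × NumExp :=
  (.div (.add (.add p.1 q.1) r.1) (.const 3), .div (.add (.add p.2 q.2) r.2) (.const 3))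

/-- The point with coordinates in entry `e` of arrays `a` and `a + 1`. -/
def pointE (a : ℕ) (e : NatExp) : NumExp × NumExp := (.get a e, .get (a + 1) e)

def BoolExp.or (b c : BoolExp) : BoolExp := .not (.and (.not b) (.not c))
def BoolExp.natEq (e f : NatExp) : BoolExp := .and (.natLe e f) (.natLe f e)
def BoolExp.numEq (e f : NumExp) : BoolExp := .and (.numLe e f) (.numLe f e)
def BoolExp.pos (e : NumExp) : BoolExp := .not (.numLe e (.const 0))

/-- The machine has no integer division. Iterated lookups in the quotient and remainder tables 20
and 21 read off the four base-`nf` digits of the index. -/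
def vertexE (e : NatExp) : NumExp × NumExp :=
  lineInterE (pointE 0 (.get 20 (.get 20 (.get 20 e)))) (pointE 0 (.get 21 (.get 20 (.get 20 e))))
    (pointE 0 (.get 21 (.get 20 e))) (pointE 0 (.get 21 e))

def vertexProgram : RamProgram :=
  .for 30 vertexCountE (.seq (.setNum 2 (.reg 30) (vertexE (.reg 30)).1)
    (.setNum 3 (.reg 30) (vertexE (.reg 30)).2))

/-- Tables 22 and 23 yield the three digits of the index in base `nf ^ 4`; arrays 2 and 3 hold the
coordinates of the vertex points. -/
def candidateE (e : NatExp) : NumExp × NumExp :=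
  centroidE (pointE 2 (.get 22 (.get 22 e))) (pointE 2 (.get 23 (.get 22 e)))
    (pointE 2 (.get 23 e))

def candidateProgram : RamProgram :=
  .for 30 candidateCountE (.seq (.setNum 4 (.reg 30) (candidateE (.reg 30)).1)
    (.setNum 5 (.reg 30) (candidateE (.reg 30)).2))

/-- Is the fixed vertex `a` a neighbour of the mobile vertex `u`? -/
def adjE (u a : NatExp) : BoolExp := .natLe (.const 1) (.get 1 (.add (.mul u nfE) a))

def setFlag (fl : ℕ) (b : BoolExp) : RamProgram := .ite b (.setNat fl (.const 0) (.const 1)) .skip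

def storeFlag (a : ℕ) (e : NatExp) (b : BoolExp) : RamProgram :=
  .ite b (.setNat a e (.const 1)) (.setNat a e (.const 0))

/-- The candidate of the node in register `v`. -/
def nodePointE (v : ℕ) : NumExp × NumExp := pointE 4 (.get 25 (.reg v))

/-- The mobile vertex of the node in register `v`. -/
def nodeVertexE (v : ℕ) : NatExp := .get 24 (.reg v)

def hullCondition : BoolExp :=
  .and (.and (adjE (nodeVertexE 30) (.reg 34)) (adjE (nodeVertexE 30) (.reg 35)))
    (.and (adjE (nodeVertexE 30) (.reg 36)) (.or
      (.and (.and
        (.pos (orientE (pointE 0 (.reg 34)) (pointE 0 (.reg 35)) (nodePointE 30)))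
        (.pos (orientE (pointE 0 (.reg 35)) (pointE 0 (.reg 36)) (nodePointE 30))))
        (.pos (orientE (pointE 0 (.reg 36)) (pointE 0 (.reg 34)) (nodePointE 30))))
      (.and (.not (.natEq (.reg 34) (.reg 35)))
        (.and (.numEq (nodePointE 30).1
            (centroidE (pointE 0 (.reg 34)) (pointE 0 (.reg 34)) (pointE 0 (.reg 35))).1)
          (.numEq (nodePointE 30).2
            (centroidE (pointE 0 (.reg 34)) (pointE 0 (.reg 34)) (pointE 0 (.reg 35))).2)))))

def blockedCondition : BoolExp :=
  .and (adjE (nodeVertexE 30) (.reg 34)) (.and (.not (.natEq (.reg 35) (.reg 34)))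
    (.and (.numEq (orientE (pointE 0 (.reg 35)) (pointE 0 (.reg 34)) (nodePointE 30)) (.const 0))
      (.numLe (dotE (pointE 0 (.reg 35)) (nodePointE 30) (pointE 0 (.reg 34))) (.const 0))))

def hullLoop : RamProgram :=
  .for 34 nfE (.for 35 nfE (.for 36 nfE (setFlag 40 hullCondition)))

def blockedLoop : RamProgram := .for 34 nfE (.for 35 nfE (setFlag 41 blockedCondition))

/-- Array `26` tells whether the candidate of a node is a valid centre. -/
def validProgram : RamProgram :=
  .for 30 nodeCountE (.seq (.setNat 40 (.const 0) (.const 0)) (.seq hullLoop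
    (.seq (.setNat 41 (.const 0) (.const 0)) (.seq blockedLoop
      (storeFlag 26 (.reg 30) (.and (.natLe (.const 1) (.reg 40)) (.natLe (.reg 41) (.const 0))))))))

def separatedE (p a q b : NumExp × NumExp) : BoolExp :=
  .or (.pos (.mul (orientE p a q) (orientE p a b))) (.pos (.mul (orientE q b p) (orientE q b a)))

def conflictCondition : BoolExp :=
  .and (.and (adjE (nodeVertexE 30) (.reg 34)) (adjE (nodeVertexE 31) (.reg 35)))
    (.and (.not (.natEq (.reg 34) (.reg 35)))
      (.not (separatedE (nodePointE 30) (pointE 0 (.reg 34)) (nodePointE 31)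
        (pointE 0 (.reg 35)))))

def conflictLoop : RamProgram := .for 34 nfE (.for 35 nfE (setFlag 41 conflictCondition))

def pairIndexE : NatExp := .add (.mul (.reg 30) nodeCountE) (.reg 31)

/-- Among pairs with the same mobile vertex only equal nodes are admitted, so the diagonal blocks of
the table play the part of the domains. -/
def pairCondition : BoolExp :=
  .and (.and (.natLe (.const 1) (.get 26 (.reg 30))) (.natLe (.const 1) (.get 26 (.reg 31))))
    (.or (.natEq (.reg 30) (.reg 31)) (.and (.not (.natEq (nodeVertexE 30) (nodeVertexE 31)))
      (.natLe (.reg 41) (.const 0))))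

/-- Array `27` tells which pairs of nodes are compatible. -/
def pairProgram : RamProgram :=
  .for 30 nodeCountE (.for 31 nodeCountE (.seq (.setNat 41 (.const 0) (.const 0))
    (.seq conflictLoop (storeFlag 27 pairIndexE pairCondition))))

/-- Compute the candidates and the decomposition of node numbers. -/
def prepareProgram : RamProgram :=
  .seq (divTableProgram 20 21 (.mul (.mul nfE nfE) nfE) nfE)
    (.seq (divTableProgram 22 23 (.mul vertexCountE vertexCountE) vertexCountE)
      (.seq (divTableProgram 24 25 nmE candidateCountE) (.seq vertexProgram candidateProgram)))

/-! ### Intended contents of the tables. -/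

section Specification

variable {K : Type} [Field K] [LinearOrder K]

def vertexAt (n : ℕ) (P : ℕ → K × K) (c : ℕ) : K × K :=
  lineInter (P (c / n / n / n)) (P (c / n / n % n)) (P (c / n % n)) (P (c % n))

def candidateAt (n : ℕ) (P : ℕ → K × K) (c : ℕ) : K × K :=
  centroid3 (vertexAt n P (c / vertexCount n / vertexCount n))
    (vertexAt n P (c / vertexCount n % vertexCount n)) (vertexAt n P (c % vertexCount n))

def IsNbr (n : ℕ) (adj : ℕ → ℕ) (u a : ℕ) : Prop := 1 ≤ adj (u * n + a)

def ValidAt (n : ℕ) (adj : ℕ → ℕ) (P : ℕ → K × K) (u : ℕ) (p : K × K) : Prop :=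
  (∃ a < n, ∃ b < n, ∃ c < n, IsNbr n adj u a ∧ IsNbr n adj u b ∧ IsNbr n adj u c ∧
    (InTriangle (P a) (P b) (P c) p ∨ (a ≠ b ∧ p = centroid3 (P a) (P a) (P b)))) ∧
  ¬ ∃ c < n, ∃ f < n, IsNbr n adj u c ∧ f ≠ c ∧ orient (P f) (P c) p = 0 ∧
    dotAt (P f) p (P c) ≤ 0

def ConflictAt (n : ℕ) (adj : ℕ → ℕ) (P : ℕ → K × K) (u : ℕ) (p : K × K) (w : ℕ) (q : K × K) :
    Prop :=
  ∃ a < n, ∃ b < n, IsNbr n adj u a ∧ IsNbr n adj w b ∧ a ≠ b ∧ ¬ Separated p (P a) q (P b)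

/-- The candidate of node `i` is a valid centre. -/
def ValidNode (n : ℕ) (adj : ℕ → ℕ) (P : ℕ → K × K) (i : ℕ) : Prop :=
  ValidAt n adj P (i / candidateCount n) (candidateAt n P (i % candidateCount n))

/-- The nodes `i` and `j` are equal or belong to different mobile vertices and are compatible. -/
def PairAt (n : ℕ) (adj : ℕ → ℕ) (P : ℕ → K × K) (i j : ℕ) : Prop :=
  ValidNode n adj P i ∧ ValidNode n adj P j ∧ (i = j ∨
    (i / candidateCount n ≠ j / candidateCount n ∧
      ¬ ConflictAt n adj P (i / candidateCount n) (candidateAt n P (i % candidateCount n))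
        (j / candidateCount n) (candidateAt n P (j % candidateCount n))))

end Specification

/-! ### Correctness of the arithmetic and point tables. -/

section Stages

set_option linter.unusedSectionVars false

variable {K : Type} [Field K] [LinearOrder K]

/-- The memory contains the input in arrays `0` and `1`. -/
structure InputState (n m : ℕ) (adj : ℕ → ℕ) (P : ℕ → K × K) (s : RamState K) : Prop where
  nf : s.nat 0 0 = n
  nm : s.nat 0 1 = m
  adj : s.nat 1 = adj
  pt : ∀ i, (s.num 0 i, s.num 1 i) = P i

/-- The memory also contains the candidates and the decomposition of node numbers. -/
structure NodeState (n m : ℕ) (adj : ℕ → ℕ) (P : ℕ → K × K) (s : RamState K) : Prop extends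
    InputState n m adj P s where
  quot : ∀ z < m * candidateCount n, s.nat 24 z = z / candidateCount n
  rem : ∀ z < m * candidateCount n, s.nat 25 z = z % candidateCount n
  cand : ∀ c < candidateCount n, (s.num 4 c, s.num 5 c) = candidateAt n P c

variable {n m : ℕ} {adj : ℕ → ℕ} {P : ℕ → K × K} {s s' : RamState K}

lemma InputState.agree {Q : RamProgram} (h : InputState n m adj P s) (hag : AgreeOutside Q s s')
    (h1 : ∀ a ∈ [0, 1], a ∉ Q.natWrites) (h2 : ∀ a ∈ [0, 1], a ∉ Q.numWrites) :
    InputState n m adj P s' := by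
  simp only [List.mem_cons, List.not_mem_nil, or_false, forall_eq_or_imp, forall_eq] at h1 h2
  refine ⟨?_, ?_, ?_, fun i => ?_⟩
  · rw [hag.nat 0 h1.1, h.nf]
  · rw [hag.nat 0 h1.1, h.nm]
  · rw [hag.nat 1 h1.2, h.adj]
  · rw [hag.num 0 h2.1, hag.num 1 h2.2, h.pt]

lemma NodeState.agree {Q : RamProgram} (h : NodeState n m adj P s) (hag : AgreeOutside Q s s')
    (h1 : ∀ a ∈ [0, 1, 24, 25], a ∉ Q.natWrites) (h2 : ∀ a ∈ [0, 1, 4, 5], a ∉ Q.numWrites) :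
    NodeState n m adj P s' := by
  refine ⟨h.toInputState.agree hag (fun a ha => h1 a (by simp at ha ⊢; tauto))
    (fun a ha => h2 a (by simp at ha ⊢; tauto)), fun z hz => ?_, fun z hz => ?_, fun c hc => ?_⟩
  · rw [hag.nat 24 (h1 24 (by simp)), h.quot z hz]
  · rw [hag.nat 25 (h1 25 (by simp)), h.rem z hz]
  · rw [hag.num 4 (h2 4 (by simp)), hag.num 5 (h2 5 (by simp)), h.cand c hc]

lemma InputState.eval_nf (h : InputState n m adj P s) : nfE.eval s = n := h.nf

lemma InputState.eval_vertexCount (h : InputState n m adj P s) :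
    vertexCountE.eval s = vertexCount n := by
  simp only [vertexCountE, NatExp.eval, h.eval_nf, vertexCount]

lemma InputState.eval_candidateCount (h : InputState n m adj P s) :
    candidateCountE.eval s = candidateCount n := by
  simp only [candidateCountE, NatExp.eval, h.eval_vertexCount, candidateCount]

lemma InputState.eval_nodeCount (h : InputState n m adj P s) :
    nodeCountE.eval s = m * candidateCount n := by
  simp only [nodeCountE, NatExp.eval, h.eval_candidateCount, nmE, h.nm]

lemma eval_reg (v : ℕ) (s : RamState K) : (NatExp.reg v).eval s = s.nat v 0 := rfl

variable {sz : K → ℕ} {X : ℕ}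

/-- The nested loops visit the indices `i * nv + j` in increasing order, so the invariant is
correctness below the current index. -/
lemma divTable_within {q r mv nv : ℕ} {me ne : NatExp} (hX : 4 ≤ X) (hs : BoundedState sz X s)
    (hqr : q ≠ r) (hq : q ∉ [30, 31]) (hr : r ∉ [30, 31]) (hmv : mv ≤ X) (hnv : nv ≤ X)
    (hm : ∀ s', AgreeOutside (divTableProgram q r me ne) s s' → me.eval s' = mv)
    (hn : ∀ s', AgreeOutside (divTableProgram q r me ne) s s' → ne.eval s' = nv) :
    Within sz X (divTableProgram q r me ne) s 5 (fun s' =>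
      ∀ z < mv * nv, s'.nat q z = z / nv ∧ s'.nat r z = z % nv) := by
  simp only [List.mem_cons, List.not_mem_nil, or_false, not_or] at hq hr
  refine Within.for (c := 3) (Inv := fun i s' => ∀ z < i * nv, s'.nat q z = z / nv ∧
    s'.nat r z = z % nv) hX hs hmv ?_ hm ?_ (by simp) ?_
  · simp only [natWrites_for, RamProgram.natWrites, List.mem_append, List.mem_singleton]
    omega
  · intro i s x h
    rwa [setNat_nat_of_ne hq.1, setNat_nat_of_ne hr.1]
  intro i hi s₁ hs₁ hag₁ hv₁ hI₁
  have hsub : ∀ s₂, AgreeOutside (.for 31 ne (.seq (.setNat q (.add (.mul (.reg 30) ne) (.reg 31))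
      (.reg 30)) (.setNat r (.add (.mul (.reg 30) ne) (.reg 31)) (.reg 31)))) s₁ s₂ →
      AgreeOutside (divTableProgram q r me ne) s s₂ := fun s₂ h =>
    hag₁.trans (h.mono (fun a ha => (natWrites_for _ _ _ a).2 (Or.inr ha))
      (fun a ha => (numWrites_for _ _ _ a).2 ha))
  have := Within.for (c := 1) (sz := sz) (X := X) (v := 31) (e := ne) (s := s₁)
    (P := .seq (.setNat q (.add (.mul (.reg 30) ne) (.reg 31)) (.reg 30))
      (.setNat r (.add (.mul (.reg 30) ne) (.reg 31)) (.reg 31)))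
    (Inv := fun j s' => ∀ z < i * nv + j, s'.nat q z = z / nv ∧
    s'.nat r z = z % nv) hX hs₁ hnv ?_ (fun s' h => hn s' (hsub s' h)) ?_ (by simpa using hI₁) ?_
  · refine this.imp fun s' _ _ h => ?_
    rw [Nat.succ_mul]; exact h
  · simp only [RamProgram.natWrites, List.mem_append, List.mem_singleton]; omega
  · intro i s x h
    rwa [setNat_nat_of_ne hq.2, setNat_nat_of_ne hr.2]
  intro j hj s₂ hs₂ hag₂ hv₂ hI₂
  have hne := hn s₂ (hsub s₂ hag₂)
  have hv₁' : s₂.nat 30 0 = i := by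
    rw [hag₂.nat 30, hv₁]
    simp only [natWrites_for, RamProgram.natWrites, List.mem_append, List.mem_singleton]; omega
  have hdiv : (i * nv + j) / nv = i := by
    rw [mul_comm, Nat.mul_add_div (by omega), Nat.div_eq_of_lt hj]; rfl
  have hmod : (i * nv + j) % nv = j := by
    rw [mul_comm, Nat.mul_add_mod, Nat.mod_eq_of_lt hj]
  refine Within.seq (a := 0) (b := 0) hX (Within.setNat (Q := fun s' =>
    (∀ z < i * nv + j, s'.nat q z = z / nv ∧ s'.nat r z = z % nv) ∧ s'.nat q (i * nv + j) = i)
    hs₂ (by rw [eval_reg, hv₁']; omega) ?_) ?_ (by norm_num) (by norm_num)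
  · simp only [NatExp.eval, eval_reg, hv₁', hv₂, hne]
    refine ⟨fun z hz => ?_, setNat_nat_self⟩
    rw [setNat_nat_self_of_ne (by omega), setNat_nat_of_ne hqr.symm]
    exact hI₂ z hz
  · intro s₃ hs₃ hag₃ hQ
    have hne₃ := hn s₃ (hsub s₃ (hag₂.trans (hag₃.mono
      (fun a ha => (natWrites_for _ _ _ a).2 (Or.inr (List.mem_append_left _ ha)))
      (fun a ha => (numWrites_for _ _ _ a).2 (List.mem_append_left _ ha)))))
    have e1 : s₃.nat 30 0 = i := by
      rw [hag₃.nat 30 (by simp [RamProgram.natWrites]; omega), hv₁']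
    have e2 : s₃.nat 31 0 = j := by
      rw [hag₃.nat 31 (by simp [RamProgram.natWrites]; omega), hv₂]
    refine Within.setNat hs₃ (by rw [eval_reg, e2]; omega) ?_
    simp only [NatExp.eval, eval_reg, e1, e2, hne₃]
    intro z hz
    rw [setNat_nat_of_ne hqr]
    rcases Nat.lt_or_ge z (i * nv + j) with h | h
    · rw [setNat_nat_self_of_ne (by omega)]
      exact hQ.1 z h
    · obtain rfl : z = i * nv + j := by omega
      rw [setNat_nat_self, hQ.2, hdiv, hmod]
      exact ⟨rfl, rfl⟩

lemma setNum_num_of_ne {s : RamState K} {a b i : ℕ} {v : K} (h : b ≠ a) :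
    (s.setNum a i v).num b = s.num b := by
  simp [RamState.setNum, Function.update_of_ne h]

lemma setNum_num_self {s : RamState K} {a i : ℕ} {v : K} : (s.setNum a i v).num a i = v := by
  simp [RamState.setNum]

lemma setNum_num_self_of_ne {s : RamState K} {a i j : ℕ} {v : K} (h : j ≠ i) :
    (s.setNum a i v).num a j = s.num a j := by
  simp [RamState.setNum, Function.update_of_ne h]

/-- A loop that computes the points of a table. -/
lemma fillPoints_within {a N : ℕ} {e : NatExp} {f : NumExp × NumExp} (F : ℕ → K × K) (hX : 4 ≤ X)
    (hs : BoundedState sz X s) (hN : N ≤ X)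
    (he : ∀ s', AgreeOutside (.for 30 e (.seq (.setNum a (.reg 30) f.1)
      (.setNum (a + 1) (.reg 30) f.2))) s s' → e.eval s' = N)
    (hf : ∀ s', AgreeOutside (.for 30 e (.seq (.setNum a (.reg 30) f.1)
      (.setNum (a + 1) (.reg 30) f.2))) s s' → ∀ i < N, s'.nat 30 0 = i →
      (f.1.eval s', f.2.eval s') = F i)
    (hF : ∀ i < N, sz (F i).1 ≤ X ∧ sz (F i).2 ≤ X) :
    Within sz X (.for 30 e (.seq (.setNum a (.reg 30) f.1) (.setNum (a + 1) (.reg 30) f.2))) s 3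
      (fun s' => ∀ z < N, (s'.num a z, s'.num (a + 1) z) = F z) := by
  refine Within.for (c := 1) (Inv := fun i s' => ∀ z < i, (s'.num a z, s'.num (a + 1) z) = F z)
    hX hs hN (by simp [RamProgram.natWrites]) he (fun i s x h => h) (by simp) ?_
  intro i hi s₁ hs₁ hag₁ hv₁ hI₁
  have h1 := hf s₁ hag₁ i hi hv₁
  have hev : ∀ s' : RamState K, s'.nat 30 0 = i → (NatExp.reg 30).eval s' = i := fun s' h => h
  refine Within.seq (a := 0) (b := 0) hX (Within.setNum (Q := fun s' =>
    (∀ z < i, (s'.num a z, s'.num (a + 1) z) = F z) ∧ s'.num a i = (F i).1)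
    hs₁ (by have := congrArg Prod.fst h1; simp only at this; rw [this]; exact (hF i hi).1) ?_) ?_
    (by norm_num) (by norm_num)
  · rw [hev _ hv₁]
    refine ⟨fun z hz => ?_, ?_⟩
    · rw [setNum_num_self_of_ne (by omega), setNum_num_of_ne (by omega)]
      exact hI₁ z hz
    · rw [setNum_num_self]
      exact congrArg Prod.fst h1
  · intro s₃ hs₃ hag₃ hQ
    have hv₃ : s₃.nat 30 0 = i := by rw [hag₃.nat 30 (by simp [RamProgram.natWrites]), hv₁]
    have h3 := congrArg Prod.snd (hf s₃ (hag₁.trans (hag₃.mono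
      (fun a ha => (natWrites_for _ _ _ a).2 (Or.inr (List.mem_append_left _ ha)))
      (fun a ha => (numWrites_for _ _ _ a).2 (List.mem_append_left _ ha)))) i hi hv₃)
    simp only at h3
    refine Within.setNum hs₃ (by rw [h3]; exact (hF i hi).2) ?_
    rw [hev _ hv₃]
    intro z hz
    rw [setNum_num_of_ne (by omega)]
    rcases Nat.lt_or_ge z i with h | h
    · rw [setNum_num_self_of_ne (by omega)]
      exact hQ.1 z h
    · obtain rfl : z = i := by omega
      rw [setNum_num_self, hQ.2, h3]

end Stages

/-! ### Meaning of the expressions, and correctness of the preparation. -/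

section Stages

set_option linter.unusedSectionVars false

variable {K : Type} [Field K] [LinearOrder K]

def evalPoint (s : RamState K) (e : NumExp × NumExp) : K × K := (e.1.eval s, e.2.eval s)

lemma eval_orientE (s : RamState K) (p q r : NumExp × NumExp) :
    (orientE p q r).eval s = orient (evalPoint s p) (evalPoint s q) (evalPoint s r) := rfl

lemma eval_dotE (s : RamState K) (p q r : NumExp × NumExp) :
    (dotE p q r).eval s = dotAt (evalPoint s p) (evalPoint s q) (evalPoint s r) := rfl

lemma evalPoint_lineInterE (s : RamState K) (a b c d : NumExp × NumExp) :
    evalPoint s (lineInterE a b c d) =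
      lineInter (evalPoint s a) (evalPoint s b) (evalPoint s c) (evalPoint s d) := rfl

lemma evalPoint_centroidE (s : RamState K) (p q r : NumExp × NumExp) :
    evalPoint s (centroidE p q r) = centroid3 (evalPoint s p) (evalPoint s q) (evalPoint s r) := by
  simp [evalPoint, centroidE, centroid3, NumExp.eval]

lemma evalPoint_pointE (s : RamState K) (a : ℕ) (e : NatExp) :
    evalPoint s (pointE a e) = (s.num a (e.eval s), s.num (a + 1) (e.eval s)) := rfl

lemma holds_or (s : RamState K) (b c : BoolExp) :
    (BoolExp.or b c).Holds s ↔ b.Holds s ∨ c.Holds s := by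
  simp only [BoolExp.or, BoolExp.Holds]; tauto

lemma holds_natEq (s : RamState K) (e f : NatExp) :
    (BoolExp.natEq e f).Holds s ↔ e.eval s = f.eval s := by
  simp only [BoolExp.natEq, BoolExp.Holds]; omega

lemma holds_numEq (s : RamState K) (e f : NumExp) :
    (BoolExp.numEq e f).Holds s ↔ e.eval s = f.eval s := by
  simp only [BoolExp.numEq, BoolExp.Holds]
  exact le_antisymm_iff.symm

lemma holds_pos (s : RamState K) (e : NumExp) : (BoolExp.pos e).Holds s ↔ 0 < e.eval s := by
  simp [BoolExp.pos, BoolExp.Holds, NumExp.eval]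

variable {n m : ℕ} {adj : ℕ → ℕ} {P : ℕ → K × K} {s s' : RamState K}

lemma InputState.evalPoint (h : InputState n m adj P s) (e : NatExp) :
    evalPoint s (pointE 0 e) = P (e.eval s) := h.pt _

lemma InputState.holds_adjE (h : InputState n m adj P s) (u a : NatExp) :
    (adjE u a).Holds s ↔ IsNbr n adj (u.eval s) (a.eval s) := by
  simp only [adjE, BoolExp.Holds, NatExp.eval, h.eval_nf, h.adj, IsNbr]

lemma NodeState.evalPoint (h : NodeState n m adj P s) {v : ℕ}
    (hv : s.nat v 0 < m * candidateCount n) :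
    evalPoint s (nodePointE v) = candidateAt n P (s.nat v 0 % candidateCount n) := by
  have hD : 0 < candidateCount n := by
    rcases Nat.eq_zero_or_pos (candidateCount n) with h0 | h0
    · rw [h0] at hv; omega
    · exact h0
  rw [nodePointE, evalPoint_pointE]
  simp only [NatExp.eval, eval_reg, h.rem _ hv]
  exact h.cand _ (Nat.mod_lt _ hD)

lemma NodeState.eval_nodeVertex (h : NodeState n m adj P s) {v : ℕ}
    (hv : s.nat v 0 < m * candidateCount n) :
    (nodeVertexE v).eval s = s.nat v 0 / candidateCount n := h.quot _ hv

variable {sz : K → ℕ} {X : ℕ}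

lemma setFlag_within {fl : ℕ} {b : BoolExp} (hX : 4 ≤ X) (hs : BoundedState sz X s) {C : Prop}
    (h : b.Holds s ↔ C) : Within sz X (setFlag fl b) s 1 (fun s' =>
      (C → s'.nat fl 0 = 1) ∧ (¬ C → s'.nat fl 0 = s.nat fl 0)) := by
  refine Within.ite (a := 0) hX hs (fun hb => Within.setNat hs ?_ ?_) (fun hb => Within.skip hs ?_)
    (by norm_num)
  · simp only [NatExp.eval]; omega
  · exact ⟨fun _ => setNat_nat_self, fun hC => absurd (h.1 hb) hC⟩
  · exact ⟨fun hC => absurd (h.2 hC) hb, fun _ => rfl⟩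

lemma storeFlag_within {a i : ℕ} {e : NatExp} {b : BoolExp} (hX : 4 ≤ X)
    (hs : BoundedState sz X s) {C : Prop} (h : b.Holds s ↔ C) (he : e.eval s = i) :
    Within sz X (storeFlag a e b) s 1 (fun s' => (C → s'.nat a i = 1) ∧ (¬ C → s'.nat a i = 0) ∧
      ∀ j, j ≠ i → s'.nat a j = s.nat a j) := by
  refine Within.ite (a := 0) hX hs (fun hb => Within.setNat hs ?_ ?_)
    (fun hb => Within.setNat hs ?_ ?_) (by norm_num)
  · simp only [NatExp.eval]; omega
  · rw [he]
    exact ⟨fun _ => setNat_nat_self, fun hC => absurd (h.1 hb) hC,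
      fun j hj => setNat_nat_self_of_ne hj⟩
  · simp only [NatExp.eval]; omega
  · rw [he]
    exact ⟨fun hC => absurd (h.2 hC) hb, fun _ => setNat_nat_self,
      fun j hj => setNat_nat_self_of_ne hj⟩

lemma div_lt_vertexCount {z : ℕ} (hz : z < vertexCount n) :
    z / n < vertexCount n ∧ z / n / n < vertexCount n :=
  ⟨(Nat.div_le_self _ _).trans_lt hz,
    ((Nat.div_le_self _ _).trans (Nat.div_le_self _ _)).trans_lt hz⟩

lemma vertexCount_pos_of_lt {z : ℕ} (hz : z < candidateCount n) : 0 < vertexCount n := by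
  rcases Nat.eq_zero_or_pos (vertexCount n) with h0 | h0
  · rw [candidateCount, h0] at hz; omega
  · exact h0

theorem prepare_within (hX : 4 ≤ X) (hs : BoundedState sz X s) (hI : InputState n m adj P s)
    (hn : n * n * n ≤ X) (hV : vertexCount n ≤ X) (hVV : vertexCount n * vertexCount n ≤ X)
    (hD : candidateCount n ≤ X) (hm : m ≤ X)
    (hv : ∀ c < vertexCount n, sz (vertexAt n P c).1 ≤ X ∧ sz (vertexAt n P c).2 ≤ X)
    (hc : ∀ c < candidateCount n, sz (candidateAt n P c).1 ≤ X ∧ sz (candidateAt n P c).2 ≤ X) :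
    Within sz X prepareProgram s 8 (NodeState n m adj P) := by
  have hnX : n ≤ X := hs.nat 0 0 |>.trans' hI.nf.ge
  refine Within.seq (a := 5) (b := 7) hX (divTable_within (mv := n * n * n) (nv := n) hX hs
    (by norm_num) (by decide) (by decide) hn hnX
    (fun s' h => by
      simp only [NatExp.eval, (hI.agree h (by decide) (by decide)).eval_nf])
    (fun s' h => (hI.agree h (by decide) (by decide)).eval_nf)) ?_ (by norm_num) (by norm_num)
  intro s₁ hs₁ hag₁ hT₁
  have hI₁ := hI.agree hag₁ (by decide) (by decide)
  refine Within.seq (a := 5) (b := 6) hX (divTable_within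
    (mv := vertexCount n * vertexCount n) (nv := vertexCount n) hX hs₁
    (by norm_num) (by decide) (by decide) hVV hV
    (fun s' h => by
      simp only [NatExp.eval, (hI₁.agree h (by decide) (by decide)).eval_vertexCount])
    (fun s' h => (hI₁.agree h (by decide) (by decide)).eval_vertexCount)) ?_
    (by norm_num) (by norm_num)
  intro s₂ hs₂ hag₂ hT₂
  have hI₂ := hI₁.agree hag₂ (by decide) (by decide)
  refine Within.seq (a := 5) (b := 4) hX (divTable_within (mv := m) (nv := candidateCount n) hX hs₂
    (by norm_num) (by decide) (by decide) hm hD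
    (fun s' h => (hI₂.agree h (by decide) (by decide)).nm)
    (fun s' h => (hI₂.agree h (by decide) (by decide)).eval_candidateCount)) ?_
    (by norm_num) (by norm_num)
  intro s₃ hs₃ hag₃ hT₃
  have hI₃ := hI₂.agree hag₃ (by decide) (by decide)
  have h20 : ∀ z < vertexCount n, s₃.nat 20 z = z / n ∧ s₃.nat 21 z = z % n := by
    rw [hag₃.nat 20 (by decide), hag₂.nat 20 (by decide), hag₃.nat 21 (by decide),
      hag₂.nat 21 (by decide)]
    exact hT₁
  have h22 : ∀ z < candidateCount n, s₃.nat 22 z = z / vertexCount n ∧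
      s₃.nat 23 z = z % vertexCount n := by
    rw [hag₃.nat 22 (by decide), hag₃.nat 23 (by decide)]
    exact hT₂
  refine Within.seq (a := 3) (b := 3) hX (fillPoints_within (vertexAt n P) hX hs₃ hV
    (fun s' h => (hI₃.agree h (by decide) (by decide)).eval_vertexCount) ?_ hv) ?_
    (by norm_num) (by norm_num)
  · intro s' hag' i hi hi'
    have hI' := hI₃.agree hag' (by decide) (by decide)
    have h20' : ∀ z < vertexCount n, s'.nat 20 z = z / n ∧ s'.nat 21 z = z % n := by
      rw [hag'.nat 20 (by decide), hag'.nat 21 (by decide)]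
      exact h20
    obtain ⟨k1, k2⟩ := div_lt_vertexCount hi
    change evalPoint s' (vertexE (.reg 30)) = _
    simp only [vertexE, evalPoint_lineInterE, hI'.evalPoint, NatExp.eval, eval_reg, hi', h20' _ hi,
      h20' _ k1, h20' _ k2, vertexAt]
  · intro s₄ hs₄ hag₄ hT₄
    have hI₄ := hI₃.agree hag₄ (by decide) (by decide)
    refine (fillPoints_within (candidateAt n P) hX hs₄ hD
      (fun s' h => (hI₄.agree h (by decide) (by decide)).eval_candidateCount) ?_ hc).imp ?_
    · intro s' hag' i hi hi'
      have h22' : ∀ z < candidateCount n, s'.nat 22 z = z / vertexCount n ∧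
          s'.nat 23 z = z % vertexCount n := by
        rw [hag'.nat 22 (by decide), hag'.nat 23 (by decide), hag₄.nat 22 (by decide),
          hag₄.nat 23 (by decide)]
        exact h22
      have hV' := vertexCount_pos_of_lt hi
      have k1 : i / vertexCount n < candidateCount n := (Nat.div_le_self _ _).trans_lt hi
      have k2 : i / vertexCount n / vertexCount n < vertexCount n := by
        rw [Nat.div_lt_iff_lt_mul hV', Nat.div_lt_iff_lt_mul hV']; exact hi
      have hT' : ∀ z < vertexCount n, (s'.num 2 z, s'.num (2 + 1) z) = vertexAt n P z := by
        rw [hag'.num 2 (by decide), hag'.num (2 + 1) (by decide)]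
        exact hT₄
      change evalPoint s' (candidateE (.reg 30)) = _
      simp only [candidateE, evalPoint_centroidE, evalPoint_pointE, NatExp.eval, eval_reg, hi',
        h22' _ hi, h22' _ k1, hT' _ k2, hT' _ (Nat.mod_lt _ hV'), candidateAt]
    · intro s' hs' hag' hc'
      refine ⟨hI₄.agree hag' (by decide) (by decide), fun z hz => ?_, fun z hz => ?_, hc'⟩
      · rw [hag'.nat 24 (by decide), hag₄.nat 24 (by decide)]; exact (hT₃ z hz).1
      · rw [hag'.nat 25 (by decide), hag₄.nat 25 (by decide)]; exact (hT₃ z hz).2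

end Stages

/-! ### Correctness of the validity and compatibility tables. -/

section Stages

set_option linter.unusedSectionVars false

variable {K : Type} [Field K] [LinearOrder K]
variable {n m : ℕ} {adj : ℕ → ℕ} {P : ℕ → K × K} {s s' : RamState K} {sz : K → ℕ} {X : ℕ}

lemma hullLoop_within (hX : 4 ≤ X) (hs : BoundedState sz X s) (hN : NodeState n m adj P s) {i : ℕ}
    (hi : i < m * candidateCount n) (hv : s.nat 30 0 = i) :
    Within sz X hullLoop s 7 (fun s' =>
      let C := ∃ a < n, ∃ b < n, ∃ c < n, IsNbr n adj (i / candidateCount n) a ∧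
        IsNbr n adj (i / candidateCount n) b ∧ IsNbr n adj (i / candidateCount n) c ∧
        (InTriangle (P a) (P b) (P c) (candidateAt n P (i % candidateCount n)) ∨
          (a ≠ b ∧ candidateAt n P (i % candidateCount n) = centroid3 (P a) (P a) (P b)))
      (C → s'.nat 40 0 = 1) ∧ (¬ C → s'.nat 40 0 = s.nat 40 0)) := by
  have hnX : n ≤ X := hs.nat 0 0 |>.trans' hN.nf.ge
  refine Within.exists _ hX hs hnX (by decide) (by decide)
    (fun s' h => (hN.agree h (by decide) (by decide)).eval_nf) ?_
  intro a ha s₁ hs₁ hag₁ ha₁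
  have hN₁ := hN.agree hag₁ (by decide) (by decide)
  refine Within.exists _ hX hs₁ hnX (by decide) (by decide)
    (fun s' h => (hN₁.agree h (by decide) (by decide)).eval_nf) ?_
  intro b hb s₂ hs₂ hag₂ hb₂
  have hN₂ := hN₁.agree hag₂ (by decide) (by decide)
  refine Within.exists _ hX hs₂ hnX (by decide) (by decide)
    (fun s' h => (hN₂.agree h (by decide) (by decide)).eval_nf) ?_
  intro c hc s₃ hs₃ hag₃ hc₃
  have hN₃ := hN₂.agree hag₃ (by decide) (by decide)
  refine setFlag_within hX hs₃ ?_
  have e34 : s₃.nat 34 0 = a := by rw [hag₃.nat 34 (by decide), hag₂.nat 34 (by decide), ha₁]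
  have e35 : s₃.nat 35 0 = b := by rw [hag₃.nat 35 (by decide), hb₂]
  have e30 : s₃.nat 30 0 = i := by
    rw [hag₃.nat 30 (by decide), hag₂.nat 30 (by decide), hag₁.nat 30 (by decide), hv]
  have hi₃ : s₃.nat 30 0 < m * candidateCount n := by rwa [e30]
  have hp := hN₃.evalPoint hi₃
  have hu := hN₃.eval_nodeVertex hi₃
  rw [e30] at hp hu
  have hc1 := evalPoint_centroidE s₃ (pointE 0 (.reg 34)) (pointE 0 (.reg 34)) (pointE 0 (.reg 35))
  simp only [hN₃.toInputState.evalPoint, eval_reg, e34, e35] at hc1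
  have hp1 := congrArg Prod.fst hp
  have hp2 := congrArg Prod.snd hp
  have hc2 := congrArg Prod.fst hc1
  have hc3 := congrArg Prod.snd hc1
  simp only [evalPoint] at hp1 hp2 hc2 hc3
  simp only [hullCondition, BoolExp.Holds, holds_or, holds_natEq, holds_numEq, holds_pos,
    hN₃.holds_adjE, eval_orientE, hN₃.toInputState.evalPoint, hp, hu, eval_reg, e34, e35, hc₃,
    hp1, hp2, hc2, hc3, InTriangle, Prod.ext_iff (x := candidateAt _ _ _)]
  tauto

lemma blockedLoop_within (hX : 4 ≤ X) (hs : BoundedState sz X s) (hN : NodeState n m adj P s)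
    {i : ℕ} (hi : i < m * candidateCount n) (hv : s.nat 30 0 = i) :
    Within sz X blockedLoop s 5 (fun s' =>
      let C := ∃ c < n, ∃ f < n, IsNbr n adj (i / candidateCount n) c ∧ f ≠ c ∧
        orient (P f) (P c) (candidateAt n P (i % candidateCount n)) = 0 ∧
        dotAt (P f) (candidateAt n P (i % candidateCount n)) (P c) ≤ 0
      (C → s'.nat 41 0 = 1) ∧ (¬ C → s'.nat 41 0 = s.nat 41 0)) := by
  have hnX : n ≤ X := hs.nat 0 0 |>.trans' hN.nf.ge
  refine Within.exists _ hX hs hnX (by decide) (by decide)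
    (fun s' h => (hN.agree h (by decide) (by decide)).eval_nf) ?_
  intro a ha s₁ hs₁ hag₁ ha₁
  have hN₁ := hN.agree hag₁ (by decide) (by decide)
  refine Within.exists _ hX hs₁ hnX (by decide) (by decide)
    (fun s' h => (hN₁.agree h (by decide) (by decide)).eval_nf) ?_
  intro b hb s₂ hs₂ hag₂ hb₂
  have hN₂ := hN₁.agree hag₂ (by decide) (by decide)
  refine setFlag_within hX hs₂ ?_
  have e34 : s₂.nat 34 0 = a := by rw [hag₂.nat 34 (by decide), ha₁]
  have e30 : s₂.nat 30 0 = i := by rw [hag₂.nat 30 (by decide), hag₁.nat 30 (by decide), hv]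
  have hi₂ : s₂.nat 30 0 < m * candidateCount n := by rwa [e30]
  have hp := hN₂.evalPoint hi₂
  have hu := hN₂.eval_nodeVertex hi₂
  rw [e30] at hp hu
  simp only [blockedCondition, BoolExp.Holds, holds_natEq, holds_numEq, hN₂.holds_adjE,
    eval_orientE, eval_dotE, hN₂.toInputState.evalPoint, hp, hu, eval_reg, e34, hb₂,
    NumExp.eval, Nat.cast_zero, ne_eq]

lemma conflictLoop_within (hX : 4 ≤ X) (hs : BoundedState sz X s) (hN : NodeState n m adj P s)
    {i j : ℕ} (hi : i < m * candidateCount n) (hv : s.nat 30 0 = i)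
    (hj : j < m * candidateCount n) (hw : s.nat 31 0 = j) :
    Within sz X conflictLoop s 5 (fun s' =>
      let C := ConflictAt n adj P (i / candidateCount n) (candidateAt n P (i % candidateCount n))
        (j / candidateCount n) (candidateAt n P (j % candidateCount n))
      (C → s'.nat 41 0 = 1) ∧ (¬ C → s'.nat 41 0 = s.nat 41 0)) := by
  have hnX : n ≤ X := hs.nat 0 0 |>.trans' hN.nf.ge
  refine Within.exists _ hX hs hnX (by decide) (by decide)
    (fun s' h => (hN.agree h (by decide) (by decide)).eval_nf) ?_
  intro a ha s₁ hs₁ hag₁ ha₁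
  have hN₁ := hN.agree hag₁ (by decide) (by decide)
  refine Within.exists _ hX hs₁ hnX (by decide) (by decide)
    (fun s' h => (hN₁.agree h (by decide) (by decide)).eval_nf) ?_
  intro b hb s₂ hs₂ hag₂ hb₂
  have hN₂ := hN₁.agree hag₂ (by decide) (by decide)
  refine setFlag_within hX hs₂ ?_
  have e34 : s₂.nat 34 0 = a := by rw [hag₂.nat 34 (by decide), ha₁]
  have e30 : s₂.nat 30 0 = i := by rw [hag₂.nat 30 (by decide), hag₁.nat 30 (by decide), hv]
  have e31 : s₂.nat 31 0 = j := by rw [hag₂.nat 31 (by decide), hag₁.nat 31 (by decide), hw]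
  have hi₂ : s₂.nat 30 0 < m * candidateCount n := by rwa [e30]
  have hj₂ : s₂.nat 31 0 < m * candidateCount n := by rwa [e31]
  have hp := hN₂.evalPoint hi₂
  have hu := hN₂.eval_nodeVertex hi₂
  have hq := hN₂.evalPoint hj₂
  have hw := hN₂.eval_nodeVertex hj₂
  rw [e30] at hp hu
  rw [e31] at hq hw
  simp only [conflictCondition, separatedE, BoolExp.Holds, holds_natEq, holds_or, holds_pos,
    hN₂.holds_adjE, NumExp.eval, eval_orientE, hN₂.toInputState.evalPoint, hp, hu, hq, hw, eval_reg,
    e34, hb₂, Separated]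
  tauto

theorem valid_within (hX : 4 ≤ X) (hs : BoundedState sz X s) (hN : NodeState n m adj P s)
    (hM : m * candidateCount n ≤ X) :
    Within sz X validProgram s 11 (fun s' => ∀ i < m * candidateCount n,
      1 ≤ s'.nat 26 i ↔ ValidNode n adj P i) := by
  refine Within.for (c := 9) (Inv := fun k s' => ∀ i < k, 1 ≤ s'.nat 26 i ↔ ValidNode n adj P i)
    hX hs hM (by decide) (fun s' h => (hN.agree h (by decide) (by decide)).eval_nodeCount)
    (fun i s x h => by rwa [setNat_nat_of_ne (by norm_num)]) (by simp) ?_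
  intro i hi s₁ hs₁ hag₁ hv₁ hI₁
  have hN₁ := hN.agree hag₁ (by decide) (by decide)
  refine Within.seq (a := 0) (b := 8) hX (Within.setNat (Q := fun s' => s'.nat 40 0 = 0) hs₁
    (Nat.zero_le _) setNat_nat_self) ?_ (by norm_num) (by norm_num)
  intro s₂ hs₂ hag₂ h40
  have hN₂ := hN₁.agree hag₂ (by decide) (by decide)
  have hv₂ : s₂.nat 30 0 = i := by rw [hag₂.nat 30 (by decide), hv₁]
  refine Within.seq (a := 7) (b := 7) hX (hullLoop_within hX hs₂ hN₂ hi hv₂) ?_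
    (by norm_num) (by norm_num)
  intro s₃ hs₃ hag₃ h3
  have hN₃ := hN₂.agree hag₃ (by decide) (by decide)
  have hv₃ : s₃.nat 30 0 = i := by rw [hag₃.nat 30 (by decide), hv₂]
  refine Within.seq (a := 0) (b := 6) hX (Within.setNat (Q := fun s' => s'.nat 41 0 = 0) hs₃
    (Nat.zero_le _) setNat_nat_self) ?_ (by norm_num) (by norm_num)
  intro s₄ hs₄ hag₄ h41
  have hN₄ := hN₃.agree hag₄ (by decide) (by decide)
  have hv₄ : s₄.nat 30 0 = i := by rw [hag₄.nat 30 (by decide), hv₃]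
  refine Within.seq (a := 5) (b := 1) hX (blockedLoop_within hX hs₄ hN₄ hi hv₄) ?_
    (by norm_num) (by norm_num)
  intro s₅ hs₅ hag₅ h5
  have hv₅ : s₅.nat 30 0 = i := by rw [hag₅.nat 30 (by decide), hv₄]
  have h26 : s₅.nat 26 = s₁.nat 26 := by
    rw [hag₅.nat 26 (by decide), hag₄.nat 26 (by decide), hag₃.nat 26 (by decide),
      hag₂.nat 26 (by decide)]
  have e40 : s₅.nat 40 0 = s₃.nat 40 0 := by rw [hag₅.nat 40 (by decide), hag₄.nat 40 (by decide)]
  refine (storeFlag_within (C := ValidNode n adj P i) (i := i) hX hs₅ ?_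
    (show (NatExp.reg 30).eval s₅ = i from hv₅)).imp ?_
  · simp only [BoolExp.Holds, NatExp.eval, eval_reg, e40]
    rw [ValidNode, ValidAt]
    dsimp only at h3 h5
    refine and_congr ⟨fun h => ?_, fun h => by rw [h3.1 h]⟩
      ⟨fun h hC => ?_, fun h => by rw [h5.2 h, h41]⟩
    · by_contra hC
      rw [h3.2 hC, h40] at h; omega
    · rw [h5.1 hC] at h; omega
  · rintro s' - - ⟨k1, k2, k3⟩ z hz
    by_cases hzi : z = i
    · subst hzi
      by_cases hC : ValidNode n adj P z
      · simp [k1 hC, hC]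
      · simp [k2 hC, hC]
    · rw [k3 z hzi, h26]
      exact hI₁ z (by omega)

/-- The table of compatible pairs, as a set of indices. -/
def tableSet (M : ℕ) (s : RamState K) : Set ℕ := {z | z < M * M ∧ 1 ≤ s.nat 27 z}

theorem pair_within (hX : 4 ≤ X) (hs : BoundedState sz X s) (hN : NodeState n m adj P s)
    (hM : m * candidateCount n ≤ X)
    (h26 : ∀ i < m * candidateCount n, 1 ≤ s.nat 26 i ↔ ValidNode n adj P i) :
    Within sz X pairProgram s 11 (fun s' => ∀ i < m * candidateCount n,
      ∀ j < m * candidateCount n, i * (m * candidateCount n) + j ∈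
        tableSet (m * candidateCount n) s' ↔ PairAt n adj P i j) := by
  set M := m * candidateCount n with hMdef
  have hlt : ∀ {i j}, i < M → j < M → i * M + j < M * M := fun {i j} hi hj => by
    calc i * M + j < i * M + M := by omega
      _ = (i + 1) * M := by ring
      _ ≤ M * M := Nat.mul_le_mul_right _ hi
  have hinj : ∀ {i j i' j'}, j < M → j' < M → i * M + j = i' * M + j' → i = i' ∧ j = j' := by
    intro i j i' j' hj hj' h
    have h1 : (i * M + j) / M = i := by
      rw [mul_comm, Nat.mul_add_div (by omega), Nat.div_eq_of_lt hj]; rfl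
    have h2 : (i' * M + j') / M = i' := by
      rw [mul_comm, Nat.mul_add_div (by omega), Nat.div_eq_of_lt hj']; rfl
    obtain rfl : i = i' := by rw [← h1, h, h2]
    exact ⟨rfl, by omega⟩
  refine Within.for (c := 9) (Inv := fun k s' => ∀ i < k, ∀ j < M, i < M →
    (i * M + j ∈ tableSet M s' ↔ PairAt n adj P i j))
    hX hs hM (by decide) (fun s' h => (hN.agree h (by decide) (by decide)).eval_nodeCount)
    (fun i s x h => by
      simp only [tableSet] at h ⊢
      rwa [setNat_nat_of_ne (by norm_num)]) (by simp) ?_ |>.imp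
    fun s' _ _ h i hi j hj => h i hi j hj hi
  intro i hi s₁ hs₁ hag₁ hv₁ hI₁
  have hN₁ := hN.agree hag₁ (by decide) (by decide)
  have h26₁ : s₁.nat 26 = s.nat 26 := hag₁.nat 26 (by decide)
  -- The invariant speaks of all pairs lexicographically before the current one; distinct pairs have
  -- distinct indices, so later writes do not spoil earlier entries.
  refine (Within.for (c := 7) (Inv := fun l s' => ∀ i' j, (i' < i ∨ (i' = i ∧ j < l)) → j < M →
    i' < M → (i' * M + j ∈ tableSet M s' ↔ PairAt n adj P i' j))
    hX hs₁ hM (by decide) (fun s' h => (hN₁.agree h (by decide) (by decide)).eval_nodeCount)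
    (fun i s x h => by
      simp only [tableSet] at h ⊢
      rwa [setNat_nat_of_ne (by norm_num)])
    (fun i' j hc => hI₁ i' (by omega) j) ?_).imp
    fun s' _ _ h i' hi' j hj => h i' j (by omega) hj
  intro j hj s₂ hs₂ hag₂ hw₂ hI₂
  have hN₂ := hN₁.agree hag₂ (by decide) (by decide)
  have hv₂ : s₂.nat 30 0 = i := by rw [hag₂.nat 30 (by decide), hv₁]
  have h26₂ : s₂.nat 26 = s.nat 26 := by rw [hag₂.nat 26 (by decide), h26₁]
  refine Within.seq (a := 0) (b := 6) hX (Within.setNat (Q := fun s' => s'.nat 41 0 = 0) hs₂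
    (Nat.zero_le _) setNat_nat_self) ?_ (by norm_num) (by norm_num)
  intro s₃ hs₃ hag₃ h41
  have hN₃ := hN₂.agree hag₃ (by decide) (by decide)
  have hv₃ : s₃.nat 30 0 = i := by rw [hag₃.nat 30 (by decide), hv₂]
  have hw₃ : s₃.nat 31 0 = j := by rw [hag₃.nat 31 (by decide), hw₂]
  refine Within.seq (a := 5) (b := 1) hX (conflictLoop_within hX hs₃ hN₃ hi hv₃ hj hw₃) ?_
    (by norm_num) (by norm_num)
  intro s₄ hs₄ hag₄ h4
  have hN₄ := hN₃.agree hag₄ (by decide) (by decide)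
  have hv₄ : s₄.nat 30 0 = i := by rw [hag₄.nat 30 (by decide), hv₃]
  have hw₄ : s₄.nat 31 0 = j := by rw [hag₄.nat 31 (by decide), hw₃]
  have h26₄ : s₄.nat 26 = s.nat 26 := by
    rw [hag₄.nat 26 (by decide), hag₃.nat 26 (by decide), h26₂]
  have h27₄ : s₄.nat 27 = s₂.nat 27 := by rw [hag₄.nat 27 (by decide), hag₃.nat 27 (by decide)]
  have hu := hN₄.eval_nodeVertex (v := 30) (by rwa [hv₄])
  have hw := hN₄.eval_nodeVertex (v := 31) (by rwa [hw₄])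
  rw [hv₄] at hu
  rw [hw₄] at hw
  refine (storeFlag_within (C := PairAt n adj P i j) (i := i * M + j) hX hs₄ ?_ ?_).imp ?_
  · simp only [pairCondition, BoolExp.Holds, holds_or, holds_natEq, NatExp.eval, eval_reg, hv₄, hw₄,
      hu, hw, h26₄, h26 i hi, h26 j hj, PairAt, and_assoc, ne_eq]
    dsimp only at h4
    refine and_congr_right fun _ => and_congr_right fun _ => or_congr_right
      (and_congr_right fun _ => ⟨fun h hC => ?_, fun h => by rw [h4.2 h, h41]⟩)
    rw [h4.1 hC] at h; omega
  · simp only [pairIndexE, NatExp.eval, eval_reg, hv₄, hw₄, hN₄.eval_nodeCount, hMdef]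
  · rintro s' - - ⟨k1, k2, k3⟩ i' j' hc hj' hi'
    by_cases h : i' * M + j' = i * M + j
    · obtain ⟨rfl, rfl⟩ := hinj hj' hj h
      by_cases hC : PairAt n adj P i' j'
      · simp [tableSet, k1 hC, hC, hlt hi' hj']
      · simp [tableSet, k2 hC, hC]
    · have := hI₂ i' j' (by
        rcases hc with hc | ⟨rfl, hc⟩
        · exact Or.inl hc
        · refine Or.inr ⟨rfl, ?_⟩
          rcases Nat.lt_or_ge j' j with h' | h'
          · exact h'
          · exact absurd (by rw [show j' = j by omega]) h) hj' hi'
      rw [← this, tableSet, tableSet, Set.mem_ofPred_eq, Set.mem_ofPred_eq, k3 _ h, h27₄]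

end Stages

/-! ## Enforcing path consistency -/

/-- Entry `(e, f)` of the table of pairs is set. -/
def pairSetE (e f : NatExp) : BoolExp :=
  .natLe (.const 1) (.get 27 (.add (.mul e nodeCountE) f))

/-- The node with mobile vertex and candidate in registers `32` and `34`. -/
def middleE : NatExp := .add (.mul (.reg 32) candidateCountE) (.reg 34)

def filterBody : RamProgram :=
  .seq (.setNat 42 (.const 0) (.const 0))
    (.seq (.for 34 candidateCountE
        (setFlag 42 (.and (pairSetE (.reg 30) middleE) (pairSetE middleE (.reg 31)))))
      (storeFlag 27 pairIndexE (.and (pairSetE (.reg 30) (.reg 31))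
        (.natLe (.const 1) (.reg 42)))))

/-- For all pairs of nodes and all mobile vertices, remove the pair if no candidate of the vertex
is compatible with both nodes. -/
def sweepProgram : RamProgram :=
  .for 30 nodeCountE (.for 31 nodeCountE (.for 32 nmE filterBody))

def filterProgram : RamProgram :=
  .for 33 (.add (.mul nodeCountE nodeCountE) (.const 1)) sweepProgram

/-- Answer whether the table is nonempty. -/
def answerProgram : RamProgram :=
  .seq (.setNat 43 (.const 0) (.const 0))
    (.seq (.for 30 (.mul nodeCountE nodeCountE)
        (setFlag 43 (.natLe (.const 1) (.get 27 (.reg 30)))))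
      (.setNat 0 (.const 2) (.reg 43)))

def drawingProgram : RamProgram :=
  .seq prepareProgram (.seq validProgram (.seq pairProgram (.seq filterProgram answerProgram)))

/-- In the table `T`, the pair of nodes `i`, `j` extends to the mobile vertex `w`. -/
def Supported (D M : ℕ) (T : Set ℕ) (i j w : ℕ) : Prop :=
  ∃ x < D, i * M + (w * D + x) ∈ T ∧ (w * D + x) * M + j ∈ T

lemma Supported.mono {D M : ℕ} {T T' : Set ℕ} (h : T ⊆ T') {i j w : ℕ}
    (hs : Supported D M T i j w) : Supported D M T' i j w := by
  obtain ⟨x, hx, h1, h2⟩ := hs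
  exact ⟨x, hx, h h1, h h2⟩

/-- Every pair in the table extends to every mobile vertex. -/
def TableConsistent (D m : ℕ) (T : Set ℕ) : Prop :=
  ∀ i < m * D, ∀ j < m * D, ∀ w < m, i * (m * D) + j ∈ T → Supported D (m * D) T i j w

/-! ### Sweeps reach the largest consistent table. -/

section Sweeps

set_option linter.unusedSectionVars false

variable {K : Type} [Field K] [LinearOrder K]
variable {n m : ℕ} {adj : ℕ → ℕ} {P : ℕ → K × K} {s s' : RamState K} {sz : K → ℕ} {X : ℕ}

/-- Progress of a sweep started with the table `S`, after the triples in `done`. -/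
structure SweepInv (D m : ℕ) (S : Set ℕ) (done : ℕ → ℕ → ℕ → Prop) (s : RamState K) : Prop where
  subset : tableSet (m * D) s ⊆ S
  keep : ∀ Z ⊆ S, TableConsistent D m Z → Z ⊆ tableSet (m * D) s
  supported : tableSet (m * D) s = S → ∀ i j w, done i j w → i * (m * D) + j ∈ S →
    Supported D (m * D) S i j w

lemma SweepInv.mono {D : ℕ} {S : Set ℕ} {done done' : ℕ → ℕ → ℕ → Prop}
    (h : SweepInv D m S done s) (hd : ∀ i j w, done' i j w → done i j w) :
    SweepInv D m S done' s :=
  ⟨h.subset, h.keep, fun hS i j w hdone => h.supported hS i j w (hd i j w hdone)⟩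

lemma tableSet_congr {M : ℕ} (h : s'.nat 27 = s.nat 27) : tableSet M s' = tableSet M s := by
  rw [tableSet, tableSet, h]

lemma SweepInv.congr {D : ℕ} {S : Set ℕ} {done : ℕ → ℕ → ℕ → Prop} (h : SweepInv D m S done s)
    (h27 : s'.nat 27 = s.nat 27) : SweepInv D m S done s' := by
  obtain ⟨h1, h2, h3⟩ := h
  rw [← tableSet_congr h27] at h1 h2 h3
  exact ⟨h1, h2, h3⟩

lemma index_lt {M i j : ℕ} (hi : i < M) (hj : j < M) : i * M + j < M * M := by
  calc i * M + j < i * M + M := by omega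
    _ = (i + 1) * M := by ring
    _ ≤ M * M := Nat.mul_le_mul_right _ hi

lemma node_lt {D w x : ℕ} (hw : w < m) (hx : x < D) : w * D + x < m * D := by
  calc w * D + x < w * D + D := by omega
    _ = (w + 1) * D := by ring
    _ ≤ m * D := Nat.mul_le_mul_right _ hw

lemma filterBody_within (hX : 4 ≤ X) (hs : BoundedState sz X s) (hI : InputState n m adj P s)
    (hD : candidateCount n ≤ X) {i j w : ℕ} (hi : i < m * candidateCount n)
    (hj : j < m * candidateCount n) (hw : w < m) (hvi : s.nat 30 0 = i) (hvj : s.nat 31 0 = j)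
    (hvw : s.nat 32 0 = w) {S : Set ℕ} {done : ℕ → ℕ → ℕ → Prop}
    (h : SweepInv (candidateCount n) m S done s) :
    Within sz X filterBody s 5 (SweepInv (candidateCount n) m S
      (fun a b c => done a b c ∨ (a = i ∧ b = j ∧ c = w))) := by
  set D := candidateCount n with hDdef
  set T := tableSet (m * D) s with hT
  have hmem : ∀ z, z ∈ T ↔ z < (m * D) * (m * D) ∧ 1 ≤ s.nat 27 z := fun z => Iff.rfl
  refine Within.seq (a := 0) (b := 4) hX (Within.setNat (Q := fun s' => s'.nat 42 0 = 0) hs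
    (Nat.zero_le _) setNat_nat_self) ?_ (by norm_num) (by norm_num)
  intro s₁ hs₁ hag₁ h42
  have hI₁ := hI.agree hag₁ (by decide) (by decide)
  have h27₁ : s₁.nat 27 = s.nat 27 := hag₁.nat 27 (by decide)
  refine Within.seq (a := 3) (b := 1) hX (Within.exists (c := 1) (fl := 42)
    (C := fun x => i * (m * D) + (w * D + x) ∈ T ∧ (w * D + x) * (m * D) + j ∈ T) hX hs₁ hD
    (by decide) (by decide)
    (fun s' h => (hI₁.agree h (by decide) (by decide)).eval_candidateCount) ?_) ?_
    (by norm_num) (by norm_num)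
  · intro x hx s₂ hs₂ hag₂ hx₂
    have hI₂ := hI₁.agree hag₂ (by decide) (by decide)
    have h27₂ : s₂.nat 27 = s.nat 27 := by rw [hag₂.nat 27 (by decide), h27₁]
    have e30 : s₂.nat 30 0 = i := by rw [hag₂.nat 30 (by decide), hag₁.nat 30 (by decide), hvi]
    have e31 : s₂.nat 31 0 = j := by rw [hag₂.nat 31 (by decide), hag₁.nat 31 (by decide), hvj]
    have e32 : s₂.nat 32 0 = w := by rw [hag₂.nat 32 (by decide), hag₁.nat 32 (by decide), hvw]
    refine setFlag_within hX hs₂ ?_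
    simp only [BoolExp.Holds, pairSetE, middleE, NatExp.eval, eval_reg, e30, e31, e32, hx₂,
      hI₂.eval_nodeCount, hI₂.eval_candidateCount, h27₂, hmem, ← hDdef]
    simp only [index_lt hi (node_lt hw hx), index_lt (node_lt hw hx) hj, true_and]
  · intro s₂ hs₂ hag₂ hex
    have hI₂ := hI₁.agree hag₂ (by decide) (by decide)
    have h27₂ : s₂.nat 27 = s.nat 27 := by rw [hag₂.nat 27 (by decide), h27₁]
    have e30 : s₂.nat 30 0 = i := by rw [hag₂.nat 30 (by decide), hag₁.nat 30 (by decide), hvi]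
    have e31 : s₂.nat 31 0 = j := by rw [hag₂.nat 31 (by decide), hag₁.nat 31 (by decide), hvj]
    have hsup : 1 ≤ s₂.nat 42 0 ↔ Supported D (m * D) T i j w := by
      refine ⟨fun h1 => ?_, fun h1 => by rw [hex.1 h1]⟩
      by_contra hC
      rw [hex.2 hC, h42] at h1; omega
    refine (storeFlag_within (i := i * (m * D) + j) (C := i * (m * D) + j ∈ T ∧
      Supported D (m * D) T i j w) hX hs₂ ?_ ?_).imp ?_
    · simp only [BoolExp.Holds, pairSetE, NatExp.eval, eval_reg, e30, e31, hsup,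
        hI₂.eval_nodeCount, h27₂, hmem, ← hDdef, index_lt hi hj, true_and]
    · simp only [pairIndexE, NatExp.eval, eval_reg, e30, e31, hI₂.eval_nodeCount, ← hDdef]
    · rintro s' - - ⟨k1, k2, k3⟩
      have hmem' : ∀ z, z ∈ tableSet (m * D) s' ↔ z ∈ T ∧
          (z = i * (m * D) + j → Supported D (m * D) T i j w) := by
        intro z
        by_cases hz : z = i * (m * D) + j
        · subst hz
          by_cases hC : i * (m * D) + j ∈ T ∧ Supported D (m * D) T i j w
          · simp [tableSet, k1 hC, index_lt hi hj, hC]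
          · have : i * (m * D) + j ∉ tableSet (m * D) s' := by simp [tableSet, k2 hC]
            tauto
        · have : z ∈ tableSet (m * D) s' ↔ z ∈ T := by
            rw [hmem, tableSet, Set.mem_ofPred_eq, k3 z hz, h27₂]
          tauto
      have hsub : tableSet (m * D) s' ⊆ T := fun z hz => ((hmem' z).1 hz).1
      refine ⟨hsub.trans h.subset, fun Z hZ hc z hz => (hmem' z).2 ⟨h.keep Z hZ hc hz, ?_⟩,
        fun heq a b c hd hab => ?_⟩
      -- A consistent subset of the table carries its own supports, so none of its pairs is ever
      -- deleted.
      · rintro rfl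
        exact (hc i hi j hj w hw hz).mono (h.keep Z hZ hc)
      -- Tables only shrink. If the result still equals the table at the start of the sweep, so did
      -- the table consulted here, and the support found is a support in `S`.
      · have hTS : T = S := subset_antisymm h.subset (heq ▸ hsub)
        rcases hd with hd | ⟨rfl, rfl, rfl⟩
        · exact h.supported hTS a b c hd hab
        · rw [← hTS]
          rw [← heq] at hab
          exact ((hmem' _).1 hab).2 rfl

/-- Deletions take effect at once, so a sweep may consult a changing table. A sweep that deletes
nothing has tested every triple against the same table, which proves consistency. -/
theorem sweep_within (hX : 4 ≤ X) (hs : BoundedState sz X s) (hI : InputState n m adj P s)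
    (hD : candidateCount n ≤ X) (hM : m * candidateCount n ≤ X) :
    Within sz X sweepProgram s 11 (fun s' =>
      let S := tableSet (m * candidateCount n) s
      let S' := tableSet (m * candidateCount n) s'
      S' ⊆ S ∧ (∀ Z ⊆ S, TableConsistent (candidateCount n) m Z → Z ⊆ S') ∧
        (S' = S → TableConsistent (candidateCount n) m S)) := by
  set D := candidateCount n with hDdef
  have hmX : m ≤ X := hs.nat 0 1 |>.trans' hI.nm.ge
  refine (Within.for (c := 9) (Inv := fun k => SweepInv D m (tableSet (m * D) s)
    (fun a b c => a < k ∧ b < m * D ∧ c < m)) hX hs hM (by decide)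
    (fun s' h => (hI.agree h (by decide) (by decide)).eval_nodeCount)
    (fun i s x h => h.congr (setNat_nat_of_ne (by norm_num)))
    ⟨subset_rfl, fun Z hZ _ => hZ, fun _ a b c h => by omega⟩ ?_).imp
    fun s' _ _ h => ⟨h.subset, h.keep, fun heq i hi j hj w hw =>
      h.supported heq i j w ⟨hi, hj, hw⟩⟩
  intro i hi s₁ hs₁ hag₁ hv₁ h₁
  have hI₁ := hI.agree hag₁ (by decide) (by decide)
  refine (Within.for (c := 7) (Inv := fun k => SweepInv D m (tableSet (m * D) s)
    (fun a b c => (a < i ∧ b < m * D ∧ c < m) ∨ (a = i ∧ b < k ∧ c < m))) hX hs₁ hM (by decide)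
    (fun s' h => (hI₁.agree h (by decide) (by decide)).eval_nodeCount)
    (fun i s x h => h.congr (setNat_nat_of_ne (by norm_num)))
    (h₁.mono fun a b c h => by omega) ?_).imp
    fun s' _ _ h => h.mono fun a b c h => by omega
  intro j hj s₂ hs₂ hag₂ hv₂ h₂
  have hI₂ := hI₁.agree hag₂ (by decide) (by decide)
  refine (Within.for (c := 5) (Inv := fun k => SweepInv D m (tableSet (m * D) s)
    (fun a b c => ((a < i ∧ b < m * D ∧ c < m) ∨ (a = i ∧ b < j ∧ c < m)) ∨
      (a = i ∧ b = j ∧ c < k))) hX hs₂ hmX (by decide)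
    (fun s' h => show nmE.eval s' = m from (hI₂.agree h (by decide) (by decide)).nm)
    (fun i s x h => h.congr (setNat_nat_of_ne (by norm_num)))
    (h₂.mono fun a b c h => by omega) ?_).imp
    fun s' _ _ h => h.mono fun a b c h => by omega
  intro w hw s₃ hs₃ hag₃ hv₃ h₃
  have hI₃ := hI₂.agree hag₃ (by decide) (by decide)
  refine (filterBody_within hX hs₃ hI₃ hD hi hj hw ?_ ?_ hv₃ h₃).imp
    fun s' _ _ h => h.mono fun a b c h => by omega
  · rw [hag₃.nat 30 (by decide), hag₂.nat 30 (by decide), hv₁]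
  · rw [hag₃.nat 31 (by decide), hv₂]

lemma finite_tableSet (M : ℕ) (s : RamState K) : (tableSet M s).Finite :=
  (Set.finite_lt_nat (M * M)).subset fun _ h => h.1

lemma ncard_tableSet_le (M : ℕ) (s : RamState K) : (tableSet M s).ncard ≤ M * M := by
  refine (Set.ncard_le_ncard (fun _ h => h.1) (Set.finite_lt_nat (M * M))).trans ?_
  rw [Set.ncard_eq_toFinset_card']
  simp

/-- Every sweep either starts from a consistent table, which it leaves alone, or deletes a pair, or
proves consistency. With at most `M * M` pairs, `M * M + 1` sweeps suffice without a test for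
changes. -/
theorem filter_within (hX : 4 ≤ X) (hs : BoundedState sz X s) (hI : InputState n m adj P s)
    (hD : candidateCount n ≤ X) (hM : m * candidateCount n ≤ X)
    (hMM : m * candidateCount n * (m * candidateCount n) + 1 ≤ X) :
    Within sz X filterProgram s 13 (fun s' =>
      let S := tableSet (m * candidateCount n) s
      let S' := tableSet (m * candidateCount n) s'
      S' ⊆ S ∧ (∀ Z ⊆ S, TableConsistent (candidateCount n) m Z → Z ⊆ S') ∧
        TableConsistent (candidateCount n) m S') := by
  set D := candidateCount n with hDdef
  refine (Within.for (c := 11) (Inv := fun k s' =>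
    tableSet (m * D) s' ⊆ tableSet (m * D) s ∧
    (∀ Z ⊆ tableSet (m * D) s, TableConsistent D m Z → Z ⊆ tableSet (m * D) s') ∧
    (TableConsistent D m (tableSet (m * D) s') ∨
      (tableSet (m * D) s').ncard + k ≤ m * D * (m * D))) hX hs hMM (by decide)
    (fun s' h => by
      simp only [NatExp.eval, (hI.agree h (by decide) (by decide)).eval_nodeCount, ← hDdef])
    (fun i s x h => by rwa [tableSet_congr (setNat_nat_of_ne (by norm_num))])
    ⟨subset_rfl, fun Z hZ _ => hZ, Or.inr (ncard_tableSet_le _ _)⟩ ?_).imp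
    fun s' _ _ h => ⟨h.1, h.2.1, h.2.2.resolve_right (by omega)⟩
  intro k hk s₁ hs₁ hag₁ hv₁ h₁
  have hI₁ := hI.agree hag₁ (by decide) (by decide)
  refine (sweep_within hX hs₁ hI₁ hD hM).imp ?_
  rintro s' - - ⟨h2, h3, h4⟩
  refine ⟨h2.trans h₁.1, fun Z hZ hc => h3 Z (h₁.2.1 Z hZ hc) hc, ?_⟩
  by_cases heq : tableSet (m * D) s' = tableSet (m * D) s₁
  · exact Or.inl (heq ▸ h4 heq)
  · rcases h₁.2.2 with hc | hc
    · exact absurd (subset_antisymm h2 (h3 _ subset_rfl hc)) heq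
    · right
      have : (tableSet (m * D) s').ncard < (tableSet (m * D) s₁).ncard :=
        Set.ncard_lt_ncard (lt_of_le_of_ne h2 heq) (finite_tableSet _ s₁)
      omega

theorem answer_within (hX : 4 ≤ X) (hs : BoundedState sz X s) (hI : InputState n m adj P s)
    (hMM : m * candidateCount n * (m * candidateCount n) + 1 ≤ X) :
    Within sz X answerProgram s 5 (fun s' =>
      ((tableSet (m * candidateCount n) s).Nonempty → s'.nat 0 2 = 1) ∧
      (¬ (tableSet (m * candidateCount n) s).Nonempty → s'.nat 0 2 = 0)) := by
  refine Within.seq (a := 0) (b := 4) hX (Within.setNat (Q := fun s' => s'.nat 43 0 = 0) hs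
    (Nat.zero_le _) setNat_nat_self) ?_ (by norm_num) (by norm_num)
  intro s₁ hs₁ hag₁ h43
  have hI₁ := hI.agree hag₁ (by decide) (by decide)
  have h27₁ : s₁.nat 27 = s.nat 27 := hag₁.nat 27 (by decide)
  refine Within.seq (a := 3) (b := 0) hX (Within.exists (c := 1) (fl := 43) (C := fun z => 1 ≤ s.nat 27 z)
    (n := m * candidateCount n * (m * candidateCount n)) hX hs₁ (by omega)
    (by decide) (by decide)
    (fun s' h => by
      simp only [NatExp.eval, (hI₁.agree h (by decide) (by decide)).eval_nodeCount]) ?_) ?_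
    (by norm_num) (by norm_num)
  · intro z hz s₂ hs₂ hag₂ hz₂
    refine setFlag_within hX hs₂ ?_
    simp only [BoolExp.Holds, NatExp.eval, eval_reg, hz₂, hag₂.nat 27 (by decide), h27₁]
  · intro s₂ hs₂ hag₂ hex
    rw [h43] at hex
    refine Within.setNat hs₂ ?_ ?_
    · rw [eval_reg]; exact hs₂.nat _ _
    · simp only [NatExp.eval, setNat_nat_self, eval_reg]
      exact hex

/-- The program computes the largest consistent part of the table of compatible pairs. -/
theorem drawing_within (hX : 4 ≤ X) (hs : BoundedState sz X s) (hI : InputState n m adj P s)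
    (hn : n * n * n ≤ X) (hV : vertexCount n ≤ X) (hVV : vertexCount n * vertexCount n ≤ X)
    (hD : candidateCount n ≤ X) (hM : m * candidateCount n ≤ X)
    (hMM : m * candidateCount n * (m * candidateCount n) + 1 ≤ X)
    (hv : ∀ c < vertexCount n, sz (vertexAt n P c).1 ≤ X ∧ sz (vertexAt n P c).2 ≤ X)
    (hc : ∀ c < candidateCount n, sz (candidateAt n P c).1 ≤ X ∧ sz (candidateAt n P c).2 ≤ X) :
    Within sz X drawingProgram s 17 (fun s' => ∃ S T : Set ℕ,
      (∀ z ∈ S, z < m * candidateCount n * (m * candidateCount n)) ∧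
      (∀ i < m * candidateCount n, ∀ j < m * candidateCount n,
        i * (m * candidateCount n) + j ∈ S ↔ PairAt n adj P i j) ∧ T ⊆ S ∧
      (∀ Z ⊆ S, TableConsistent (candidateCount n) m Z → Z ⊆ T) ∧
      TableConsistent (candidateCount n) m T ∧
      (T.Nonempty → s'.nat 0 2 = 1) ∧ (¬ T.Nonempty → s'.nat 0 2 = 0)) := by
  have hmX : m ≤ X := hs.nat 0 1 |>.trans' hI.nm.ge
  refine Within.seq (a := 8) (b := 16) hX (prepare_within hX hs hI hn hV hVV hD hmX hv hc) ?_
    (by norm_num) (by norm_num)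
  intro s₁ hs₁ hag₁ hN₁
  refine Within.seq (a := 11) (b := 15) hX (valid_within hX hs₁ hN₁ hM) ?_
    (by norm_num) (by norm_num)
  intro s₂ hs₂ hag₂ h26
  have hN₂ := hN₁.agree hag₂ (by decide) (by decide)
  refine Within.seq (a := 11) (b := 14) hX (pair_within hX hs₂ hN₂ hM h26) ?_
    (by norm_num) (by norm_num)
  intro s₃ hs₃ hag₃ h27
  have hN₃ := hN₂.agree hag₃ (by decide) (by decide)
  refine Within.seq (a := 13) (b := 5) hX (filter_within hX hs₃ hN₃.toInputState hD hM hMM) ?_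
    (by norm_num) (by norm_num)
  intro s₄ hs₄ hag₄ h4
  have hN₄ := hN₃.agree hag₄ (by decide) (by decide)
  refine (answer_within hX hs₄ hN₄.toInputState hMM).imp fun s' _ _ h => ?_
  exact ⟨tableSet _ s₃, tableSet _ s₄, fun z hz => hz.1, h27, h4.1, h4.2.1, h4.2.2, h.1, h.2⟩

end Sweeps

/-! ## Sizes of the computed numbers -/

section Sizes

variable {K : Type} [Field K] {sz : K → ℕ} {N : ℕ}

/-- Each field operation raises the exponent of the size bound by `3`, because the left side is at
most `8` times the common bound. -/
lemma two_mul_add_le_pow (hN : 2 ≤ N) {a b k : ℕ} (ha : a ≤ N ^ k) (hb : b ≤ N ^ k) :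
    2 * (a + b) + 2 ≤ N ^ (k + 3) := by
  have h1 : 2 ^ 3 ≤ N ^ 3 := Nat.pow_le_pow_left hN 3
  have h2 : 1 ≤ N ^ k := Nat.one_le_pow _ _ (by omega)
  calc 2 * (a + b) + 2 ≤ N ^ k * 2 ^ 3 := by omega
    _ ≤ N ^ k * N ^ 3 := Nat.mul_le_mul_left _ h1
    _ = N ^ (k + 3) := (pow_add _ _ _).symm

variable {k : ℕ}

/-- Both coordinates have size at most `B`. -/
def PointSizeLe {K : Type} (sz : K → ℕ) (B : ℕ) (p : K × K) : Prop := sz p.1 ≤ B ∧ sz p.2 ≤ B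

lemma size_orient_le (hN : 2 ≤ N) (hsz : SizeBound sz) {p q r : K × K}
    (hp : PointSizeLe sz (N ^ k) p) (hq : PointSizeLe sz (N ^ k) q)
    (hr : PointSizeLe sz (N ^ k) r) : sz (orient p q r) ≤ N ^ (k + 9) := by
  have h : ∀ {a b}, sz a ≤ N ^ k → sz b ≤ N ^ k → sz (a - b) ≤ N ^ (k + 3) := fun ha hb =>
    (hsz.sub _ _).trans (two_mul_add_le_pow hN ha hb)
  have h' : ∀ {a b}, sz a ≤ N ^ (k + 3) → sz b ≤ N ^ (k + 3) → sz (a * b) ≤ N ^ (k + 6) :=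
    fun ha hb => (hsz.mul _ _).trans (two_mul_add_le_pow hN ha hb)
  exact (hsz.sub _ _).trans (two_mul_add_le_pow hN (h' (h hq.1 hp.1) (h hr.2 hp.2))
    (h' (h hq.2 hp.2) (h hr.1 hp.1)))

lemma pointSize_lineInter_le (hN : 2 ≤ N) (hsz : SizeBound sz) {a b c d : K × K}
    (ha : PointSizeLe sz (N ^ k) a) (hb : PointSizeLe sz (N ^ k) b)
    (hc : PointSizeLe sz (N ^ k) c) (hd : PointSizeLe sz (N ^ k) d) :
    PointSizeLe sz (N ^ (k + 21)) (lineInter a b c d) := by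
  have ho1 := size_orient_le hN hsz hc hd ha
  have ho2 := size_orient_le hN hsz hc hd hb
  have hq : sz (orient c d a / (orient c d a - orient c d b)) ≤ N ^ (k + 15) :=
    (hsz.div _ _).trans (two_mul_add_le_pow hN (ho1.trans (Nat.pow_le_pow_right (by omega)
      (by omega))) ((hsz.sub _ _).trans (two_mul_add_le_pow hN ho1 ho2)))
  have key : ∀ {x y : K}, sz x ≤ N ^ k → sz y ≤ N ^ k →
      sz (x + orient c d a / (orient c d a - orient c d b) * (y - x)) ≤ N ^ (k + 21) := by
    intro x y hx hy
    refine (hsz.add _ _).trans (two_mul_add_le_pow (k := k + 18) hN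
      (hx.trans (Nat.pow_le_pow_right (by omega) (by omega))) ?_)
    refine (hsz.mul _ _).trans (two_mul_add_le_pow (k := k + 15) hN hq ?_)
    exact ((hsz.sub _ _).trans (two_mul_add_le_pow hN hy hx)).trans
      (Nat.pow_le_pow_right (by omega) (by omega))
  exact ⟨key ha.1 hb.1, key ha.2 hb.2⟩

lemma pointSize_centroid3_le (hN : 2 ≤ N) (hsz : SizeBound sz) {a b c : K × K}
    (ha : PointSizeLe sz (N ^ k) a) (hb : PointSizeLe sz (N ^ k) b)
    (hc : PointSizeLe sz (N ^ k) c) : PointSizeLe sz (N ^ (k + 9)) (centroid3 a b c) := by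
  have h3 : sz (3 : K) ≤ N ^ (k + 6) := by
    have h1 := hsz.natCast 3
    rw [Nat.cast_ofNat] at h1
    have h2 : 2 ^ 3 ≤ N ^ 3 := Nat.pow_le_pow_left hN 3
    have h3 : N ^ 3 ≤ N ^ (k + 6) := Nat.pow_le_pow_right (by omega) (by omega)
    omega
  have key : ∀ {x y z : K}, sz x ≤ N ^ k → sz y ≤ N ^ k → sz z ≤ N ^ k →
      sz ((x + y + z) / 3) ≤ N ^ (k + 9) := by
    intro x y z hx hy hz
    refine (hsz.div _ _).trans (two_mul_add_le_pow (k := k + 6) hN ?_ h3)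
    refine (hsz.add _ _).trans (two_mul_add_le_pow (k := k + 3) hN ?_
      (hz.trans (Nat.pow_le_pow_right (by omega) (by omega))))
    exact (hsz.add _ _).trans (two_mul_add_le_pow hN hx hy)
  exact ⟨key ha.1 hb.1 hc.1, key ha.2 hb.2 hc.2⟩

lemma pointSize_vertexAt_le {n : ℕ} {P : ℕ → K × K} (hN : 2 ≤ N) (hsz : SizeBound sz)
    (hP : ∀ i, PointSizeLe sz (N ^ 1) (P i)) (c : ℕ) : PointSizeLe sz (N ^ 22) (vertexAt n P c) :=
  pointSize_lineInter_le hN hsz (hP _) (hP _) (hP _) (hP _)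

lemma pointSize_candidateAt_le {n : ℕ} {P : ℕ → K × K} (hN : 2 ≤ N) (hsz : SizeBound sz)
    (hP : ∀ i, PointSizeLe sz (N ^ 1) (P i)) (c : ℕ) :
    PointSizeLe sz (N ^ 31) (candidateAt n P c) :=
  pointSize_centroid3_le hN hsz (pointSize_vertexAt_le hN hsz hP _)
    (pointSize_vertexAt_le hN hsz hP _) (pointSize_vertexAt_le hN hsz hP _)

end Sizes

lemma vertexCount_le_pow {n N : ℕ} (h : n ≤ N) : vertexCount n ≤ N ^ 4 := by
  calc vertexCount n = n ^ 4 := by rw [vertexCount]; ring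
    _ ≤ N ^ 4 := Nat.pow_le_pow_left h 4

lemma candidateCount_le_pow {n N : ℕ} (h : n ≤ N) : candidateCount n ≤ N ^ 12 := by
  calc candidateCount n = n ^ 12 := by rw [candidateCount, vertexCount]; ring
    _ ≤ N ^ 12 := Nat.pow_le_pow_left h 12

lemma nodeCount_le_pow {n m N : ℕ} (h : n ≤ N) (hm : m ≤ N) :
    m * candidateCount n ≤ N ^ 13 := by
  calc m * candidateCount n ≤ N * N ^ 12 := Nat.mul_le_mul hm (candidateCount_le_pow h)
    _ = N ^ 13 := by ring

/-- The running time of the program in terms of a bound for the input. -/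
theorem exists_exponent_drawingProgram {K : Type} [Field K] [LinearOrder K] {sz : K → ℕ}
    (hsz : SizeBound sz) : ∃ k : ℕ, ∀ (I : FMBigraph K) (N : ℕ), 2 ≤ N → I.nf ≤ N → I.nm ≤ N →
      (∀ i, PointSizeLe sz N (I.loc i)) →
      ∃ (s' : RamState K) (t : ℕ) (S T : Set ℕ), Runs sz drawingProgram I.input s' t ∧ t ≤ N ^ k ∧
        (∀ z ∈ S, z < I.nm * candidateCount I.nf * (I.nm * candidateCount I.nf)) ∧
        (∀ i < I.nm * candidateCount I.nf, ∀ j < I.nm * candidateCount I.nf,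
          i * (I.nm * candidateCount I.nf) + j ∈ S ↔ PairAt I.nf (I.input.nat 1)
            (fun i => (I.input.num 0 i, I.input.num 1 i)) i j) ∧ T ⊆ S ∧
        (∀ Z ⊆ S, TableConsistent (candidateCount I.nf) I.nm Z → Z ⊆ T) ∧
        TableConsistent (candidateCount I.nf) I.nm T ∧
        (T.Nonempty → s'.nat 0 2 = 1) ∧ (¬ T.Nonempty → s'.nat 0 2 = 0) := by
  obtain ⟨k, hk⟩ := exists_stepCostLe hsz drawingProgram
  -- Memories are bounded by `N ^ 40`, which exceeds all quantities needed: `N ^ 31` for candidate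
  -- coordinates and `N ^ 27` for the number of pairs plus one. The `17` is the exponent in
  -- `drawing_within`, and `k` that of the price per step.
  refine ⟨40 * 17 + 40 * k, fun I N hN hnf hnm hloc => ?_⟩
  have hpow : ∀ {l x : ℕ}, x ≤ N ^ l → l ≤ 40 → x ≤ N ^ 40 := fun h hl =>
    h.trans (Nat.pow_le_pow_right (by omega) hl)
  have hpow1 : ∀ {x : ℕ}, x ≤ N → x ≤ N ^ 40 := fun h => hpow (l := 1) (by simpa) (by norm_num)
  have h0 : sz (0 : K) ≤ N := by
    have := hsz.natCast 0
    rw [Nat.cast_zero] at this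
    omega
  have hnum : ∀ a i, sz (I.input.num a i) ≤ N := by
    intro a i
    simp only [FMBigraph.input]
    split_ifs
    · exact (hloc _).1
    · exact (hloc _).2
    · exact h0
    · exact h0
  have hs : BoundedState sz (N ^ 40) I.input := by
    refine ⟨fun a i => hpow1 ?_, fun a i => hpow1 (hnum a i)⟩
    simp only [FMBigraph.input]
    split_ifs <;> omega
  have hI : InputState I.nf I.nm (I.input.nat 1)
      (fun i => (I.input.num 0 i, I.input.num 1 i)) I.input :=
    ⟨by simp [FMBigraph.input], by simp [FMBigraph.input], rfl, fun _ => rfl⟩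
  have hP : ∀ i, PointSizeLe sz (N ^ 1) (I.input.num 0 i, I.input.num 1 i) := fun i => by
    rw [pow_one]; exact ⟨hnum 0 i, hnum 1 i⟩
  have hX : 2 ^ 40 ≤ N ^ 40 := Nat.pow_le_pow_left hN 40
  have hM := nodeCount_le_pow hnf hnm
  obtain ⟨s', st, hrun, hst, S, T, h⟩ := drawing_within (sz := sz) (X := N ^ 40) (by omega) hs hI
    (hpow (l := 3) (by
      calc I.nf * I.nf * I.nf = I.nf ^ 3 := by ring
        _ ≤ N ^ 3 := Nat.pow_le_pow_left hnf 3) (by norm_num))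
    (hpow (vertexCount_le_pow hnf) (by norm_num))
    (hpow (l := 8) (by
      calc vertexCount I.nf * vertexCount I.nf ≤ N ^ 4 * N ^ 4 :=
            Nat.mul_le_mul (vertexCount_le_pow hnf) (vertexCount_le_pow hnf)
        _ = N ^ 8 := by ring) (by norm_num))
    (hpow (candidateCount_le_pow hnf) (by norm_num)) (hpow hM (by norm_num))
    (hpow (l := 27) (by
      have h1 : 1 ≤ N ^ 26 := Nat.one_le_pow _ _ (by omega)
      calc _ ≤ N ^ 13 * N ^ 13 + 1 := Nat.add_le_add_right (Nat.mul_le_mul hM hM) 1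
        _ = N ^ 26 + 1 := by ring
        _ ≤ N ^ 26 * 2 := by omega
        _ ≤ N ^ 26 * N := Nat.mul_le_mul_left _ hN
        _ = N ^ 27 := by ring) (by norm_num))
    (fun c _ => ⟨hpow (pointSize_vertexAt_le hN hsz hP c).1 (by norm_num),
      hpow (pointSize_vertexAt_le hN hsz hP c).2 (by norm_num)⟩)
    (fun c _ => ⟨hpow (pointSize_candidateAt_le hN hsz hP c).1 (by norm_num),
      hpow (pointSize_candidateAt_le hN hsz hP c).2 (by norm_num)⟩)
  obtain ⟨t, hruns, ht⟩ := hrun.exists_runs (hk (N ^ 40) (by omega))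
  refine ⟨s', t, S, T, hruns, ?_, h⟩
  calc t ≤ st * (N ^ 40) ^ k := ht
    _ ≤ (N ^ 40) ^ 17 * (N ^ 40) ^ k := Nat.mul_le_mul_right _ hst
    _ = N ^ (40 * 17 + 40 * k) := by rw [← pow_mul, ← pow_mul, ← pow_add]

lemma sizeBound_zero : SizeBound (fun _ : ℝ => 0) := by
  constructor <;> intros <;> simp

lemma size_mul_le (a b : ℕ) : (a * b).size ≤ a.size + b.size := by
  rw [Nat.size_le, pow_add]
  exact Nat.mul_lt_mul'' (Nat.lt_size_self a) (Nat.lt_size_self b)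

lemma size_add_le (a b : ℕ) : (a + b).size ≤ a.size + b.size + 1 := by
  rw [Nat.size_le]
  have h1 := Nat.lt_size_self a
  have h2 := Nat.lt_size_self b
  have h3 : 2 ^ a.size ≤ 2 ^ (a.size + b.size) := Nat.pow_le_pow_right (by norm_num) (by omega)
  have h4 : 2 ^ b.size ≤ 2 ^ (a.size + b.size) := Nat.pow_le_pow_right (by norm_num) (by omega)
  rw [pow_succ]
  omega

/-- Reducing a fraction only shrinks its numerator and denominator. -/
lemma ratSize_divInt_le (a b : ℤ) (hb : b ≠ 0) :
    ratSize (Rat.divInt a b) ≤ a.natAbs.size + b.natAbs.size := by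
  have hn : (Rat.divInt a b).num.natAbs ≤ a.natAbs := by
    rcases eq_or_ne a 0 with rfl | ha
    · simp
    · exact Nat.le_of_dvd (Int.natAbs_pos.2 ha)
        (Int.natAbs_dvd_natAbs.2 (Rat.num_dvd a hb))
  have hd : (Rat.divInt a b).den ≤ b.natAbs :=
    Nat.le_of_dvd (Int.natAbs_pos.2 hb) (Int.natCast_dvd.1 (Rat.den_dvd a b))
  exact Nat.add_le_add (Nat.size_le_size hn) (Nat.size_le_size hd)

lemma sizeBound_ratSize : SizeBound ratSize := by
  have hden : ∀ x : ℚ, (x.den : ℤ) ≠ 0 := fun x => by exact_mod_cast x.den_nz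
  have hadd : ∀ x y, ratSize (x + y) ≤ 2 * (ratSize x + ratSize y) + 2 := by
    intro x y
    have e : x + y = Rat.divInt (x.num * y.den + y.num * x.den) (x.den * y.den) := by
      rw [← Rat.divInt_add_divInt _ _ (hden x) (hden y), Rat.num_divInt_den, Rat.num_divInt_den]
    have h := ratSize_divInt_le (x.num * y.den + y.num * x.den) (x.den * y.den)
      (mul_ne_zero (hden x) (hden y))
    rw [← e, Int.natAbs_mul, Int.natAbs_natCast, Int.natAbs_natCast] at h
    have h1 := Nat.size_le_size (Int.natAbs_add_le (x.num * y.den) (y.num * x.den))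
    rw [Int.natAbs_mul, Int.natAbs_mul, Int.natAbs_natCast, Int.natAbs_natCast] at h1
    have h2 := size_add_le (x.num.natAbs * y.den) (y.num.natAbs * x.den)
    have h3 := size_mul_le x.num.natAbs y.den
    have h4 := size_mul_le y.num.natAbs x.den
    have h5 := size_mul_le x.den y.den
    simp only [ratSize] at h ⊢
    omega
  refine ⟨fun n => ?_, hadd, fun x y => ?_, fun x y => ?_, fun x y => ?_⟩
  · have h1 : n.size ≤ n := Nat.size_le.2 Nat.lt_two_pow_self
    simp only [ratSize, Rat.num_natCast, Rat.den_natCast, Int.natAbs_natCast, Nat.size_one]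
    omega
  · rw [sub_eq_add_neg]
    exact (hadd x (-y)).trans (by simp [ratSize])
  · have e : x * y = Rat.divInt (x.num * y.num) (x.den * y.den) := by
      rw [← Rat.divInt_mul_divInt, Rat.num_divInt_den, Rat.num_divInt_den]
    have h := ratSize_divInt_le (x.num * y.num) (x.den * y.den) (mul_ne_zero (hden x) (hden y))
    rw [← e, Int.natAbs_mul, Int.natAbs_mul, Int.natAbs_natCast, Int.natAbs_natCast] at h
    have h3 := size_mul_le x.num.natAbs y.num.natAbs
    have h5 := size_mul_le x.den y.den
    simp only [ratSize] at h ⊢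
    omega
  · rcases eq_or_ne y 0 with rfl | hy
    · simp [ratSize]
    have e : x / y = Rat.divInt (x.num * y.den) (x.den * y.num) := by
      rw [← Rat.divInt_mul_divInt, Rat.num_divInt_den, ← Rat.inv_def, div_eq_mul_inv]
    have h := ratSize_divInt_le (x.num * y.den) (x.den * y.num)
      (mul_ne_zero (hden x) (Rat.num_ne_zero.2 hy))
    rw [← e, Int.natAbs_mul, Int.natAbs_mul, Int.natAbs_natCast, Int.natAbs_natCast] at h
    have h3 := size_mul_le x.num.natAbs y.den
    have h5 := size_mul_le x.den y.num.natAbs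
    simp only [ratSize] at h ⊢
    omega

/-! ## Correctness -/

/-! ### Transfer to ℝ along an ordered embedding, and correctness of the answer. -/

section Transfer

set_option linter.unusedSectionVars false

variable {K : Type} [Field K] [LinearOrder K] {f : K →+* ℝ}

lemma map_orient (f : K →+* ℝ) (p q r : K × K) :
    orient (Prod.map f f p) (Prod.map f f q) (Prod.map f f r) = f (orient p q r) := by
  simp [orient]

lemma map_dotAt (f : K →+* ℝ) (p q r : K × K) :
    dotAt (Prod.map f f p) (Prod.map f f q) (Prod.map f f r) = f (dotAt p q r) := by
  simp [dotAt]

lemma map_lineInter (f : K →+* ℝ) (a b c d : K × K) :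
    Prod.map f f (lineInter a b c d) =
      lineInter (Prod.map f f a) (Prod.map f f b) (Prod.map f f c) (Prod.map f f d) := by
  simp [lineInter, map_orient]

lemma map_centroid3 (f : K →+* ℝ) (p q r : K × K) :
    Prod.map f f (centroid3 p q r) =
      centroid3 (Prod.map f f p) (Prod.map f f q) (Prod.map f f r) := by
  simp [centroid3, map_ofNat f 3]

lemma pos_map_iff (hf : StrictMono f) (x : K) : 0 < f x ↔ 0 < x := by
  rw [← map_zero f, hf.lt_iff_lt]

lemma map_inTriangle (hf : StrictMono f) (a b c p : K × K) :
    InTriangle (Prod.map f f a) (Prod.map f f b) (Prod.map f f c) (Prod.map f f p) ↔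
      InTriangle a b c p := by
  simp only [InTriangle, map_orient, pos_map_iff hf]

lemma map_separated (hf : StrictMono f) (p a q b : K × K) :
    Separated (Prod.map f f p) (Prod.map f f a) (Prod.map f f q) (Prod.map f f b) ↔
      Separated p a q b := by
  simp only [Separated, map_orient, ← map_mul, pos_map_iff hf]

/-- The image of an FM-bigraph under an embedding of its field of coordinates. -/
def FMBigraph.map (I : FMBigraph K) (f : K →+* ℝ) : FMBigraph ℝ where
  nf := I.nf
  nm := I.nm
  nbr := I.nbr
  loc i := Prod.map f f (I.loc i)
  loc_injective := (f.injective.prodMap f.injective).comp I.loc_injective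

/-- The points in the memory. -/
def FMBigraph.inputPoint (I : FMBigraph K) (i : ℕ) : K × K := (I.input.num 0 i, I.input.num 1 i)

lemma FMBigraph.inputPoint_fin (I : FMBigraph K) (i : Fin I.nf) : I.inputPoint i = I.loc i := by
  simp [inputPoint, input]

lemma FMBigraph.isNbr_iff (I : FMBigraph K) (u : Fin I.nm) (a : Fin I.nf) :
    IsNbr I.nf (I.input.nat 1) u a ↔ a ∈ I.nbr u := by
  have h : ∀ (m : Fin I.nm) (f : Fin I.nf), (u : ℕ) * I.nf + a = m * I.nf + f → m = u ∧ f = a := by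
    intro m f h
    have hn : 0 < I.nf := a.pos
    have h1 : ((u : ℕ) * I.nf + a) / I.nf = u := by
      rw [mul_comm, Nat.mul_add_div hn, Nat.div_eq_of_lt a.2]; rfl
    have h2 : ((m : ℕ) * I.nf + f) / I.nf = m := by
      rw [mul_comm, Nat.mul_add_div hn, Nat.div_eq_of_lt f.2]; rfl
    have h3 : (u : ℕ) = m := by rw [← h1, h, h2]
    rw [h3] at h
    exact ⟨Fin.ext h3.symm, Fin.ext (by omega)⟩
  simp only [IsNbr, input]
  rw [if_neg (by simp), if_neg (by simp)]
  split_ifs with c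
  · obtain ⟨-, m, f, hf, e⟩ := c
    obtain ⟨rfl, rfl⟩ := h m f e
    simpa using hf
  · simp only [true_and] at c
    refine iff_of_false (by norm_num) fun ha => c ⟨u, a, ha, rfl⟩

lemma FMBigraph.validAt_iff (I : FMBigraph K) (hf : StrictMono f) (u : Fin I.nm) (p : K × K) :
    ValidAt I.nf (I.input.nat 1) I.inputPoint u p ↔
      ValidCentre (I.map f).loc (I.nbr u) (Prod.map f f p) := by
  have hinj : Function.Injective (Prod.map f f) := f.injective.prodMap f.injective
  have hz : ∀ x : K, f x ≠ 0 ↔ x ≠ 0 := fun x => map_ne_zero f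
  refine and_congr ⟨?_, ?_⟩ ⟨?_, ?_⟩
  · rintro ⟨a, ha, b, hb, c, hc, h1, h2, h3, h⟩
    lift a to Fin I.nf using ha
    lift b to Fin I.nf using hb
    lift c to Fin I.nf using hc
    rw [I.isNbr_iff] at h1 h2 h3
    refine ⟨a, h1, b, h2, c, h3, ?_⟩
    simp only [FMBigraph.inputPoint_fin] at h
    simp only [FMBigraph.map, map_inTriangle hf, ← map_centroid3, hinj.eq_iff]
    exact h.imp_right fun h => ⟨fun hab => h.1 (congrArg _ hab), h.2⟩
  · rintro ⟨(a : Fin I.nf), h1, (b : Fin I.nf), h2, (c : Fin I.nf), h3, h⟩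
    simp only [FMBigraph.map, map_inTriangle hf, ← map_centroid3, hinj.eq_iff] at h
    refine ⟨a, a.2, b, b.2, c, c.2, (I.isNbr_iff u a).2 h1, (I.isNbr_iff u b).2 h2,
      (I.isNbr_iff u c).2 h3, ?_⟩
    simp only [FMBigraph.inputPoint_fin]
    exact h.imp_right fun h => ⟨fun hab => h.1 (Fin.ext hab), h.2⟩
  · intro h (c : Fin I.nf) hc (g : Fin I.nf) hg
    simp only [FMBigraph.map, map_orient, map_dotAt, hz, pos_map_iff hf]
    by_contra hcon
    push Not at hcon
    refine h ⟨c, c.2, g, g.2, (I.isNbr_iff u c).2 hc, fun h => hg (Fin.ext h), ?_⟩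
    simp only [FMBigraph.inputPoint_fin]
    exact hcon
  · rintro h ⟨c, hc, g, hg, h1, h2, h3, h4⟩
    lift c to Fin I.nf using hc
    lift g to Fin I.nf using hg
    rw [I.isNbr_iff] at h1
    have := h c h1 g (fun h => h2 (congrArg _ h))
    simp only [FMBigraph.map, map_orient, map_dotAt, hz, pos_map_iff hf] at this
    simp only [FMBigraph.inputPoint_fin] at h3 h4
    rcases this with h | h
    · exact h h3
    · exact absurd h (not_lt.2 h4)

lemma FMBigraph.not_conflictAt_iff (I : FMBigraph K) (hf : StrictMono f) (u w : Fin I.nm)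
    (p q : K × K) : ¬ ConflictAt I.nf (I.input.nat 1) I.inputPoint u p w q ↔
      CompatibleCentres (I.map f).loc (I.nbr u) (Prod.map f f p) (I.nbr w) (Prod.map f f q) := by
  simp only [CompatibleCentres, FMBigraph.map, map_separated hf]
  constructor
  · intro h a ha b hb hab
    by_contra hcon
    refine h ⟨a, a.2, b, b.2, (I.isNbr_iff u a).2 ha, (I.isNbr_iff w b).2 hb,
      fun h => hab (Fin.ext h), ?_⟩
    simpa only [FMBigraph.inputPoint_fin] using hcon
  · rintro h ⟨a, ha, b, hb, h1, h2, h3, h4⟩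
    lift a to Fin I.nf using ha
    lift b to Fin I.nf using hb
    rw [I.isNbr_iff] at h1 h2
    simp only [FMBigraph.inputPoint_fin] at h4
    exact h4 (h a h1 b h2 fun h => h3 (congrArg _ h))

/-- Used repeatedly to encode four fixed vertices as a vertex index, and three such indices as a
candidate index. -/
lemma exists_digits {N q r : ℕ} {Q : ℕ} (hq : q < Q) (hr : r < N) :
    ∃ e < Q * N, e / N = q ∧ e % N = r := by
  refine ⟨q * N + r, ?_, ?_, ?_⟩
  · calc q * N + r < q * N + N := by omega
      _ = (q + 1) * N := by ring
      _ ≤ Q * N := Nat.mul_le_mul_right _ hq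
  · rw [mul_comm, Nat.mul_add_div (by omega), Nat.div_eq_of_lt hr]; rfl
  · rw [mul_comm, Nat.mul_add_mod, Nat.mod_eq_of_lt hr]

lemma FMBigraph.exists_vertexAt (I : FMBigraph K) {z : ℝ × ℝ}
    (h : IsVertexPoint (I.map f).loc z) :
    ∃ e < vertexCount I.nf, Prod.map f f (vertexAt I.nf I.inputPoint e) = z := by
  obtain ⟨(a : Fin I.nf), (b : Fin I.nf), (c : Fin I.nf), (d : Fin I.nf), rfl⟩ := h
  obtain ⟨e₁, h1, h1a, h1b⟩ := exists_digits a.2 b.2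
  obtain ⟨e₂, h2, h2a, h2b⟩ := exists_digits h1 c.2
  obtain ⟨e₃, h3, h3a, h3b⟩ := exists_digits h2 d.2
  refine ⟨e₃, h3, ?_⟩
  simp only [vertexAt, map_lineInter, h3a, h3b, h2a, h2b, h1a, h1b, FMBigraph.inputPoint_fin]
  rfl

lemma FMBigraph.exists_candidateAt (I : FMBigraph K) {z : ℝ × ℝ}
    (h : IsCandidate (I.map f).loc z) :
    ∃ e < candidateCount I.nf, Prod.map f f (candidateAt I.nf I.inputPoint e) = z := by
  obtain ⟨u, v, w, hu, hv, hw, rfl⟩ := h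
  obtain ⟨a, ha, rfl⟩ := I.exists_vertexAt hu
  obtain ⟨b, hb, rfl⟩ := I.exists_vertexAt hv
  obtain ⟨c, hc, rfl⟩ := I.exists_vertexAt hw
  obtain ⟨e₁, h1, h1a, h1b⟩ := exists_digits ha hb
  obtain ⟨e₂, h2, h2a, h2b⟩ := exists_digits h1 hc
  refine ⟨e₂, h2, ?_⟩
  simp only [candidateAt, map_centroid3, h2a, h2b, h1a, h1b]

lemma node_div {D w x : ℕ} (hx : x < D) : (w * D + x) / D = w := by
  rw [mul_comm, Nat.mul_add_div (by omega), Nat.div_eq_of_lt hx]; rfl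

lemma node_mod {D w x : ℕ} (hx : x < D) : (w * D + x) % D = x := by
  rw [mul_comm, Nat.mul_add_mod, Nat.mod_eq_of_lt hx]

/-- The largest consistent part of the table of compatible pairs decides the drawing problem. -/
theorem FMBigraph.nonempty_iff_hasPlanarConvexHullDrawing (I : FMBigraph K) (hf : StrictMono f)
    (hgp : (I.map f).InGeneralPosition) (hcactus : IsCactus (I.map f).chGraph) {S T : Set ℕ}
    (hSlt : ∀ z ∈ S, z < I.nm * candidateCount I.nf * (I.nm * candidateCount I.nf))
    (hS : ∀ i < I.nm * candidateCount I.nf, ∀ j < I.nm * candidateCount I.nf,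
      i * (I.nm * candidateCount I.nf) + j ∈ S ↔ PairAt I.nf (I.input.nat 1) I.inputPoint i j)
    (hTS : T ⊆ S) (hmax : ∀ Z ⊆ S, TableConsistent (candidateCount I.nf) I.nm Z → Z ⊆ T)
    (hT : TableConsistent (candidateCount I.nf) I.nm T) :
    T.Nonempty ↔ (I.map f).HasPlanarConvexHullDrawing := by
  set D := candidateCount I.nf with hDdef
  set M := I.nm * D with hM
  set cand : ℕ → ℝ × ℝ := fun x => Prod.map f f (candidateAt I.nf I.inputPoint x) with hcand
  have hnode : ∀ (u : Fin I.nm) (x : ℕ), x < D → (u : ℕ) * D + x < M := fun u x hx =>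
    node_lt u.2 hx
  have hpair : ∀ (u w : Fin I.nm) (x y : ℕ), x < D → y < D →
      (((u : ℕ) * D + x) * M + ((w : ℕ) * D + y) ∈ S ↔
        ValidCentre (I.map f).loc (I.nbr u) (cand x) ∧
        ValidCentre (I.map f).loc (I.nbr w) (cand y) ∧ ((u = w ∧ x = y) ∨ (u ≠ w ∧
          CompatibleCentres (I.map f).loc (I.nbr u) (cand x) (I.nbr w) (cand y)))) := by
    intro u w x y hx hy
    rw [hS _ (hnode u x hx) _ (hnode w y hy)]
    simp only [PairAt, ValidNode, ← hDdef, node_div hx, node_mod hx, node_div hy, node_mod hy,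
      I.validAt_iff hf, I.not_conflictAt_iff hf]
    have e1 : ((u : ℕ) * D + x = w * D + y) ↔ (u = w ∧ x = y) := by
      constructor
      · intro h
        have h1 : (u : ℕ) = w := by rw [← node_div (w := u) hx, h, node_div hy]
        exact ⟨Fin.ext h1, by rw [h1] at h; omega⟩
      · rintro ⟨rfl, rfl⟩; rfl
    rw [e1, Fin.val_ne_iff]
  constructor
  · intro hne
    have := hcactus.1.nonempty
    -- Symmetry of `T` is not needed: along each edge the solution satisfies the relation in one of
    -- the two orders, and either one yields compatibility.
    let R : Fin I.nm → Fin I.nm → Fin D → Fin D → Prop := fun u v x y =>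
      ((u : ℕ) * D + x) * M + ((v : ℕ) * D + y) ∈ T
    have hdiag : ∀ u x y, R u u x y → x = y := by
      intro u x y h
      have := ((hpair u u _ _ x.2 y.2).1 (hTS h)).2.2
      rcases this with h | h
      · exact Fin.ext h.2
      · exact absurd rfl h.1
    have hpc : ∀ u v w x y, R u v x y → ∃ z, R u w x z ∧ R w v z y := by
      intro u v w x y h
      obtain ⟨z, hz, h1, h2⟩ := hT _ (hnode u x x.2) _ (hnode v y y.2) w w.2 h
      exact ⟨⟨z, hz⟩, h1, h2⟩
    have hex : ∃ u v x y, R u v x y := by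
      obtain ⟨z, hz⟩ := hne
      have hzlt := hSlt z (hTS hz)
      have hMpos : 0 < M := by
        rcases Nat.eq_zero_or_pos M with h | h
        · rw [h] at hzlt; omega
        · exact h
      have hDpos : 0 < D := by
        rcases Nat.eq_zero_or_pos D with h | h
        · rw [hM, h] at hMpos; omega
        · exact h
      have h1 : z / M < M := (Nat.div_lt_iff_lt_mul hMpos).2 hzlt
      have h2 : z % M < M := Nat.mod_lt _ hMpos
      refine ⟨⟨z / M / D, (Nat.div_lt_iff_lt_mul hDpos).2 h1⟩,
        ⟨z % M / D, (Nat.div_lt_iff_lt_mul hDpos).2 h2⟩, ⟨z / M % D, Nat.mod_lt _ hDpos⟩,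
        ⟨z % M % D, Nat.mod_lt _ hDpos⟩, ?_⟩
      simp only [R, Nat.div_add_mod']
      exact hz
    obtain ⟨g, hg1, hg2⟩ := exists_solution_of_pathConsistent hcactus hdiag hpc hex
    refine hasPlanarConvexHullDrawing_of_tests (I.map f) (fun u => cand (g u)) (fun u => ?_)
      fun u w huw => ?_
    · exact ((hpair u u _ _ (g u).2 (g u).2).1 (hTS (hg1 u))).1
    · have hne := huw.ne
      refine (hg2 u w huw).imp (fun h => ?_) fun h => ?_
      · exact (((hpair u w _ _ (g u).2 (g w).2).1 (hTS h)).2.2.resolve_left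
          fun h => hne h.1).2
      · exact (((hpair w u _ _ (g w).2 (g u).2).1 (hTS h)).2.2.resolve_left
          fun h => hne h.1.symm).2
  · intro h
    obtain ⟨pos, hp1, hp2, hp3⟩ := exists_candidates (I.map f) hgp h
    choose g hg hgpos using fun u => I.exists_candidateAt (hp1 u)
    have hnm : Nonempty (Fin I.nm) := hcactus.1.nonempty
    obtain ⟨u₀⟩ := hnm
    -- All ordered pairs of nodes from one drawing. Any third vertex is supported by its own node,
    -- so this set is consistent and survives the filtering.
    set Z : Set ℕ := {z | ∃ u v : Fin I.nm, z = ((u : ℕ) * D + g u) * M + ((v : ℕ) * D + g v)}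
      with hZ
    have hZS : Z ⊆ S := by
      rintro _ ⟨u, v, rfl⟩
      refine (hpair u v _ _ (hg u) (hg v)).2 ?_
      have hcg : ∀ u : Fin I.nm, cand (g u) = pos u := hgpos
      rw [hcg u, hcg v]
      refine ⟨hp2 u, hp2 v, ?_⟩
      rcases eq_or_ne u v with rfl | huv
      · exact Or.inl ⟨rfl, rfl⟩
      · exact Or.inr ⟨huv, hp3 u v huv⟩
    refine ⟨_, hmax Z hZS ?_ ⟨u₀, u₀, rfl⟩⟩
    rintro i hi j hj w hw ⟨u, v, e⟩
    have h1 : i = (u : ℕ) * D + g u := by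
      rw [← node_div (w := i) hj, e, node_div (hnode v _ (hg v))]
    have h2 : j = (v : ℕ) * D + g v := by
      rw [← node_mod (w := i) hj, e, node_mod (hnode v _ (hg v))]
    subst h1 h2
    exact ⟨g ⟨w, hw⟩, hg _, ⟨u, ⟨w, hw⟩, rfl⟩, ⟨⟨w, hw⟩, v, rfl⟩⟩

theorem exists_exponent_answersWithin (hf : StrictMono f) {sz : K → ℕ} (hsz : SizeBound sz) :
    ∃ k : ℕ, ∀ (I : FMBigraph K) (N : ℕ), 2 ≤ N → I.nf ≤ N → I.nm ≤ N →
      (∀ i, PointSizeLe sz N (I.loc i)) → (I.map f).InGeneralPosition →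
      IsCactus (I.map f).chGraph →
      AnswersWithin sz drawingProgram I.input (N ^ k) (I.map f).HasPlanarConvexHullDrawing := by
  obtain ⟨k, hk⟩ := exists_exponent_drawingProgram hsz
  refine ⟨k, fun I N hN hnf hnm hloc hgp hcactus => ?_⟩
  obtain ⟨s', t, S, T, hrun, ht, h1, h2, h3, h4, h5, h6, h7⟩ := hk I N hN hnf hnm hloc
  have hiff := I.nonempty_iff_hasPlanarConvexHullDrawing hf hgp hcactus h1 h2 h3 h4 h5
  refine ⟨s', t, hrun, ht, ?_⟩
  by_cases h : T.Nonempty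
  · exact Or.inl ⟨hiff.1 h, h6 h⟩
  · exact Or.inr ⟨fun h' => h (hiff.2 h'), h7 h⟩

end Transfer

theorem mainTheorem2 :
    ∃ P : RamProgram,
      (∃ p : Polynomial ℕ, ∀ I : FMBigraph ℝ,
        I.InGeneralPosition → IsCactus I.chGraph →
          AnswersWithin (fun _ => 0) P I.input (p.eval (I.nf + I.nm))
            I.HasPlanarConvexHullDrawing) ∧
      (∃ q : Polynomial ℕ, ∀ I : FMBigraph ℚ,
        I.toReal.InGeneralPosition → IsCactus I.toReal.chGraph →
          AnswersWithin ratSize P I.input (q.eval I.bitSize)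
            I.toReal.HasPlanarConvexHullDrawing) := by
  refine ⟨drawingProgram, ?_, ?_⟩
  · obtain ⟨k, hk⟩ := exists_exponent_answersWithin (f := RingHom.id ℝ) strictMono_id sizeBound_zero
    -- The summand `2` ensures that the size parameter is at least `2`, even for tiny inputs.
    refine ⟨(Polynomial.X + 2) ^ k, fun I hgp hc => ?_⟩
    have h := hk I (I.nf + I.nm + 2) (by omega) (by omega) (by omega)
      (fun i => ⟨Nat.zero_le _, Nat.zero_le _⟩) hgp hc
    rw [show I.map (RingHom.id ℝ) = I from rfl] at h
    simpa using h
  · obtain ⟨k, hk⟩ := exists_exponent_answersWithin (f := Rat.castHom ℝ) Rat.cast_strictMono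
      sizeBound_ratSize
    refine ⟨(Polynomial.X + 2) ^ k, fun I hgp hc => ?_⟩
    have hle : ∀ i, ratSize (I.loc i).1 + ratSize (I.loc i).2 ≤ I.bitSize := fun i =>
      (Finset.single_le_sum (f := fun i => ratSize (I.loc i).1 + ratSize (I.loc i).2)
        (fun _ _ => Nat.zero_le _) (Finset.mem_univ i)).trans (Nat.le_add_left _ _)
    have hb : I.nf + I.nm ≤ I.bitSize := Nat.le_add_right _ _
    have h := hk I (I.bitSize + 2) (by omega) (by omega) (by omega)
      (fun i => ⟨by have := hle i; omega, by have := hle i; omega⟩) hgp hc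
    rw [show I.map (Rat.castHom ℝ) = I.toReal from rfl] at h
    simpa using h
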